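/- **Conventions.** A difference ring $(R,\sigma)$ is a commutative ring with a ring automorphism; $\mathrm{const}(R,\sigma)=\{c\in R\mid\sigma(c)=c\}$. It is *constant-stable* if $\mathrm{const}(R,\sigma^k)=\mathrm{const}(R,\sigma)$ for all $k\ge 1$. For $\mathbf a=(a_0,\dots,a_m)\in R^{m+1}$, $\mathbf f=(f_1,\dots,f_d)\in R^d$ and $C=\mathrm{const}(R,\sigma)$ let $$V(\mathbf a,\mathbf f,R)=\Big\{(c_1,\dots,c_d,g)\in C^d\times R\;\Big|\;\sum_{i=0}^m a_i\,\sigma^i(g)=\sum_{j=1}^d c_j f_j\Big\},$$ the $C$-module of solutions of a parameterized linear difference equation (PLDE). *One can solve PLDEs* in $(R,\sigma)$ if there is an algorithm that computes, for all $m,d\ge 0$, all $\mathbf 0\ne\mathbf a\in R^{m+1}$ and all $\mathbf f\in R^d$, a finite $C$-basis of $V(\mathbf a,\mathbf f,R)$. *One can solve non-degenerate PLDEs* if the same holds for all non-degenerate $\mathbf a$ (defined below) in place of all $\mathbf a\neq\mathbf 0$. $(R,\sigma)$ is *computable* if its elements are represented by natural numbers such that equality is decidable and the ring operations and $\sigma$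 are computable. **Setting.** Let $(\mathbb F,\sigma)$ be a constant-stable difference field with constant field $\mathbb K$, and let $(\mathbb E,\sigma)$ with $\mathbb E=\mathbb F[y]\langle t_1\rangle\cdots\langle t_e\rangle$, $e\ge0$, be a basic $R\Pi\Sigma$-ring extension of $(\mathbb F,\sigma)$ whose only $R$-monomial is $y$, of order $\lambda>1$, with $\alpha=\sigma(y)/y\in\mathbb K$. That is: $\sigma$ on $\mathbb E$ extends $\sigma$ on $\mathbb F$; $\mathrm{const}(\mathbb E,\sigma)=\mathbb K$; $\mathbb F[y]$ is the extension of $\mathbb F$ subject to the relation $y^\lambda=1$, and $\alpha$ is a primitive $\lambda$th root of unity; and, with $\mathbb A_i=\mathbb F[y]\langle t_1\rangle\cdots\langle t_i\rangle$, each $t_i$ is either a $\Sigma$-monomial ($\mathbb A_i=\mathbb A_{i-1}[t_i]$ is a polynomial ring and $\sigma(t_i)-t_i\in\mathbb A_{i-1}$) or a $\Pi$-monomial ($\mathbb A_i=\mathbb A_{i-1}[t_i,t_i^{-1}]$ is a Laurent polynomial ring and $\sigma(t_i)/t_i$ is the product of an element of $\mathbb F\setminus\{0\}$ and integer powers of $\Pi$-monomials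 $t_j$ with $j<i$). Let $\tilde{\mathbb E}=\mathbb F\langle t_1\rangle\cdots\langle t_e\rangle\subseteq\mathbb E$, let $\pi:\mathbb E\to\tilde{\mathbb E}$ be the substitution $y\mapsto\alpha^{\lambda-1}$ (the projection to the first of the $\lambda$ components of $\mathbb E=e_0\tilde{\mathbb E}\oplus\dots\oplus e_{\lambda-1}\tilde{\mathbb E}$, where $e_s=\prod_{0\le j<\lambda,\,j\ne\lambda-1-s}\frac{y-\alpha^j}{\alpha^{\lambda-1-s}-\alpha^j}$; one has $e_0f=e_0\pi(f)$), and let $\sigma_0$ be the automorphism $\sigma_0(f)=\pi(\sigma^\lambda(f))$ of $\tilde{\mathbb E}$; it extends $\sigma^\lambda$ on $\mathbb F$. $Q(\cdot)$ denotes the ring of fractions whose denominators are all non-zero-divisors; $\sigma$, $\sigma_0$, $\pi$ extend to $Q(\mathbb E)$, $Q(\tilde{\mathbb E})$ and to $Q(\mathbb E)\to Q(\tilde{\mathbb E})$ by acting on numerators and denominators. For $R=\mathbb E$ (resp. $R=Q(\mathbb E)$), $\mathbf a=(a_0,\dots,a_m)\in R^{m+1}$ is *non-degenerate* if the $((m+1)\lambda-m)\times(m+1)\lambda$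 matrix whose $j$th row, $0\le j<(m+1)\lambda-m$, is $(0,\dots,0,\pi(\sigma^j(a_0)),\dots,\pi(\sigma^j(a_m)),0,\dots,0)$ with $j$ leading zeros has linearly independent rows over $\tilde{\mathbb E}$ (resp. over $Q(\tilde{\mathbb E})$). **Proposition.** Suppose that $(\mathbb E,\sigma)$ is computable. Let the elements of $\tilde{\mathbb E}$ be represented in such a way that the inclusion $\tilde{\mathbb E}\subseteq\mathbb E$ is computable, and let the elements of $Q(\mathbb E)$ and $Q(\tilde{\mathbb E})$ be represented as fractions. 1. If one can solve PLDEs in $(\tilde{\mathbb E},\sigma_0)$, then one can solve non-degenerate PLDEs in $(\mathbb E,\sigma)$. 2. If one can solve PLDEs in $(Q(\tilde{\mathbb E}),\sigma_0)$, then one can solve non-degenerate PLDEs in $(Q(\mathbb E),\sigma)$. -/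

import Mathlib

namespace DifferenceRing

/-! ### Difference rings, constants and parameterized linear difference equations

A difference ring is a commutative ring `R` with a ring automorphism `σ : R ≃+* R`. -/

/-- The ring of constants `{c | σ c = c}` of the difference ring `(R, σ)`. -/
def constants {R : Type*} [CommRing R] (σ : R ≃+* R) : Subring R where
  carrier := {c | σ c = c}
  mul_mem' := by
    intro a b ha hb
    simp only [Set.mem_ofPred_eq] at *
    rw [map_mul, ha, hb]
  one_mem' := map_one σ
  add_mem' := by
    intro a b ha hb
    simp only [Set.mem_ofPred_eq] at *
    rw [map_add, ha, hb]
  zero_mem' := map_zero σ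
  neg_mem' := by
    intro a ha
    simp only [Set.mem_ofPred_eq] at *
    rw [map_neg, ha]

/-- `(R, σ)` is constant-stable: `σ ^ k` has the same constants as `σ`, for all `k ≥ 1`. -/
def ConstantStable {R : Type*} [CommRing R] (σ : R ≃+* R) : Prop :=
  ∀ k : ℕ, 0 < k → {x : R | σ^[k] x = x} = {x : R | σ x = x}

/-- The solution space `V(a, f, R)`: all `(c₁, …, c_d, g)` with constants `c_j` and `g` in `R`
such that `a₀ g + a₁ σ(g) + ⋯ + a_m σ^m(g) = c₁ f₁ + ⋯ + c_d f_d`. -/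
def pldeSpace {R : Type*} [CommRing R] (σ : R ≃+* R) {m d : ℕ} (a : Fin (m + 1) → R)
    (f : Fin d → R) : Submodule (constants σ) ((Fin d → constants σ) × R) where
  carrier := {p | ∑ i, a i * σ^[i] p.2 = ∑ j, (p.1 j : R) * f j}
  add_mem' := by
    intro p q hp hq
    simp only [Set.mem_ofPred_eq, Prod.snd_add, Prod.fst_add, Pi.add_apply, Subring.coe_add,
      iterate_map_add, mul_add, add_mul, Finset.sum_add_distrib] at *
    rw [hp, hq]
  zero_mem' := by simp
  smul_mem' := by
    intro c p hp
    have hc : ∀ k : ℕ, σ^[k] (c : R) = c := fun k => Function.iterate_fixed c.2 k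
    simp only [Set.mem_ofPred_eq, Prod.smul_snd, Prod.smul_fst, Pi.smul_apply, smul_eq_mul,
      Subring.coe_mul, Subring.smul_def, iterate_map_mul, hc] at *
    calc ∑ i, a i * ((c : R) * σ^[i] p.2) = c * ∑ i, a i * σ^[i] p.2 := by
          rw [Finset.mul_sum]; exact Finset.sum_congr rfl fun i _ => by ring
      _ = ∑ j, (c : R) * (p.1 j : R) * f j := by
          rw [hp, Finset.mul_sum]; exact Finset.sum_congr rfl fun i _ => by ring

/-! ### `RΠΣ`-ring extensions -/

/-- The three kinds of monomials: `R`-monomials of order `ν`, `Π`-monomials, `Σ`-monomials. -/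
inductive MonomialKind
  | rootOfUnity (ν : ℕ)
  | product
  | sum

/-- `B[t]` is a ring extension of `B` subject to the relation `t ^ ν = 1` for some `ν > 1`, and
`σ(t) / t ∈ B` is a primitive `ν`-th root of unity. -/
def IsRMonomial {A E : Type*} [CommRing A] [CommRing E] [Algebra A E] (B : Subalgebra A E)
    (σ : E ≃+* E) (ν : ℕ) (t : E) : Prop :=
  1 < ν ∧ t ^ ν = 1 ∧ LinearIndependent B (fun k : Fin ν => t ^ (k : ℕ)) ∧
    ∃ α : B, IsPrimitiveRoot α ν ∧ σ t = (α : E) * t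

/-- `B[t, t⁻¹]` is a ring of Laurent polynomials over `B`, and `σ(t) / t` is a unit of `B`. -/
def IsPiMonomial {A E : Type*} [CommRing A] [CommRing E] [Algebra A E] (B : Subalgebra A E)
    (σ : E ≃+* E) (t : E) : Prop :=
  (∃ u : Eˣ, (u : E) = t ∧ LinearIndependent B (fun k : ℤ => ((u ^ k : Eˣ) : E))) ∧
    ∃ α : Bˣ, σ t = ((α : B) : E) * t

/-- `B[t]` is a polynomial ring over `B`, and `σ(t) - t ∈ B`. -/
def IsSigmaMonomial {A E : Type*} [CommRing A] [CommRing E] [Algebra A E] (B : Subalgebra A E)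
    (σ : E ≃+* E) (t : E) : Prop :=
  LinearIndependent B (fun k : ℕ => t ^ k) ∧ ∃ β : B, σ t = t + (β : E)

/-- The subring `A⟨t₀⟩⋯⟨t_{i-1}⟩` of `E`, generated over `A` by the `t_j` with `j < i` and by the
inverses of the `Π`-monomials among them. -/
def tower (A : Type*) {E : Type*} [CommRing A] [CommRing E] [Algebra A E] {n : ℕ}
    (kind : Fin n → MonomialKind) (t : Fin n → E) (i : ℕ) : Subalgebra A E :=
  Algebra.adjoin A {x | ∃ j : Fin n, (j : ℕ) < i ∧
    (x = t j ∨ (kind j = .product ∧ x * t j = 1))}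

/-- `(E, σ)` with `E = A⟨t₀⟩⋯⟨t_{n-1}⟩` is an `RΠΣ`-ring extension of `(A, σA)`. -/
structure IsRPiSigmaExtension {A E : Type*} [CommRing A] [CommRing E] [Algebra A E]
    (σA : A ≃+* A) (σ : E ≃+* E) {n : ℕ} (kind : Fin n → MonomialKind) (t : Fin n → E) :
    Prop where
  injective : Function.Injective (algebraMap A E)
  extends_aut : ∀ a : A, σ (algebraMap A E a) = algebraMap A E (σA a)
  tower_eq_top : tower A kind t n = ⊤
  constants_eq : ∀ x : E, σ x = x → ∃ c : A, σA c = c ∧ algebraMap A E c = x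
  rootOfUnity : ∀ i ν, kind i = .rootOfUnity ν → IsRMonomial (tower A kind t i) σ ν (t i)
  product : ∀ i, kind i = .product → IsPiMonomial (tower A kind t i) σ (t i)
  sum : ∀ i, kind i = .sum → IsSigmaMonomial (tower A kind t i) σ (t i)

/-- The product group of `A⟨t₀⟩⋯⟨t_{i-1}⟩` over `A`: all `f t₀^{m₀} ⋯ t_{i-1}^{m_{i-1}}` with a
unit `f` of `A` and integers `m_j`, where `m_j = 0` unless `t_j` is a `Π`-monomial. -/
def productGroup (A : Type*) {E : Type*} [CommRing A] [CommRing E] [Algebra A E] {n : ℕ}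
    (kind : Fin n → MonomialKind) (t : Fin n → E) (i : ℕ) : Subgroup Eˣ :=
  Subgroup.closure ({u | ∃ f : Aˣ, (u : E) = algebraMap A E f} ∪
    {u | ∃ j : Fin n, (j : ℕ) < i ∧ kind j = .product ∧ (u : E) = t j})

/-- Basic `RΠΣ`-ring extensions: `σ(t) / t` lies in the product group of the ring below for each
`Π`-monomial `t`, and it is a unit among the constants of `A` for each `R`-monomial `t`. -/
structure IsBasicExtension {A E : Type*} [CommRing A] [CommRing E] [Algebra A E]
    (σA : A ≃+* A) (σ : E ≃+* E) {n : ℕ} (kind : Fin n → MonomialKind) (t : Fin n → E) : Prop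
    extends IsRPiSigmaExtension σA σ kind t where
  product_basic : ∀ i, kind i = .product →
    ∃ u ∈ productGroup A kind t i, σ (t i) = (u : E) * t i
  rootOfUnity_basic : ∀ i ν, kind i = .rootOfUnity ν →
    ∃ c : A, IsUnit c ∧ σA c = c ∧ σ (t i) = algebraMap A E c * t i

/-- `E = F[y]⟨t₁⟩⋯⟨t_e⟩` is a basic `RΠΣ`-ring extension of the difference field `(F, σF)` where
`y = t 0` is an `R`-monomial of order `lam` with `σ(y) / y = α`, and `t 1, …, t e` are
`ΠΣ`-monomials. -/
structure IsSingleRExtension {F E : Type*} [Field F] [CommRing E] [Algebra F E]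
    (σF : F ≃+* F) (σ : E ≃+* E) {e : ℕ} (kind : Fin (e + 1) → MonomialKind)
    (t : Fin (e + 1) → E) (lam : ℕ) (α : F) : Prop
    extends IsBasicExtension σF σ kind t where
  kind_zero : kind 0 = .rootOfUnity lam
  kind_ne_zero : ∀ i, i ≠ 0 → kind i = .product ∨ kind i = .sum
  apply_zero : σ (t 0) = algebraMap F E α * t 0

/-! ### The subring `F⟨t₁⟩⋯⟨t_e⟩` and the projection `y ↦ α ^ (lam - 1)` -/

/-- `F⟨t₁⟩⋯⟨t_{i-1}⟩` (the `R`-monomial `t 0` is left out). -/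
def tildeTower (F : Type*) {E : Type*} [CommRing F] [CommRing E] [Algebra F E] {e : ℕ}
    (kind : Fin (e + 1) → MonomialKind) (t : Fin (e + 1) → E) (i : ℕ) : Subalgebra F E :=
  Algebra.adjoin F {x | ∃ j : Fin (e + 1), j ≠ 0 ∧ (j : ℕ) < i ∧
    (x = t j ∨ (kind j = .product ∧ x * t j = 1))}

/-- The subring `Ẽ = F⟨t₁⟩⋯⟨t_e⟩` of `E`. -/
abbrev tilde (F : Type*) {E : Type*} [CommRing F] [CommRing E] [Algebra F E] {e : ℕ}
    (kind : Fin (e + 1) → MonomialKind) (t : Fin (e + 1) → E) : Subalgebra F E :=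
  tildeTower F kind t (e + 1)

section aux

theorem tildeTower_le_tower {F E : Type*} [CommRing F] [CommRing E] [Algebra F E] {e : ℕ}
    (kind : Fin (e + 1) → MonomialKind) (t : Fin (e + 1) → E) (i : ℕ) :
    tildeTower F kind t i ≤ tower F kind t i :=
  Algebra.adjoin_mono fun _ ⟨j, _, hj, hx⟩ => ⟨j, hj, hx⟩

theorem tildeTower_mono {F E : Type*} [CommRing F] [CommRing E] [Algebra F E] {e : ℕ}
    (kind : Fin (e + 1) → MonomialKind) (t : Fin (e + 1) → E) {i k : ℕ} (h : i ≤ k) :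
    tildeTower F kind t i ≤ tildeTower F kind t k :=
  Algebra.adjoin_mono fun _ ⟨j, h0, hj, hx⟩ => ⟨j, h0, hj.trans_le h, hx⟩

theorem eq_zero_of_mem_span {F E ι : Type*} [CommRing F] [CommRing E] [Algebra F E]
    {B C : Subalgebra F E} (hCB : C ≤ B) {q : E} (hq : q ∈ B) {v : ι → E}
    (hv : LinearIndependent B v) (hC : ∀ b ∈ C, q * b = 0 → b = 0) {x : E}
    (hx : x ∈ Submodule.span C (Set.range v)) (hqx : q * x = 0) : x = 0 := by
  obtain ⟨c, rfl⟩ := Finsupp.mem_span_range_iff_exists_finsupp.1 hx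
  rw [Finsupp.sum, Finset.mul_sum] at hqx
  rw [linearIndependent_iff'] at hv
  have h := hv c.support (fun i => ⟨q * (c i : E), B.mul_mem hq (hCB (c i).2)⟩) (by
    rw [← hqx]
    refine Finset.sum_congr rfl fun i _ => ?_
    simp only [Subalgebra.smul_def, smul_eq_mul]
    ring)
  refine Finset.sum_eq_zero fun i hi => ?_
  have h1 := congrArg Subtype.val (h i hi)
  simp only [Subalgebra.smul_def]
  rw [hC _ (c i).2 (by simpa using h1), zero_smul]

theorem mem_span_of_mem_tildeTower {F E ι : Type*} [CommRing F] [CommRing E] [Algebra F E]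
    {e : ℕ} (kind : Fin (e + 1) → MonomialKind) (t : Fin (e + 1) → E) {i : ℕ} {v : ι → E}
    (hone : 1 ∈ Set.range v)
    (hmul : ∀ a ∈ Set.range v, ∀ b ∈ Set.range v, a * b ∈ Set.range v)
    (hgen : ∀ j : Fin (e + 1), (j : ℕ) = i → ∀ x : E,
      (x = t j ∨ (kind j = .product ∧ x * t j = 1)) → x ∈ Set.range v) {x : E}
    (hx : x ∈ tildeTower F kind t (i + 1)) :
    x ∈ Submodule.span (tildeTower F kind t i) (Set.range v) := by
  have hC : ∀ c ∈ tildeTower F kind t i,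
      c ∈ Submodule.span (tildeTower F kind t i) (Set.range v) := by
    intro c hc
    have := Submodule.smul_mem _ (⟨c, hc⟩ : tildeTower F kind t i)
      (Submodule.subset_span (R := tildeTower F kind t i) hone)
    simpa [Subalgebra.smul_def] using this
  induction hx using Algebra.adjoin_induction with
  | mem x hx =>
    obtain ⟨j, h0, hj, hx⟩ := hx
    rcases Nat.lt_succ_iff_lt_or_eq.1 hj with hj | hj
    · exact hC _ (Algebra.subset_adjoin ⟨j, h0, hj, hx⟩)
    · exact Submodule.subset_span (hgen j hj x hx)
  | algebraMap r => exact hC _ (Subalgebra.algebraMap_mem _ r)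
  | add x y _ _ hx hy => exact Submodule.add_mem _ hx hy
  | mul x y _ _ hx hy =>
    have h := Submodule.mul_mem_mul hx hy
    rw [Submodule.span_mul_span] at h
    refine Submodule.span_mono ?_ h
    rintro _ ⟨a, ha, b, hb, rfl⟩
    exact hmul a ha b hb

/-- The cofactor of `y - ζ` in `y ^ lam - 1`. -/
def cofactor {F E : Type*} [CommRing F] [CommRing E] [Algebra F E] (lam : ℕ) (ζ : F) (y : E) :
    E :=
  ∑ k ∈ Finset.range lam, y ^ k * algebraMap F E ζ ^ (lam - 1 - k)

/-- The idempotents `e_s`, for `0 ≤ s < lam`: the product of the `y - α ^ j` with `j < lam` and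
`j ≠ lam - 1 - s`, divided by its value at `y = α ^ (lam - 1 - s)`. -/
def idem {F E : Type*} [Field F] [CommRing E] [Algebra F E] (lam : ℕ) (α : F) (y : E) (s : ℕ) :
    E :=
  algebraMap F E (∏ j ∈ (Finset.range lam).erase (lam - 1 - s), (α ^ (lam - 1 - s) - α ^ j))⁻¹ *
    ∏ j ∈ (Finset.range lam).erase (lam - 1 - s), (y - algebraMap F E (α ^ j))

end aux

namespace IsSingleRExtension

variable {F E : Type*} [Field F] [CommRing E] [Algebra F E]
  {σF : F ≃+* F} {σ : E ≃+* E} {e : ℕ} {kind : Fin (e + 1) → MonomialKind}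
  {t : Fin (e + 1) → E} {lam : ℕ} {α : F}

theorem isRMonomial (h : IsSingleRExtension σF σ kind t lam α) :
    IsRMonomial (tower F kind t 0) σ lam (t 0) :=
  h.rootOfUnity 0 lam h.kind_zero

theorem one_lt (h : IsSingleRExtension σF σ kind t lam α) : 1 < lam := h.isRMonomial.1

theorem y_pow (h : IsSingleRExtension σF σ kind t lam α) : t 0 ^ lam = 1 := h.isRMonomial.2.1

theorem isUnit_y (h : IsSingleRExtension σF σ kind t lam α) : IsUnit (t 0) :=
  IsUnit.of_pow_eq_one h.y_pow (by have := h.one_lt; omega)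

theorem isPrimitiveRoot (h : IsSingleRExtension σF σ kind t lam α) : IsPrimitiveRoot α lam := by
  obtain ⟨-, -, -, β, hβ, hσ⟩ := h.isRMonomial
  have h1 : (β : E) = algebraMap F E α := by
    apply h.isUnit_y.mul_right_cancel
    rw [← hσ, h.apply_zero]
  have h2 : IsPrimitiveRoot (algebraMap F E α) lam := by
    rw [← h1]
    exact hβ.map_of_injective (f := (tower F kind t 0).val) Subtype.val_injective
  exact h2.of_map_of_injective h.injective

theorem map_α (h : IsSingleRExtension σF σ kind t lam α) : σF α = α := by
  obtain ⟨c, -, hc, hσ⟩ := h.rootOfUnity_basic 0 lam h.kind_zero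
  have h1 : algebraMap F E c = algebraMap F E α := by
    apply h.isUnit_y.mul_right_cancel
    rw [← hσ, h.apply_zero]
  rwa [← h.injective h1]

theorem root_pow (h : IsSingleRExtension σF σ kind t lam α) : (α ^ (lam - 1)) ^ lam = 1 := by
  rw [← pow_mul, mul_comm, pow_mul, h.isPrimitiveRoot.pow_eq_one, one_pow]

theorem cofactor_mul (h : IsSingleRExtension σF σ kind t lam α) :
    cofactor lam (α ^ (lam - 1)) (t 0) * (t 0 - algebraMap F E (α ^ (lam - 1))) = 0 := by
  rw [cofactor, (Commute.all _ _).geom_sum₂_mul, h.y_pow, ← map_pow, h.root_pow, map_one,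
    sub_self]

theorem eq_zero_of_cofactor_mul (h : IsSingleRExtension σF σ kind t lam α) (i : ℕ)
    (hi : i ≤ e) : ∀ x ∈ tildeTower F kind t (i + 1),
      cofactor lam (α ^ (lam - 1)) (t 0) * x = 0 → x = 0 := by
  induction i with
  | zero =>
    intro x hx hqx
    have hbot : tildeTower F kind t (0 + 1) = ⊥ := by
      rw [tildeTower, ← Algebra.adjoin_empty]
      congr 1
      ext x
      simp only [Set.mem_ofPred_eq, Set.mem_empty_iff_false, iff_false, not_exists]
      rintro j ⟨h0, hj, -⟩
      exact h0 (Fin.ext (by simpa using hj))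
    rw [hbot] at hx
    obtain ⟨r, rfl⟩ := Algebra.mem_bot.1 hx
    have hlin := h.isRMonomial.2.2.1
    rw [Fintype.linearIndependent_iff] at hlin
    have hl := h.one_lt
    have h1 := hlin
      (fun k => algebraMap F (tower F kind t 0) ((α ^ (lam - 1)) ^ (lam - 1 - (k : ℕ)) * r)) (by
        rw [← hqx, cofactor, Finset.sum_mul, Finset.sum_range]
        refine Finset.sum_congr rfl fun k _ => ?_
        rw [Subalgebra.smul_def, Subalgebra.coe_algebraMap, smul_eq_mul, map_mul, map_pow]
        ring) ⟨lam - 1, by omega⟩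
    have h2 := congrArg Subtype.val h1
    simpa using h2
  | succ i ih =>
    intro x hx hqx
    have hq : cofactor lam (α ^ (lam - 1)) (t 0) ∈ tower F kind t (i + 1) := by
      refine Subalgebra.sum_mem _ fun k _ => Subalgebra.mul_mem _ (Subalgebra.pow_mem _ ?_ _)
        (Subalgebra.pow_mem _ (Subalgebra.algebraMap_mem _ _) _)
      exact Algebra.subset_adjoin ⟨0, by simp, Or.inl rfl⟩
    set j : Fin (e + 1) := ⟨i + 1, by omega⟩ with hj
    have hj0 : j ≠ 0 := by simp [hj, Fin.ext_iff]
    rcases h.kind_ne_zero j hj0 with hk | hk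
    · obtain ⟨⟨u, hu, hlin⟩, -⟩ := h.product j hk
      refine eq_zero_of_mem_span (tildeTower_le_tower kind t (i + 1)) hq hlin
        (ih (by omega)) (mem_span_of_mem_tildeTower kind t ⟨0, by simp⟩ ?_ ?_ hx) hqx
      · rintro _ ⟨a, rfl⟩ _ ⟨b, rfl⟩
        exact ⟨a + b, by simp [zpow_add]⟩
      · intro j' hj' x hx
        obtain rfl : j' = j := Fin.ext hj'
        rcases hx with rfl | ⟨-, hx⟩
        · exact ⟨1, by simp [hu]⟩
        · refine ⟨-1, ?_⟩
          rw [← hu] at hx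
          simp only [zpow_neg, zpow_one]
          exact (Units.eq_inv_of_mul_eq_one_right hx).symm
    · obtain ⟨hlin, -⟩ := h.sum j hk
      refine eq_zero_of_mem_span (tildeTower_le_tower kind t (i + 1)) hq hlin
        (ih (by omega)) (mem_span_of_mem_tildeTower kind t ⟨0, by simp⟩ ?_ ?_ hx) hqx
      · rintro _ ⟨a, rfl⟩ _ ⟨b, rfl⟩
        exact ⟨a + b, by simp [pow_add]⟩
      · intro j' hj' x hx
        obtain rfl : j' = j := Fin.ext hj'
        rcases hx with rfl | ⟨hx, -⟩
        · exact ⟨1, by simp⟩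
        · rw [hk] at hx; cases hx

theorem substitution_bijective (h : IsSingleRExtension σF σ kind t lam α) :
    Function.Bijective ((Ideal.Quotient.mkₐ F
      (Ideal.span {t 0 - algebraMap F E (α ^ (lam - 1))})).comp (tilde F kind t).val) := by
  constructor
  · rw [injective_iff_map_eq_zero]
    intro x hx
    have h1 : (x : E) ∈ Ideal.span {t 0 - algebraMap F E (α ^ (lam - 1))} :=
      Ideal.Quotient.eq_zero_iff_mem.1 hx
    obtain ⟨b, hb⟩ := Ideal.mem_span_singleton'.1 h1
    refine Subtype.ext (h.eq_zero_of_cofactor_mul e le_rfl x x.2 ?_)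
    rw [← hb, mul_left_comm, h.cofactor_mul, mul_zero]
  · have key : (⊤ : Subalgebra F E) ≤ (((Ideal.Quotient.mkₐ F
        (Ideal.span {t 0 - algebraMap F E (α ^ (lam - 1))})).comp
          (tilde F kind t).val).range).comap (Ideal.Quotient.mkₐ F _) := by
      rw [← h.tower_eq_top, tower, Algebra.adjoin_le_iff]
      rintro x ⟨j, hj, hx⟩
      by_cases hj0 : j = 0
      · subst hj0
        rcases hx with rfl | ⟨hx, -⟩
        · refine ⟨algebraMap F _ (α ^ (lam - 1)), ?_⟩
          symm
          exact Ideal.Quotient.eq.2 (Ideal.subset_span rfl)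
        · rw [h.kind_zero] at hx; cases hx
      · exact ⟨⟨x, Algebra.subset_adjoin ⟨j, hj0, hj, hx⟩⟩, rfl⟩
    intro z
    obtain ⟨x, rfl⟩ := Ideal.Quotient.mk_surjective z
    exact key (Algebra.mem_top (x := x))

/-- The substitution `f ↦ f|_{y → α ^ (lam - 1)}` from `E` onto `Ẽ`, where `y = t 0`: it maps `y`
to `α ^ (lam - 1)` and fixes the elements of `Ẽ`. This is the projection `π` onto the first
component of `E = e₀ Ẽ ⊕ ⋯ ⊕ e_{lam-1} Ẽ`. -/
noncomputable def proj (h : IsSingleRExtension σF σ kind t lam α) : E →ₐ[F] tilde F kind t :=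
  ((AlgEquiv.ofBijective _ h.substitution_bijective).symm : _ →ₐ[F] _).comp
    (Ideal.Quotient.mkₐ F (Ideal.span {t 0 - algebraMap F E (α ^ (lam - 1))}))

theorem proj_coe (h : IsSingleRExtension σF σ kind t lam α) (x : tilde F kind t) :
    h.proj (x : E) = x :=
  (AlgEquiv.ofBijective _ h.substitution_bijective).symm_apply_apply x

theorem proj_y (h : IsSingleRExtension σF σ kind t lam α) :
    h.proj (t 0) = algebraMap F _ (α ^ (lam - 1)) := by
  rw [← h.proj.commutes]
  have h1 : Ideal.Quotient.mkₐ F (Ideal.span {t 0 - algebraMap F E (α ^ (lam - 1))}) (t 0) =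
      Ideal.Quotient.mkₐ F (Ideal.span {t 0 - algebraMap F E (α ^ (lam - 1))})
        (algebraMap F E (α ^ (lam - 1))) :=
    Ideal.Quotient.eq.2 (Ideal.subset_span rfl)
  simp only [proj, AlgHom.comp_apply, h1]

theorem proj_eq_zero_iff (h : IsSingleRExtension σF σ kind t lam α) (x : E) :
    h.proj x = 0 ↔ ∃ b, x = b * (t 0 - algebraMap F E (α ^ (lam - 1))) := by
  have : h.proj x = 0 ↔ x ∈ Ideal.span {t 0 - algebraMap F E (α ^ (lam - 1))} := by
    rw [← Ideal.Quotient.eq_zero_iff_mem]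
    exact map_eq_zero_iff _ (AlgEquiv.ofBijective _ h.substitution_bijective).symm.injective
  rw [this, Ideal.mem_span_singleton']
  exact ⟨fun ⟨b, hb⟩ => ⟨b, hb.symm⟩, fun ⟨b, hb⟩ => ⟨b, hb.symm⟩⟩

/-- The projection agrees with the identity on the component on which `y` acts as
`α ^ (lam - 1)`. -/
theorem cofactor_mul_proj (h : IsSingleRExtension σF σ kind t lam α) (x : E) :
    cofactor lam (α ^ (lam - 1)) (t 0) * (h.proj x : E) =
      cofactor lam (α ^ (lam - 1)) (t 0) * x := by
  obtain ⟨b, hb⟩ := (h.proj_eq_zero_iff ((h.proj x : E) - x)).1 (by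
    rw [map_sub, h.proj_coe, sub_self])
  rw [← sub_eq_zero, ← mul_sub, hb, mul_left_comm, h.cofactor_mul, mul_zero]

theorem prod_sub_root (h : IsSingleRExtension σF σ kind t lam α) :
    ∏ j ∈ Finset.range lam, (t 0 - algebraMap F E (α ^ j)) = 0 := by
  classical
  have hp := h.isPrimitiveRoot
  have hpos : 0 < lam := by have := h.one_lt; omega
  have himg : Polynomial.nthRootsFinset lam (1 : F) =
      (Finset.range lam).image (fun j => α ^ j) := by
    symm
    apply Finset.eq_of_subset_of_card_le
    · intro x hx
      obtain ⟨j, -, rfl⟩ := Finset.mem_image.1 hx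
      rw [Polynomial.mem_nthRootsFinset hpos, ← pow_mul, mul_comm, pow_mul, hp.pow_eq_one, one_pow]
    · rw [hp.card_nthRootsFinset, Finset.card_image_of_injOn, Finset.card_range]
      intro i hi j hj hij
      exact hp.pow_inj (by simpa using hi) (by simpa using hj) hij
  have h1 := congrArg (Polynomial.aeval (t 0)) (Polynomial.X_pow_sub_one_eq_prod hpos hp)
  rw [himg, Finset.prod_image (fun i hi j hj hij =>
    hp.pow_inj (by simpa using hi) (by simpa using hj) hij)] at h1
  simpa [map_prod, h.y_pow] using h1.symm

theorem idem_zero_mul (h : IsSingleRExtension σF σ kind t lam α) :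
    idem lam α (t 0) 0 * (t 0 - algebraMap F E (α ^ (lam - 1))) = 0 := by
  have hl := h.one_lt
  rw [idem, mul_assoc, Nat.sub_zero, Finset.prod_erase_mul _ _ (by simp; omega), h.prod_sub_root,
    mul_zero]

/-- `π(x)` is the first component of `x`: it is an element of `Ẽ` with `e₀ x = e₀ π(x)`. -/
theorem idem_zero_mul_proj (h : IsSingleRExtension σF σ kind t lam α) (x : E) :
    idem lam α (t 0) 0 * (h.proj x : E) = idem lam α (t 0) 0 * x := by
  obtain ⟨b, hb⟩ := (h.proj_eq_zero_iff ((h.proj x : E) - x)).1 (by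
    rw [map_sub, h.proj_coe, sub_self])
  rw [← sub_eq_zero, ← mul_sub, hb, mul_left_comm, h.idem_zero_mul, mul_zero]

theorem iterate_y (h : IsSingleRExtension σF σ kind t lam α) (k : ℕ) :
    σ^[k] (t 0) = algebraMap F E α ^ k * t 0 := by
  induction k with
  | zero => simp
  | succ k ih =>
    rw [Function.iterate_succ_apply', ih, map_mul, map_pow, h.extends_aut, h.map_α, h.apply_zero]
    ring

theorem iterate_lam_root (h : IsSingleRExtension σF σ kind t lam α) :
    σ^[lam] (t 0 - algebraMap F E (α ^ (lam - 1))) = t 0 - algebraMap F E (α ^ (lam - 1)) := by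
  have h1 : σ (algebraMap F E (α ^ (lam - 1))) = algebraMap F E (α ^ (lam - 1)) := by
    rw [h.extends_aut, map_pow, h.map_α]
  rw [iterate_map_sub, h.iterate_y, Function.iterate_fixed h1, ← map_pow,
    h.isPrimitiveRoot.pow_eq_one, map_one, one_mul]

theorem proj_iterate_proj (h : IsSingleRExtension σF σ kind t lam α) (τ : E ≃+* E)
    (hτ : τ (t 0 - algebraMap F E (α ^ (lam - 1))) = t 0 - algebraMap F E (α ^ (lam - 1)))
    (x : E) : h.proj (τ (h.proj x : E)) = h.proj (τ x) := by
  obtain ⟨b, hb⟩ := (h.proj_eq_zero_iff ((h.proj x : E) - x)).1 (by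
    rw [map_sub, h.proj_coe, sub_self])
  rw [← sub_eq_zero, ← map_sub, ← map_sub, hb, h.proj_eq_zero_iff]
  exact ⟨τ b, by rw [map_mul, hτ]⟩

/-- The automorphism `σ₀` of `Ẽ`, given by `σ₀(f) = σ^lam(f)|_{y → α ^ (lam - 1)}`; so
`σ₀(f) = σ^lam(f)` for `f` in `F`, and `σ₀(t_i) = σ^lam(t_i)|_{y → α ^ (lam - 1)}`. -/
noncomputable def sigmaZero (h : IsSingleRExtension σF σ kind t lam α) :
    tilde F kind t ≃+* tilde F kind t where
  toFun f := h.proj (σ^[lam] (f : E))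
  invFun f := h.proj (σ.symm^[lam] (f : E))
  left_inv f := by
    have e1 : ∀ x, (σ.symm ^ lam : RingAut E) x = σ.symm^[lam] x := fun x => by
      rw [← RingAut.coe_pow]
    have hr : σ.symm^[lam] (t 0 - algebraMap F E (α ^ (lam - 1))) =
        t 0 - algebraMap F E (α ^ (lam - 1)) := by
      conv_lhs => rw [← h.iterate_lam_root]
      exact Function.LeftInverse.iterate σ.symm_apply_apply lam _
    have := h.proj_iterate_proj (σ.symm ^ lam : RingAut E) (by rw [e1, hr]) (σ^[lam] (f : E))
    rw [e1, e1, Function.LeftInverse.iterate σ.symm_apply_apply lam, h.proj_coe] at this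
    exact this
  right_inv f := by
    have e1 : ∀ x, (σ ^ lam : RingAut E) x = σ^[lam] x := fun x => by
      rw [← RingAut.coe_pow]
    have := h.proj_iterate_proj (σ ^ lam : RingAut E) (by rw [e1, h.iterate_lam_root])
      (σ.symm^[lam] (f : E))
    rw [e1, e1, Function.LeftInverse.iterate σ.apply_symm_apply lam, h.proj_coe] at this
    exact this
  map_mul' f g := by simp only [MulMemClass.coe_mul, iterate_map_mul, map_mul]
  map_add' f g := by simp only [AddMemClass.coe_add, iterate_map_add, map_add]

theorem iterate_lam_idem (h : IsSingleRExtension σF σ kind t lam α) (s : ℕ) :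
    σ^[lam] (idem lam α (t 0) s) = idem lam α (t 0) s := by
  have hα : ∀ (k : ℕ) (c : F), σF c = c → σ^[k] (algebraMap F E c) = algebraMap F E c :=
    fun k c hc => Function.iterate_fixed (by rw [h.extends_aut, hc]) k
  have e1 : ∀ x, (σ ^ lam : RingAut E) x = σ^[lam] x := fun x => by rw [← RingAut.coe_pow]
  have e2 : σ^[lam] (t 0) = t 0 := by
    rw [h.iterate_y, ← map_pow, h.isPrimitiveRoot.pow_eq_one, map_one, one_mul]
  rw [idem, ← e1, map_mul, map_prod]
  congr 1
  · rw [e1, hα]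
    simp [map_prod, h.map_α]
  · refine Finset.prod_congr rfl fun j _ => ?_
    rw [map_sub, e1, e1, e2, hα _ _ (by rw [map_pow, h.map_α])]

/-- `f ↦ e₀ f` is an isomorphism of difference rings from `(Ẽ, σ₀)` to `(e₀ E, σ ^ lam)`. -/
theorem idem_zero_mul_sigmaZero (h : IsSingleRExtension σF σ kind t lam α)
    (f : tilde F kind t) :
    idem lam α (t 0) 0 * (h.sigmaZero f : E) = σ^[lam] (idem lam α (t 0) 0 * (f : E)) := by
  rw [iterate_map_mul, h.iterate_lam_idem]
  exact h.idem_zero_mul_proj _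

theorem nonZeroDivisors_le_comap (h : IsSingleRExtension σF σ kind t lam α) :
    nonZeroDivisors E ≤ (nonZeroDivisors (tilde F kind t)).comap
      (h.proj : E →+* tilde F kind t) := by
  intro b hb
  rw [Submonoid.mem_comap, mem_nonZeroDivisors_iff_right]
  intro x hx
  refine Subtype.ext (h.eq_zero_of_cofactor_mul e le_rfl x x.2 ?_)
  refine (mem_nonZeroDivisors_iff_right.1 hb) _ ?_
  have hx' : (x : E) * (h.proj b : E) = 0 := congrArg Subtype.val hx
  rw [mul_right_comm, ← h.cofactor_mul_proj b, mul_assoc, mul_comm (h.proj b : E), hx', mul_zero]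

/-- The projection `Q(E) → Q(Ẽ)`, `a / b ↦ π(a) / π(b)`. -/
noncomputable def fracProj (h : IsSingleRExtension σF σ kind t lam α) :
    FractionRing E →+* FractionRing (tilde F kind t) :=
  IsLocalization.map (FractionRing (tilde F kind t)) (h.proj : E →+* tilde F kind t)
    h.nonZeroDivisors_le_comap

end IsSingleRExtension

/-! ### Rings of fractions -/

/-- The automorphism `a / b ↦ σ(a) / σ(b)` of the ring of fractions `Q(R)`, whose denominators are
all the elements of `R` that are not zero divisors. -/
noncomputable def fracAut {R : Type*} [CommRing R] (σ : R ≃+* R) :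
    FractionRing R ≃+* FractionRing R :=
  IsLocalization.ringEquivOfRingEquiv (M := nonZeroDivisors R) (T := nonZeroDivisors R)
    (FractionRing R) (FractionRing R) σ (MulEquivClass.map_nonZeroDivisors σ)

/-! ### Non-degenerate equations -/

/-- The shift projection matrix of `a = (a₀, …, a_m)` for a projection `π` of an idempotent
difference ring of order `lam`: it has `(m + 1) lam - m` rows and `(m + 1) lam` columns, and row
`j` is `(0, …, 0, π(σ^j a₀), …, π(σ^j a_m), 0, …, 0)` with `j` leading zeros. -/
def shiftProjectionMatrix {R S : Type*} [CommRing R] [CommRing S] (σ : R ≃+* R) (π : R →+* S)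
    (lam : ℕ) {m : ℕ} (a : Fin (m + 1) → R) :
    Matrix (Fin ((m + 1) * lam - m)) (Fin ((m + 1) * lam)) S :=
  fun j c => if hc : (j : ℕ) ≤ c ∧ (c : ℕ) - j < m + 1 then π (σ^[j] (a ⟨c - j, hc.2⟩)) else 0

/-- `a` is non-degenerate: the rows of its shift projection matrix are linearly independent. -/
def NonDegenerate {R S : Type*} [CommRing R] [CommRing S] (σ : R ≃+* R) (π : R →+* S)
    (lam : ℕ) {m : ℕ} (a : Fin (m + 1) → R) : Prop :=
  LinearIndependent S (shiftProjectionMatrix σ π lam a).row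

/-! ### Computability -/

/-- `(R, σ)` is computable, where the natural number `n` represents the element `ν n`: every
element is represented, equality is decidable, and the ring operations and `σ` are computable. -/
structure IsComputable {R : Type*} [CommRing R] (σ : R ≃+* R) (ν : ℕ → R) : Prop where
  surjective : Function.Surjective ν
  eq : ComputablePred fun p : ℕ × ℕ => ν p.1 = ν p.2
  add : ∃ f : ℕ → ℕ → ℕ, Computable₂ f ∧ ∀ a b, ν (f a b) = ν a + ν b
  mul : ∃ f : ℕ → ℕ → ℕ, Computable₂ f ∧ ∀ a b, ν (f a b) = ν a * ν b
  neg : ∃ f : ℕ → ℕ, Computable f ∧ ∀ a, ν (f a) = -ν a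
  aut : ∃ f : ℕ → ℕ, Computable f ∧ ∀ a, ν (f a) = σ (ν a)

/-- `ν₀` represents the elements of the subring `S` of `R` in such a way that every one of them is
represented, and a representation in `R` can be computed from one in `S`. -/
def IsComputableSubring {F R : Type*} [CommRing F] [CommRing R] [Algebra F R]
    (S : Subalgebra F R) (ν₀ : ℕ → S) (ν : ℕ → R) : Prop :=
  Function.Surjective ν₀ ∧ ∃ f : ℕ → ℕ, Computable f ∧ ∀ n, ν (f n) = (ν₀ n : R)

open Classical in
/-- The representation of the elements of `Q(R)` as fractions: the code of a pair `(k, l)`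
represents `ν k / ν l` if `ν l` is not a zero divisor (and `0` otherwise). -/
noncomputable def fracNumbering {R : Type*} [CommRing R] (ν : ℕ → R) (n : ℕ) : FractionRing R :=
  if hn : ν n.unpair.2 ∈ nonZeroDivisors R then
    IsLocalization.mk' (FractionRing R) (ν n.unpair.1) (⟨ν n.unpair.2, hn⟩ : nonZeroDivisors R)
  else 0

/-- The list `B` of coded vectors `(c₁, …, c_d, g)` represents a basis of `V(a, f, R)` over the
constants. -/
def IsCodedBasis {R : Type*} [CommRing R] (σ : R ≃+* R) (ν : ℕ → R) {m d : ℕ}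
    (a : Fin (m + 1) → R) (f : Fin d → R) (B : List (List ℕ × ℕ)) : Prop :=
  ∃ (r : ℕ) (c : Fin r → Fin d → ℕ) (g : Fin r → ℕ)
    (b : Module.Basis (Fin r) (constants σ) (pldeSpace σ a f)),
    B = List.ofFn (fun k => (List.ofFn (c k), g k)) ∧
      ∀ k, (∀ j, ν (c k j) = (((b k : (Fin d → constants σ) × R).1 j : constants σ) : R)) ∧
        ν (g k) = (b k : (Fin d → constants σ) × R).2

/-- One can solve in `(R, σ)` all parameterized linear difference equations whose coefficient
vector `a` satisfies `P`: there is an algorithm that computes, for all `m` and `d`, a finite basis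
of `V(a, f, R)` from `a = (a₀, …, a_m)` with `P a` and `f = (f₁, …, f_d)`. -/
def CanSolvePLDE {R : Type*} [CommRing R] (σ : R ≃+* R) (ν : ℕ → R)
    (P : ∀ m : ℕ, (Fin (m + 1) → R) → Prop) : Prop :=
  ∃ solve : List ℕ × List ℕ →. List (List ℕ × ℕ), Partrec solve ∧
    ∀ (m d : ℕ) (a : Fin (m + 1) → ℕ) (f : Fin d → ℕ), P m (fun i => ν (a i)) →
      ∃ B ∈ solve (List.ofFn a, List.ofFn f),
        IsCodedBasis σ ν (fun i => ν (a i)) (fun j => ν (f j)) B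

end DifferenceRing

open DifferenceRing

/-!
Through `x ↦ (π (x), π (σ x), …, π (σ ^ (lam - 1) x))` the ring `E` is a product of `lam` copies of
the domain `Ẽ`, and `σ` permutes these copies cyclically, with `σ ^ lam` acting on the first one as
`σ₀` (`IsCyclicProduct`, `IsSingleRExtension.isCyclicProduct`). Rings of fractions inherit this
decomposition (`IsCyclicProduct.fractionRing`), and both parts of the theorem are instances of
`IsCyclicProduct.canSolvePLDE`.

Apply `π ∘ σ ^ j` to an equation `a₀ g + ⋯ + a_m σ^m(g) = c₁ f₁ + ⋯ + c_d f_d`, for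
`0 ≤ j < (m + 1) lam - m`. The result is a linear system for the `π (σ ^ c (g))` whose matrix is the
shift projection matrix. There is one row more than there are columns `c` with `c % lam ≠ s`, so a
nonzero combination of the rows vanishes in all of these columns. Since the rows are independent, it
does not vanish in the remaining columns, which belong to `π (σ ^ (k lam + s) (g)) = σ₀ ^ k (g_s)`
with `g_s = π (σ ^ s (g))`. So `g_s` solves a nonzero equation over `Ẽ`
(`NonDegenerate.exists_eliminant`, `IsCyclicProduct.eliminant_eq`), whose solutions can be computed.
Hence all solutions `(c, g)` lie in a computable finite-dimensional space over the constants, and it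
remains to find a basis of the kernel of a linear map on this space.

The algorithm searches for a certificate (`BasisCert`): vectors `B` and `P` that span this space,
such that the members of `B` are independent solutions and the residuals of the members of `P` are
independent. Solutions in the span of `B` and `P` are then spanned by `B`
(`BasisCert.isCodedBasis`), and such vectors exist by linear algebra (`exists_basisCert`). A
certificate can be found if being one is a recursively enumerable condition
(`REPred.exists_partrec`, `re_basisCert`), for which only independence over the constants is a
problem: it is a negative statement about constants, and no algorithm for linear algebra over them
is assumed. It is recursively enumerable (`re_constIndep`) for one of two reasons.

* Over a difference field, vectors are independent over the constants iff the matrix of their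
  images under powers of the automorphism has a left inverse, as for Casoratians
  (`constIndep_iff_of_isField`).
* In a domain in which constants are units, and in which no nonzero element is divisible by all
  powers of some `a ≠ 0`, a finite-dimensional space over the constants contains no nonzero
  multiples of `a ^ N` for large `N`. So vectors can be combined into scalars `f_j` without new
  relations, and they are independent iff some equation `a₀ g = c₁ f₁ + ⋯ + c_d f_d` with `a₀ ≠ 0`
  has only the trivial solution (`constIndep_iff_exists_weights`), which the given solver confirms.

A field falls under the first case, and `Ẽ`, a Noetherian domain, falls under the second one by
Krull's intersection theorem if it is not a field (`isField_or_exists_forall_pow_dvd`).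
-/

/-! ### Recursively enumerable predicates -/

namespace REPred

variable {α β : Type*} [Primcodable α] [Primcodable β]

theorem comp {p : β → Prop} (hp : REPred p) {f : α → β} (hf : Computable f) :
    REPred fun a => p (f a) :=
  Partrec.comp hp hf

/-- A recursively enumerable predicate is the projection of a decidable relation: the bound `k` is
the number of steps after which a semi-decision procedure halts. -/
theorem exists_bool {p : α → Prop} (hp : REPred p) :
    ∃ q : α × ℕ → Bool, Computable q ∧ ∀ a, p a ↔ ∃ k, q (a, k) = true := by
  obtain ⟨c, hc⟩ := Nat.Partrec.Code.exists_code.1 hp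
  refine ⟨fun x => (Nat.Partrec.Code.evaln x.2 c (Encodable.encode x.1)).isSome, ?_, fun a => ?_⟩
  · exact Primrec.option_isSome.to_comp.comp (Nat.Partrec.Code.primrec_evaln.to_comp.comp
      ((Computable.snd.pair (Computable.const c)).pair (Computable.encode.comp Computable.fst)))
  · have h1 : p a ↔ ∃ x, x ∈ Nat.Partrec.Code.eval c (Encodable.encode a) := by
      rw [hc]
      simp
    rw [h1]
    simp only [Nat.Partrec.Code.evaln_complete, Option.isSome_iff_exists, Option.mem_def]
    exact exists_comm

theorem of_bool {q : α × ℕ → Bool} (hq : Computable q) : REPred fun a => ∃ k, q (a, k) = true := by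
  refine (Partrec.rfind (p := fun a k => Part.some (q (a, k))) hq.partrec).dom_re.of_eq
    fun a => ?_
  refine Nat.rfind_dom.trans (exists_congr fun k => ?_)
  exact ⟨fun h => (Part.mem_some_iff.1 h.1).symm,
    fun h => ⟨Part.mem_some_iff.2 h.symm, fun _ => trivial⟩⟩

theorem and {p q : α → Prop} (hp : REPred p) (hq : REPred q) : REPred fun a => p a ∧ q a := by
  refine (Partrec.bind hp (hq.comp Computable.fst).to₂).dom_re.of_eq fun a => ?_
  simp [Part.dom_iff_mem]

theorem imp {p q : α → Prop} (hp : ComputablePred p) (hq : REPred q) :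
    REPred fun a => p a → q a := by
  classical
  refine (Partrec.cond hp.decide hq (Computable.const ()).partrec).dom_re.of_eq fun a => ?_
  by_cases h : p a <;> simp [h, Part.dom_iff_mem]

theorem exists_right {p : α → β → Prop} (hp : REPred fun x : α × β => p x.1 x.2) :
    REPred fun a => ∃ b, p a b := by
  obtain ⟨q, hq, h⟩ := hp.exists_bool
  have hr : Computable fun x : α × ℕ =>
      ((Encodable.decode (α := β × ℕ) x.2).map fun y => q ((x.1, y.1), y.2)).getD false := by
    refine Computable.option_getD (Computable.option_map (Computable.decode.comp Computable.snd)
      (hq.comp ?_)) (Computable.const _)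
    exact ((Computable.fst.comp Computable.fst).pair (Computable.fst.comp Computable.snd)).pair
      (Computable.snd.comp Computable.snd)
  refine (of_bool hr).of_eq fun a => ?_
  have h' : ∀ b, p a b ↔ ∃ k, q ((a, b), k) = true := fun b => h (a, b)
  simp only [h']
  constructor
  · rintro ⟨k, hk⟩
    cases hd : Encodable.decode (α := β × ℕ) k with
    | none => simp [hd] at hk
    | some y => exact ⟨y.1, y.2, by simpa [hd] using hk⟩
  · rintro ⟨b, j, hj⟩
    exact ⟨Encodable.encode (b, j), by simpa using hj⟩

theorem forall_lt {p : α → ℕ → Prop} (hp : REPred fun x : α × ℕ => p x.1 x.2) {n : α → ℕ}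
    (hn : Computable n) : REPred fun a => ∀ i < n a, p a i := by
  have h := Partrec.nat_rec (σ := Unit) hn (g := fun _ => Part.some ())
    (h := fun a y => Part.assert (p a y.1) fun _ => Part.some ()) (Computable.const ()).partrec
    (hp.comp (Computable.fst.pair (Computable.fst.comp Computable.snd))).to₂
  refine h.dom_re.of_eq fun a => ?_
  induction n a with
  | zero => simp
  | succ k ih =>
    simp only [Nat.forall_lt_succ_right, ← ih]
    simp [Part.dom_iff_mem]

/-- Uniformization: a witness of a recursively enumerable relation can be found by search. -/
theorem exists_partrec {p : α × β → Prop} (hp : REPred p) :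
    ∃ f : α →. β, Partrec f ∧ ∀ a, (∃ b, p (a, b)) → ∃ b ∈ f a, p (a, b) := by
  obtain ⟨q, hq, h⟩ := hp.exists_bool
  have hr : Computable₂ fun (a : α) (k : ℕ) =>
      (Encodable.decode (α := β × ℕ) k).bind fun y =>
        cond (q ((a, y.1), y.2)) (some y.1) none := by
    refine Computable.option_bind (Computable.decode.comp Computable.snd)
      (Computable.cond (hq.comp ?_)
        (Computable.option_some.comp (Computable.fst.comp Computable.snd)) (Computable.const _))
    exact ((Computable.fst.comp Computable.fst).pair (Computable.fst.comp Computable.snd)).pair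
      (Computable.snd.comp Computable.snd)
  refine ⟨_, Partrec.rfindOpt hr, ?_⟩
  rintro a ⟨b, hb⟩
  obtain ⟨j, hj⟩ := (h _).1 hb
  have hdom : (Nat.rfindOpt fun k => (Encodable.decode (α := β × ℕ) k).bind fun y =>
        cond (q ((a, y.1), y.2)) (some y.1) none).Dom :=
    Nat.rfindOpt_dom.2 ⟨Encodable.encode (b, j), b, by simp [hj]⟩
  refine ⟨_, Part.get_mem hdom, ?_⟩
  obtain ⟨k, hk⟩ := Nat.rfindOpt_spec (Part.get_mem hdom)
  generalize (Part.get _ hdom) = z at hk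
  simp only [Option.mem_def, Option.bind_eq_some_iff] at hk
  obtain ⟨y, -, hy⟩ := hk
  cases hq' : q ((a, y.1), y.2) with
  | false => simp [hq'] at hy
  | true =>
    simp only [hq', cond_true, Option.some.injEq] at hy
    exact (h _).2 ⟨y.2, hy ▸ hq'⟩

/-- The graph of a partial recursive function is recursively enumerable. -/
theorem mem_partrec {f : α →. β} (hf : Partrec f) {g : α → β} (hg : Computable g) :
    REPred fun a => g a ∈ f a := by
  classical
  have h : Partrec fun a => (f a).bind fun b =>
      cond (decide (b = g a)) (Part.some ()) Part.none := by
    refine hf.bind (Partrec.cond ?_ (Computable.const ()).partrec Partrec.none)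
    refine ((Primrec.eq (α := ℕ)).decide.to_comp.comp
      (Computable.encode.comp Computable.snd)
      (Computable.encode.comp (hg.comp Computable.fst))).of_eq fun x => ?_
    simp
  refine h.dom_re.of_eq fun a => ?_
  rw [Part.bind_dom]
  constructor
  · rintro ⟨h1, h2⟩
    by_cases hb : (f a).get h1 = g a
    · exact hb ▸ Part.get_mem h1
    · simp [hb] at h2
  · rintro ⟨h1, h2⟩
    exact ⟨h1, by simp [h2]⟩

end REPred

namespace ComputablePred

variable {α β : Type*} [Primcodable α] [Primcodable β]

theorem comp {p : β → Prop} (hp : ComputablePred p) {f : α → β} (hf : Computable f) :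
    ComputablePred fun a => p (f a) := by
  classical
  exact (hp.decide.comp hf).computablePred

theorem natEq {f g : α → ℕ} (hf : Computable f) (hg : Computable g) :
    ComputablePred fun a => f a = g a := by
  classical
  exact (Primrec.eq.decide.to_comp.comp hf hg).computablePred

theorem natLt {f g : α → ℕ} (hf : Computable f) (hg : Computable g) :
    ComputablePred fun a => f a < g a := by
  classical
  exact (Primrec.nat_lt.decide.to_comp.comp hf hg).computablePred

theorem natLe {f g : α → ℕ} (hf : Computable f) (hg : Computable g) :
    ComputablePred fun a => f a ≤ g a := by
  classical
  exact (Primrec.nat_le.decide.to_comp.comp hf hg).computablePred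

theorem and {p q : α → Prop} (hp : ComputablePred p) (hq : ComputablePred q) :
    ComputablePred fun a => p a ∧ q a := by
  classical
  refine ((Primrec.and.to_comp.comp hp.decide hq.decide).of_eq fun a => ?_).computablePred
  simp

end ComputablePred

namespace Computable

variable {α β γ : Type*} [Primcodable α] [Primcodable β] [Primcodable γ]

theorem id_fun : Computable fun a : α => a := Computable.id

theorem comp_fun {f : β → γ} {g : α → β} (hf : Computable f) (hg : Computable g) :
    Computable fun a => f (g a) :=
  hf.comp hg

theorem pair_fun {f : α → β} {g : α → γ} (hf : Computable f) (hg : Computable g) :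
    Computable fun a => (f a, g a) :=
  hf.pair hg

theorem fst_fun {f : α → β × γ} (hf : Computable f) : Computable fun a => (f a).1 :=
  fst.comp hf

theorem snd_fun {f : α → β × γ} (hf : Computable f) : Computable fun a => (f a).2 :=
  snd.comp hf

theorem length_fun {f : α → List β} (hf : Computable f) : Computable fun a => (f a).length :=
  list_length.comp hf

theorem list_getD {l : α → List β} {i : α → ℕ} (b : β) (hl : Computable l) (hi : Computable i) :
    Computable fun a => (l a).getD (i a) b :=
  (Primrec.list_getD b).to_comp.comp hl hi

theorem add_fun {f g : α → ℕ} (hf : Computable f) (hg : Computable g) :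
    Computable fun a => f a + g a :=
  Primrec.nat_add.to_comp.comp hf hg

theorem sub_fun {f g : α → ℕ} (hf : Computable f) (hg : Computable g) :
    Computable fun a => f a - g a :=
  Primrec.nat_sub.to_comp.comp hf hg

theorem mul_fun {f g : α → ℕ} (hf : Computable f) (hg : Computable g) :
    Computable fun a => f a * g a :=
  Primrec.nat_mul.to_comp.comp hf hg

theorem mod_fun {f g : α → ℕ} (hf : Computable f) (hg : Computable g) :
    Computable fun a => f a % g a :=
  Primrec.nat_mod.to_comp.comp hf hg

theorem natPair_fun {f g : α → ℕ} (hf : Computable f) (hg : Computable g) :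
    Computable fun a => Nat.pair (f a) (g a) :=
  Primrec₂.natPair.to_comp.comp hf hg

theorem unpair_fun {f : α → ℕ} (hf : Computable f) : Computable fun a => Nat.unpair (f a) :=
  unpair.comp hf

end Computable

-- With these attributes `fun_prop` proves the computability of compositions of the functions above.
attribute [fun_prop] Computable
attribute [fun_prop] Computable.id_fun Computable.const Computable.comp_fun Computable.pair_fun
  Computable.fst_fun Computable.snd_fun Computable.length_fun Computable.list_getD
  Computable.add_fun Computable.sub_fun Computable.mul_fun Computable.mod_fun
  Computable.natPair_fun Computable.unpair_fun

namespace DifferenceRing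

/-! ### Computable families of ring elements -/

/-- The family `u` of elements of `R` is computable: a code of `u a`, for the numbering `ν` of `R`,
can be computed from `a`. -/
def ComputableVal {α R : Type*} [Primcodable α] (ν : ℕ → R) (u : α → R) : Prop :=
  ∃ g : α → ℕ, Computable g ∧ ∀ a, ν (g a) = u a

namespace ComputableVal

variable {α β R S : Type*} [Primcodable α] [Primcodable β] {ν : ℕ → R} {u v : α → R}

theorem of_code {g : α → ℕ} (hg : Computable g) : ComputableVal ν fun a => ν (g a) :=
  ⟨g, hg, fun _ => rfl⟩

theorem comp {u : β → R} (hu : ComputableVal ν u) {f : α → β} (hf : Computable f) :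
    ComputableVal ν fun a => u (f a) :=
  let ⟨g, hg, h⟩ := hu
  ⟨fun a => g (f a), hg.comp hf, fun a => h (f a)⟩

theorem map {ν' : ℕ → S} {φ : R → S} (hφ : ComputableVal ν' fun n => φ (ν n))
    (hu : ComputableVal ν u) : ComputableVal ν' fun a => φ (u a) :=
  let ⟨g, hg, h⟩ := hu
  let ⟨g', hg', h'⟩ := hφ
  ⟨fun a => g' (g a), hg'.comp hg, fun a => by simp only [h', h]⟩

theorem getD {l : α → List ℕ} {i : α → ℕ} (hl : Computable l) (hi : Computable i) :
    ComputableVal ν fun a => ν ((l a).getD (i a) 0) :=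
  of_code (Computable.list_getD 0 hl hi)

theorem ite {p : α → Prop} [DecidablePred p] (hp : ComputablePred p) (hu : ComputableVal ν u)
    (hv : ComputableVal ν v) : ComputableVal ν fun a => if p a then u a else v a :=
  let ⟨f, hf, h⟩ := hu
  let ⟨g, hg, h'⟩ := hv
  ⟨fun a => cond (decide (p a)) (f a) (g a), hp.decide.cond hf hg, fun a => by
    by_cases hpa : p a <;> simp [hpa, h, h']⟩

/-- A family is computable if its values can be recognized: they are found by search. -/
theorem of_search (hν : Function.Surjective ν)
    (H : ComputablePred fun x : α × ℕ => u x.1 = ν x.2) : ComputableVal ν u := by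
  classical
  have hex : ∀ a, ∃ n, u a = ν n := fun a => (hν (u a)).imp fun _ h => h.symm
  exact ⟨_, Computable.find (P := fun a n => u a = ν n) H hex,
    fun a => (Nat.find_spec (hex a)).symm⟩

variable [CommRing R] {σ : R ≃+* R} (hν : IsComputable σ ν)
include hν

theorem const (x : R) : ComputableVal ν fun _ : α => x :=
  let ⟨n, hn⟩ := hν.surjective x
  ⟨fun _ => n, Computable.const n, fun _ => hn⟩

theorem add (hu : ComputableVal ν u) (hv : ComputableVal ν v) :
    ComputableVal ν fun a => u a + v a :=
  let ⟨f, hf, h⟩ := hu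
  let ⟨g, hg, h'⟩ := hv
  let ⟨k, hk, h''⟩ := hν.add
  ⟨fun a => k (f a) (g a), hk.comp hf hg, fun a => by rw [h'', h, h']⟩

theorem mul (hu : ComputableVal ν u) (hv : ComputableVal ν v) :
    ComputableVal ν fun a => u a * v a :=
  let ⟨f, hf, h⟩ := hu
  let ⟨g, hg, h'⟩ := hv
  let ⟨k, hk, h''⟩ := hν.mul
  ⟨fun a => k (f a) (g a), hk.comp hf hg, fun a => by rw [h'', h, h']⟩

theorem neg (hu : ComputableVal ν u) : ComputableVal ν fun a => -u a :=
  map hν.neg hu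

theorem sub (hu : ComputableVal ν u) (hv : ComputableVal ν v) :
    ComputableVal ν fun a => u a - v a := by
  simpa only [sub_eq_add_neg] using add hν hu (neg hν hv)

theorem aut (hu : ComputableVal ν u) : ComputableVal ν fun a => σ (u a) :=
  map hν.aut hu

theorem iterate (hu : ComputableVal ν u) {k : α → ℕ} (hk : Computable k) :
    ComputableVal ν fun a => σ^[k a] (u a) := by
  obtain ⟨f, hf, h⟩ := hu
  obtain ⟨g, hg, h'⟩ := hν.aut
  refine ⟨_, Computable.nat_rec hk hf (h := fun _ y => g y.2)
    (hg.comp (Computable.snd.comp Computable.snd)).to₂, fun a => ?_⟩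
  dsimp only
  induction k a with
  | zero => exact h a
  | succ n ih => simp only [Function.iterate_succ_apply', h', ih]

theorem sum {n : α → ℕ} (hn : Computable n) {w : α → ℕ → R}
    (hw : ComputableVal ν fun x : α × ℕ => w x.1 x.2) :
    ComputableVal ν fun a => ∑ i ∈ Finset.range (n a), w a i := by
  obtain ⟨f, hf, h⟩ := hw
  obtain ⟨g, hg, h'⟩ := hν.add
  obtain ⟨z, hz⟩ := hν.surjective 0
  refine ⟨_, Computable.nat_rec hn (Computable.const z) (h := fun a y => g y.2 (f (a, y.1)))
    (hg.comp (Computable.snd.comp Computable.snd)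
      (hf.comp (Computable.fst.pair (Computable.fst.comp Computable.snd)))).to₂, fun a => ?_⟩
  dsimp only
  induction n a with
  | zero => exact hz
  | succ n ih => simp only [Finset.sum_range_succ, h', ih, h]

theorem prod {w : α → ℕ → R} (hw : ∀ i, ComputableVal ν fun a => w a i) (n : ℕ) :
    ComputableVal ν fun a => ∏ i ∈ Finset.range n, w a i := by
  induction n with
  | zero => simpa using const hν 1
  | succ n ih => simpa only [Finset.prod_range_succ] using mul hν ih (hw n)

theorem eq (hu : ComputableVal ν u) (hv : ComputableVal ν v) :
    ComputablePred fun a => u a = v a := by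
  obtain ⟨f, hf, h⟩ := hu
  obtain ⟨g, hg, h'⟩ := hv
  exact (hν.eq.comp (hf.pair hg)).of_eq fun a => by rw [h, h']

theorem re_eq (hu : ComputableVal ν u) (hv : ComputableVal ν v) : REPred fun a => u a = v a :=
  (eq hν hu hv).to_re

end ComputableVal

open Finset

/-! ### Linear independence over the constants -/

/-- The vectors `u 0, …, u (n - 1)`, with components `u j κ` for `κ < q`, are linearly independent
over the constants of `(D, τ)`. -/
def ConstIndep {D : Type*} [CommRing D] (τ : D ≃+* D) (n q : ℕ) (u : ℕ → ℕ → D) : Prop :=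
  ∀ x : ℕ → D, (∀ j, τ (x j) = x j) → (∀ κ < q, ∑ j ∈ range n, x j * u j κ = 0) →
    ∀ j < n, x j = 0

/-- If the vectors `u j` over a difference field are linearly independent over the constants, then
so are, over the field, the vectors `(τ ^ k (u j κ))` indexed by `k` and `κ`. A relation of minimal
support with a coefficient `1` is fixed by `τ⁻¹`, so it is a relation over the constants. -/
theorem eq_zero_of_forall_iterate {D : Type*} [Field D] {τ : D ≃+* D} {n q : ℕ} {u : ℕ → ℕ → D}
    (hu : ConstIndep τ n q u) (x : ℕ → D)
    (hx : ∀ κ < q, ∀ k, ∑ j ∈ range n, x j * τ^[k] (u j κ) = 0) : ∀ j < n, x j = 0 := by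
  classical
  obtain ⟨s, hs⟩ : ∃ s, #{j ∈ range n | x j ≠ 0} = s := ⟨_, rfl⟩
  induction s using Nat.strong_induction_on generalizing x with
  | _ s ih =>
  by_contra! hne
  obtain ⟨i, hi, hxi⟩ := hne
  set y : ℕ → D := fun j => (x i)⁻¹ * x j with hy
  have hyi : y i = 1 := inv_mul_cancel₀ hxi
  have hyrel : ∀ κ < q, ∀ k, ∑ j ∈ range n, y j * τ^[k] (u j κ) = 0 := fun κ hκ k => by
    simp only [hy, mul_assoc, ← mul_sum, hx κ hκ k, mul_zero]
  have hzrel : ∀ κ < q, ∀ k, ∑ j ∈ range n, (y j - τ.symm (y j)) * τ^[k] (u j κ) = 0 := by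
    intro κ hκ k
    have h1 := congrArg τ.symm (hyrel κ hκ (k + 1))
    rw [map_sum, map_zero] at h1
    simp only [map_mul, Function.iterate_succ_apply', RingEquiv.symm_apply_apply] at h1
    simp only [sub_mul, sum_sub_distrib, hyrel κ hκ k, h1, sub_zero]
  have hz := ih _ (by
    rw [← hs]
    refine card_lt_card (Finset.ssubset_iff_of_subset ?_ |>.2 ⟨i, ?_, ?_⟩)
    · intro j hj
      simp only [mem_filter, hy] at hj ⊢
      refine ⟨hj.1, fun h => hj.2 ?_⟩
      simp [h]
    · simpa [hxi] using hi
    · simp [hyi]) _ hzrel rfl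
  set w : ℕ → D := fun j => if j < n then y j else 0 with hw
  have h1 := hu w (fun j => by
    by_cases hj : j < n
    · simp only [hw, hj, if_true]
      exact τ.symm.injective ((τ.symm_apply_apply _).trans (sub_eq_zero.1 (hz j hj)))
    · simp [hw, hj]) (fun κ hκ => by
      rw [← hyrel κ hκ 0]
      exact sum_congr rfl fun j hj => by simp [hw, mem_range.1 hj]) i hi
  simp [hw, hi, hyi] at h1

/-- In a difference field, linear independence of vectors over the constants is witnessed by a left
inverse of a matrix formed by the images of the components under powers of `τ`. -/
theorem constIndep_iff_of_isField {D : Type*} [Field D] (τ : D ≃+* D) (n q : ℕ) (u : ℕ → ℕ → D) :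
    ConstIndep τ n q u ↔ ∀ i < n, ∃ (K : ℕ) (z : ℕ → ℕ → D), ∀ j < n,
      ∑ κ ∈ range q, ∑ k ∈ range K, z κ k * τ^[k] (u j κ) = if j = i then 1 else 0 := by
  classical
  constructor
  · intro hu i hi
    -- A linear form that vanishes on all the rows would be a relation between the vectors, so the
    -- rows span the whole space; the unit vectors as combinations of rows give the left inverse.
    set row : Fin q × ℕ → Fin n → D := fun p j => τ^[p.2] (u j p.1) with hrow
    have htop : Submodule.span D (Set.range row) = ⊤ := by
      by_contra hne
      obtain ⟨f, hf, hle⟩ := Submodule.exists_le_ker_of_lt_top _ (lt_top_iff_ne_top.2 hne)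
      apply hf
      set x : ℕ → D := fun j => if hj : j < n then f (Pi.single ⟨j, hj⟩ 1) else 0 with hx
      have hfx : ∀ v : Fin n → D, f v = ∑ j : Fin n, x j * v j := fun v => by
        rw [LinearMap.pi_apply_eq_sum_univ f v]
        refine sum_congr rfl fun j _ => ?_
        simp only [hx, j.2, dif_pos, smul_eq_mul, mul_comm (v j)]
        congr 2
        ext l
        simp [Pi.single_apply, eq_comm]
      have h0 := eq_zero_of_forall_iterate hu x (fun κ hκ k => by
        have h1 : f (row (⟨κ, hκ⟩, k)) = 0 :=
          hle (Submodule.subset_span ⟨_, rfl⟩)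
        rw [hfx] at h1
        rw [sum_range]
        exact h1)
      refine LinearMap.ext fun v => ?_
      rw [hfx, LinearMap.zero_apply]
      exact sum_eq_zero fun j _ => by rw [h0 j j.2, zero_mul]
    have hmem : (Pi.single ⟨i, hi⟩ 1 : Fin n → D) ∈ Submodule.span D (Set.range row) :=
      htop ▸ Submodule.mem_top
    obtain ⟨c, hc⟩ := Finsupp.mem_span_range_iff_exists_finsupp.1 hmem
    refine ⟨c.support.sup Prod.snd + 1, fun κ k => if hκ : κ < q then c (⟨κ, hκ⟩, k) else 0,
      fun j hj => ?_⟩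
    have h1 := congrFun hc ⟨j, hj⟩
    rw [Pi.single_apply] at h1
    simp only [Fin.mk.injEq] at h1
    rw [← h1, Finsupp.sum, Finset.sum_apply, sum_range]
    simp only [Fin.is_lt, dif_pos, Fin.eta]
    rw [← sum_product' (f := fun (κ : Fin q) k => c (κ, k) * τ^[k] (u j κ))]
    refine (sum_subset (fun p hp => ?_) fun p _ hp => ?_).symm
    · simp only [mem_product, mem_univ, true_and, mem_range]
      exact Nat.lt_succ_of_le (le_sup (f := Prod.snd) hp)
    · simp [Finsupp.notMem_support_iff.1 hp]
  · intro h x hx hrel i hi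
    obtain ⟨K, z, hz⟩ := h i hi
    calc x i = ∑ j ∈ range n, x j * (if j = i then 1 else 0) := by simp [hi]
      _ = ∑ j ∈ range n, ∑ κ ∈ range q, ∑ k ∈ range K, z κ k * τ^[k] (x j * u j κ) := by
          refine sum_congr rfl fun j hj => ?_
          rw [← hz j (mem_range.1 hj), mul_sum]
          refine sum_congr rfl fun κ _ => ?_
          rw [mul_sum]
          refine sum_congr rfl fun k _ => ?_
          rw [iterate_map_mul, Function.iterate_fixed (hx j)]
          ring
      _ = ∑ κ ∈ range q, ∑ k ∈ range K, z κ k * τ^[k] (∑ j ∈ range n, x j * u j κ) := by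
          rw [sum_comm]
          refine sum_congr rfl fun κ _ => ?_
          rw [sum_comm]
          refine sum_congr rfl fun k _ => ?_
          rw [← RingAut.coe_pow, map_sum, mul_sum]
      _ = 0 := sum_eq_zero fun κ hκ => sum_eq_zero fun k _ => by
          rw [hrel κ (mem_range.1 hκ), ← RingAut.coe_pow, map_zero, mul_zero]

section Divisibility

variable {D : Type*} [CommRing D] {τ : D ≃+* D} {a : D}

/-- A finite-dimensional space over the constants contains no nonzero multiples of a high power of
`a` if no nonzero element is divisible by all powers of `a`. -/
theorem exists_pow_dvd_imp_eq_zero (ha : ∀ x : D, (∀ N, a ^ N ∣ x) → x = 0)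
    (hunit : ∀ x : D, τ x = x → x ≠ 0 → IsUnit x) (w : ℕ → D) (n : ℕ) :
    ∃ N, ∀ x : ℕ → D, (∀ j, τ (x j) = x j) → a ^ N ∣ ∑ j ∈ range n, x j * w j →
      ∑ j ∈ range n, x j * w j = 0 := by
  induction n with
  | zero => exact ⟨0, by simp⟩
  | succ n ih =>
    obtain ⟨N₀, hN₀⟩ := ih
    by_contra! hcon
    -- For every `N ≥ N₀` there is a multiple of `a ^ N` of the form `∑ j < n, x j * w j + w n`.
    have key : ∀ N, N₀ ≤ N → ∃ x : ℕ → D, (∀ j, τ (x j) = x j) ∧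
        a ^ N ∣ ∑ j ∈ range n, x j * w j + w n ∧ ∑ j ∈ range n, x j * w j + w n ≠ 0 := by
      intro N hN
      obtain ⟨x, hx, hdvd, hne⟩ := hcon N
      rw [sum_range_succ] at hdvd hne
      have hxn : x n ≠ 0 := by
        intro h0
        rw [h0, zero_mul, add_zero] at hdvd hne
        exact hne (hN₀ x hx ((pow_dvd_pow a hN).trans hdvd))
      obtain ⟨v, hv⟩ := hunit _ (hx n) hxn
      have hτv : τ ↑v⁻¹ = (↑v⁻¹ : D) := by
        apply v.isUnit.mul_left_cancel
        rw [Units.mul_inv]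
        nth_rw 1 [hv, ← hx n, ← hv]
        rw [← map_mul, Units.mul_inv, map_one]
      have hsum : ∑ j ∈ range n, ↑v⁻¹ * x j * w j + w n =
          ↑v⁻¹ * (∑ j ∈ range n, x j * w j + x n * w n) := by
        rw [mul_add, ← mul_assoc, ← hv, Units.inv_mul, one_mul, mul_sum]
        simp only [mul_assoc]
      refine ⟨fun j => ↑v⁻¹ * x j, fun j => by rw [map_mul, hτv, hx], ?_, ?_⟩
      · simp only [hsum]
        exact hdvd.mul_left _
      · simp only [hsum]
        exact fun h0 => hne ((Units.mul_right_eq_zero _).1 h0)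
    -- Two such multiples differ by an element to which the induction hypothesis applies, so they
    -- are all equal, and this element is divisible by all powers of `a`.
    obtain ⟨x, hx, hdvd, hne⟩ := key N₀ le_rfl
    refine hne (ha _ fun N => ?_)
    rcases le_total N N₀ with hN | hN
    · exact (pow_dvd_pow a hN).trans hdvd
    · obtain ⟨y, hy, hdvd', -⟩ := key N hN
      have h1 := hN₀ (fun j => x j - y j) (fun j => by rw [map_sub, hx, hy]) (by
        have h2 := dvd_sub hdvd ((pow_dvd_pow a hN).trans hdvd')
        rwa [add_sub_add_right_eq_sub, ← sum_sub_distrib, sum_congr rfl fun j _ =>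
          (sub_mul (x j) (y j) (w j)).symm] at h2)
      simp only [sub_mul, sum_sub_distrib, sub_eq_zero] at h1
      rwa [h1]

/-- Vectors can be replaced by scalars without changing the relations over the constants. -/
theorem exists_weights [IsDomain D] (ha0 : a ≠ 0) (ha : ∀ x : D, (∀ N, a ^ N ∣ x) → x = 0)
    (hunit : ∀ x : D, τ x = x → x ≠ 0 → IsUnit x) (u : ℕ → ℕ → D) (n q : ℕ) :
    ∃ ρ : ℕ → D, ∀ x : ℕ → D, (∀ j, τ (x j) = x j) →
      ∑ κ ∈ range q, ρ κ * ∑ j ∈ range n, x j * u j κ = 0 →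
      ∀ κ < q, ∑ j ∈ range n, x j * u j κ = 0 := by
  induction q with
  | zero => exact ⟨0, by simp⟩
  | succ q ih =>
    obtain ⟨ρ, hρ⟩ := ih
    obtain ⟨N, hN⟩ := exists_pow_dvd_imp_eq_zero ha hunit (fun j => u j q) n
    -- Scaled by `a ^ N`, the contribution of the first `q` components cannot cancel a nonzero
    -- combination of the last ones.
    refine ⟨fun κ => if κ < q then a ^ N * ρ κ else 1, fun x hx hsum => ?_⟩
    have h1 : ∑ κ ∈ range q, (if κ < q then a ^ N * ρ κ else 1) * ∑ j ∈ range n, x j * u j κ =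
        a ^ N * ∑ κ ∈ range q, ρ κ * ∑ j ∈ range n, x j * u j κ := by
      rw [mul_sum]
      exact sum_congr rfl fun κ hκ => by rw [if_pos (mem_range.1 hκ), mul_assoc]
    rw [sum_range_succ, h1] at hsum
    simp only [lt_self_iff_false, if_false, one_mul] at hsum
    have h2 := hN x hx ((dvd_neg.2 (dvd_mul_right _ _)).trans
      (dvd_of_eq (eq_neg_of_add_eq_zero_right hsum).symm))
    rw [h2, add_zero, mul_eq_zero, or_iff_right (pow_ne_zero _ ha0)] at hsum
    intro κ hκ
    rcases Nat.lt_succ_iff_lt_or_eq.1 hκ with hκ | rfl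
    · exact hρ x hx hsum κ hκ
    · exact h2

/-- Linear independence over the constants is witnessed by an equation `a₀ g = ∑ c_j f_j` that has
only the trivial solution, where the `f_j` are combinations of the components of the vectors. -/
theorem constIndep_iff_exists_weights [IsDomain D] (ha0 : a ≠ 0)
    (ha : ∀ x : D, (∀ N, a ^ N ∣ x) → x = 0) (hunit : ∀ x : D, τ x = x → x ≠ 0 → IsUnit x)
    (n q : ℕ) (u : ℕ → ℕ → D) :
    ConstIndep τ n q u ↔ ∃ (a₀ : D) (ρ : ℕ → D), a₀ ≠ 0 ∧ ∀ x : ℕ → D, (∀ j, τ (x j) = x j) →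
      ∀ g, a₀ * g = ∑ j ∈ range n, x j * ∑ κ ∈ range q, ρ κ * u j κ → g = 0 ∧ ∀ j < n, x j = 0 := by
  have hswap : ∀ (ρ x : ℕ → D), ∑ κ ∈ range q, ρ κ * ∑ j ∈ range n, x j * u j κ =
      ∑ j ∈ range n, x j * ∑ κ ∈ range q, ρ κ * u j κ := by
    intro ρ x
    simp only [mul_sum]
    rw [sum_comm]
    exact sum_congr rfl fun j _ => sum_congr rfl fun κ _ => by ring
  constructor
  · intro h
    obtain ⟨ρ, hρ⟩ := exists_weights ha0 ha hunit u n q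
    obtain ⟨N, hN⟩ := exists_pow_dvd_imp_eq_zero ha hunit
      (fun j => ∑ κ ∈ range q, ρ κ * u j κ) n
    refine ⟨a ^ N, ρ, pow_ne_zero _ ha0, fun x hx g hg => ?_⟩
    have h0 := hN x hx ⟨g, hg.symm⟩
    rw [h0, mul_eq_zero, or_iff_right (pow_ne_zero _ ha0)] at hg
    exact ⟨hg, h x hx (hρ x hx ((hswap ρ x).trans h0))⟩
  · rintro ⟨a₀, ρ, -, h⟩ x hx hrel
    refine (h x hx 0 ?_).2
    rw [mul_zero, ← hswap]
    exact (sum_eq_zero fun κ hκ => by rw [hrel κ (mem_range.1 hκ), mul_zero]).symm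

end Divisibility

/-! ### Coded bases of solution spaces -/

theorem exists_list_getD {β : Type*} (n : ℕ) (b : β) (x : ℕ → β) :
    ∃ l : List β, l.length = n ∧ ∀ i < n, l.getD i b = x i := by
  refine ⟨List.ofFn fun i : Fin n => x i, by simp, fun i hi => ?_⟩
  rw [List.getD_eq_getElem _ _ (by simpa using hi)]
  simp

theorem exists_codes {R : Type*} {ν : ℕ → R} (hν : Function.Surjective ν) (n : ℕ) (x : ℕ → R) :
    ∃ l : List ℕ, l.length = n ∧ ∀ i < n, ν (l.getD i 0) = x i := by
  choose f hf using fun i => hν (x i)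
  obtain ⟨l, hl, h⟩ := exists_list_getD n 0 f
  exact ⟨l, hl, fun i hi => by rw [h i hi, hf]⟩

/-- The code of the component `c_j` of the `k`-th vector `(c₁, …, c_d, g)` of a list of coded
vectors, and `0` beyond the ends of the lists. -/
def codedConst (B : List (List ℕ × ℕ)) (k j : ℕ) : ℕ := (B.getD k ([], 0)).1.getD j 0

/-- The code of the component `g` of the `k`-th vector `(c₁, …, c_d, g)` of a list of coded vectors,
and `0` beyond the end of the list. -/
def codedSol (B : List (List ℕ × ℕ)) (k : ℕ) : ℕ := (B.getD k ([], 0)).2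

theorem codedConst_ofFn {r d : ℕ} (c : Fin r → Fin d → ℕ) (g : Fin r → ℕ) (k : Fin r)
    (j : Fin d) : codedConst (List.ofFn fun k => (List.ofFn (c k), g k)) k j = c k j := by
  simp [codedConst, List.getD_eq_getElem?_getD]

theorem codedSol_ofFn {r d : ℕ} (c : Fin r → Fin d → ℕ) (g : Fin r → ℕ) (k : Fin r) :
    codedSol (List.ofFn fun k => (List.ofFn (c k), g k)) k = g k := by
  rw [codedSol, List.getD_eq_getElem _ _ (by simp)]
  simp

section Solve

variable {R : Type*} [CommRing R] {σ : R ≃+* R} {ν : ℕ → R}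

theorem mem_constants {x : R} : x ∈ constants σ ↔ σ x = x := Iff.rfl

theorem mem_pldeSpace {m d : ℕ} {a : Fin (m + 1) → R} {f : Fin d → R}
    {p : (Fin d → constants σ) × R} :
    p ∈ pldeSpace σ a f ↔ ∑ i, a i * σ^[i] p.2 = ∑ j, (p.1 j : R) * f j := Iff.rfl

/-- `g = ∑ y_k g_k` and `c_j = ∑ y_k c_{k,j}` for some constants `y_k`, where `(c_k, g_k)` are the
vectors coded by `B`. -/
def InCodedSpan (σ : R ≃+* R) (ν : ℕ → R) (d : ℕ) (B : List (List ℕ × ℕ)) (c : ℕ → R) (g : R) :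
    Prop :=
  ∃ y : ℕ → R, (∀ k, σ (y k) = y k) ∧
    (∀ j < d, c j = ∑ k ∈ range B.length, y k * ν (codedConst B k j)) ∧
    g = ∑ k ∈ range B.length, y k * ν (codedSol B k)

theorem IsCodedBasis.inCodedSpan {m d : ℕ} {a : ℕ → R} {f : ℕ → R} {B : List (List ℕ × ℕ)}
    (hB : IsCodedBasis σ ν (fun i : Fin (m + 1) => a i) (fun j : Fin d => f j) B) {c : ℕ → R}
    (hc : ∀ j, σ (c j) = c j) {g : R}
    (h : ∑ i ∈ range (m + 1), a i * σ^[i] g = ∑ j ∈ range d, c j * f j) :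
    InCodedSpan σ ν d B c g := by
  obtain ⟨r, cB, gB, b, rfl, hb⟩ := hB
  set p : pldeSpace σ (fun i : Fin (m + 1) => a i) (fun j : Fin d => f j) :=
    ⟨(fun j => ⟨c j, hc j⟩, g), by
      rw [mem_pldeSpace]
      rw [sum_range, sum_range] at h
      exact h⟩ with hp
  have hsum := congrArg Subtype.val (b.sum_repr p)
  rw [Submodule.coe_sum] at hsum
  refine ⟨fun k => if hk : k < r then (b.repr p ⟨k, hk⟩ : R) else 0, fun k => ?_, fun j hj => ?_,
    ?_⟩
  · by_cases hk : k < r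
    · simp only [hk, dif_pos]
      exact (b.repr p ⟨k, hk⟩).2
    · simp [hk]
  · have h1 := congrArg
      (fun q : (Fin d → constants σ) × R => ((q.1 ⟨j, hj⟩ : constants σ) : R)) hsum
    simp only [Prod.fst_sum, Finset.sum_apply, AddSubmonoidClass.coe_finsetSum] at h1
    rw [List.length_ofFn, sum_range]
    refine h1.symm.trans (sum_congr rfl fun k _ => ?_)
    have h2 := codedConst_ofFn cB gB k ⟨j, hj⟩
    dsimp only at h2
    rw [h2, (hb k).1]
    simp
  · have h1 := congrArg Prod.snd hsum
    rw [Prod.snd_sum] at h1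
    rw [List.length_ofFn, sum_range]
    refine h1.symm.trans (sum_congr rfl fun k _ => ?_)
    rw [codedSol_ofFn, (hb k).2]
    simp [Subring.smul_def]

theorem IsCodedBasis.eq_nil {m d : ℕ} {a : Fin (m + 1) → R} {f : Fin d → R}
    {B : List (List ℕ × ℕ)} (hB : IsCodedBasis σ ν a f B) (hnt : Nontrivial R)
    (h : ∀ p ∈ pldeSpace σ a f, p = 0) : B = [] := by
  obtain ⟨r, cB, gB, b, rfl, -⟩ := hB
  rcases Nat.eq_zero_or_pos r with rfl | hr
  · simp
  · exact absurd (Subtype.ext (h _ (b ⟨0, hr⟩).2)) (b.ne_zero _)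

theorem exists_isCodedBasis {solve : List ℕ × List ℕ →. List (List ℕ × ℕ)}
    {P : ∀ m : ℕ, (Fin (m + 1) → R) → Prop}
    (H : ∀ (m d : ℕ) (a : Fin (m + 1) → ℕ) (f : Fin d → ℕ), P m (fun i => ν (a i)) →
      ∃ B ∈ solve (List.ofFn a, List.ofFn f),
        IsCodedBasis σ ν (fun i => ν (a i)) (fun j => ν (f j)) B)
    {m d : ℕ} {la lf : List ℕ} (ha : la.length = m + 1) (hf : lf.length = d)
    (hP : P m fun i => ν (la.getD i 0)) :
    ∃ B ∈ solve (la, lf), IsCodedBasis σ ν (fun i : Fin (m + 1) => ν (la.getD i 0))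
      (fun j : Fin d => ν (lf.getD j 0)) B := by
  have key : ∀ (n : ℕ) (l : List ℕ), l.length = n →
      List.ofFn (fun i : Fin n => l.getD i 0) = l := by
    rintro _ l rfl
    refine List.ext_getElem (by simp) fun i h1 h2 => ?_
    simp
  have := H m d (fun i => la.getD i 0) (fun j => lf.getD j 0) hP
  rwa [key _ _ ha, key _ _ hf] at this

/-- A list of coded solutions that are linearly independent and span the solution space. -/
theorem isCodedBasis_of_span {m d : ℕ} {a : ℕ → R} {f : ℕ → R} {B : List (List ℕ × ℕ)}
    (hlen : ∀ k < B.length, (B.getD k ([], 0)).1.length = d)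
    (hconst : ∀ k < B.length, ∀ j < d, σ (ν (codedConst B k j)) = ν (codedConst B k j))
    (hsol : ∀ k < B.length, ∑ i ∈ range (m + 1), a i * σ^[i] (ν (codedSol B k)) =
      ∑ j ∈ range d, ν (codedConst B k j) * f j)
    (hind : ∀ x : ℕ → R, (∀ k, σ (x k) = x k) →
      (∀ j < d, ∑ k ∈ range B.length, x k * ν (codedConst B k j) = 0) →
      ∑ k ∈ range B.length, x k * ν (codedSol B k) = 0 → ∀ k < B.length, x k = 0)
    (hspan : ∀ c : ℕ → R, (∀ j, σ (c j) = c j) → ∀ g,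
      ∑ i ∈ range (m + 1), a i * σ^[i] g = ∑ j ∈ range d, c j * f j →
      InCodedSpan σ ν d B c g) :
    IsCodedBasis σ ν (fun i : Fin (m + 1) => a i) (fun j : Fin d => f j) B := by
  set V := pldeSpace σ (fun i : Fin (m + 1) => a i) (fun j : Fin d => f j) with hV
  set v : Fin B.length → V := fun k =>
    ⟨(fun j => ⟨ν (codedConst B k j), hconst k k.2 j j.2⟩, ν (codedSol B k)), by
      have := hsol k k.2
      rw [sum_range, sum_range] at this
      exact mem_pldeSpace.2 this⟩ with hv
  have hv1 : ∀ (x : Fin B.length → constants σ) (j : Fin d),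
      (((∑ k, x k • v k : V) : (Fin d → constants σ) × R).1 j : R) =
        ∑ k : Fin B.length, (x k : R) * ν (codedConst B k j) := by
    intro x j
    rw [Submodule.coe_sum, Prod.fst_sum, Finset.sum_apply, AddSubmonoidClass.coe_finsetSum]
    rfl
  have hv2 : ∀ (x : Fin B.length → constants σ),
      ((∑ k, x k • v k : V) : (Fin d → constants σ) × R).2 =
        ∑ k : Fin B.length, (x k : R) * ν (codedSol B k) := by
    intro x
    rw [Submodule.coe_sum, Prod.snd_sum]
    rfl
  have hli : LinearIndependent (constants σ) v := by
    rw [Fintype.linearIndependent_iff]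
    intro x hx k
    have h1 := hind (fun k => if hk : k < B.length then (x ⟨k, hk⟩ : R) else 0)
      (fun k => by
        by_cases hk : k < B.length
        · simp only [hk, dif_pos]
          exact (x ⟨k, hk⟩).2
        · simp [hk])
      (fun j hj => by
        have := hv1 x ⟨j, hj⟩
        rw [hx] at this
        rw [sum_range]
        simpa using this.symm)
      (by
        have := hv2 x
        rw [hx] at this
        rw [sum_range]
        simpa using this.symm) k k.2
    simpa using h1
  have hsp : ⊤ ≤ Submodule.span (constants σ) (Set.range v) := by
    rintro ⟨p, hp⟩ -
    have hp' := mem_pldeSpace.1 hp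
    obtain ⟨y, hy, hy1, hy2⟩ := hspan (fun j => if hj : j < d then (p.1 ⟨j, hj⟩ : R) else 0)
      (fun j => by
        by_cases hj : j < d
        · simp only [hj, dif_pos]
          exact (p.1 ⟨j, hj⟩).2
        · simp [hj]) p.2 (by
        rw [sum_range, sum_range]
        simpa using hp')
    rw [Submodule.mem_span_range_iff_exists_fun]
    refine ⟨fun k => ⟨y k, hy k⟩, Subtype.ext (Prod.ext (funext fun j => Subtype.ext ?_) ?_)⟩
    · rw [hv1]
      have := hy1 j j.2
      rw [sum_range] at this
      simpa using this.symm
    · rw [hv2, hy2, sum_range]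
  refine ⟨B.length, fun k j => codedConst B k j, fun k => codedSol B k, Module.Basis.mk hli hsp,
    ?_, fun k => ⟨fun j => ?_, ?_⟩⟩
  · refine List.ext_getElem (by simp) fun k h1 h2 => ?_
    rw [List.getElem_ofFn]
    have hk : B.getD k ([], 0) = B[k] := List.getD_eq_getElem _ _ h1
    have hl := hk ▸ hlen k h1
    refine Prod.ext ?_ ?_
    · refine List.ext_getElem (by simpa using hl) fun j h3 h4 => ?_
      rw [List.getElem_ofFn]
      simp only [codedConst, hk]
      rw [List.getD_eq_getElem _ _ h3]
    · simp only [codedSol, hk]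
  · rw [Module.Basis.mk_apply]
  · rw [Module.Basis.mk_apply]

end Solve

/-! ### Independence over the constants is recursively enumerable -/

section Indep

variable {D : Type*} [CommRing D] {τ : D ≃+* D} {ν : ℕ → D}

/-- Linear independence over the constants is recursively enumerable. Over a field a left inverse of
a matrix is a witness; otherwise, an equation `a₀ g = ∑ c_j f_j` for which the solver returns the
empty basis. -/
theorem re_constIndep [IsDomain D] (hν : IsComputable τ ν)
    (hunit : ∀ x : D, τ x = x → x ≠ 0 → IsUnit x)
    (hD : IsField D ∨ ∃ a : D, a ≠ 0 ∧ ∀ x : D, (∀ N, a ^ N ∣ x) → x = 0)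
    (hsolve : CanSolvePLDE τ ν fun _ a => a ≠ 0) {α : Type*} [Primcodable α] {n q : α → ℕ}
    (hn : Computable n) (hq : Computable q) {u : α → ℕ → ℕ → D}
    (hu : ComputableVal ν fun x : α × ℕ × ℕ => u x.1 x.2.1 x.2.2) :
    REPred fun a => ConstIndep τ (n a) (q a) (u a) := by
  rcases hD with hD | ⟨a, ha0, ha⟩
  · -- `y` codes the number of powers of `τ` and the entries of one row of the left inverse.
    have h : REPred fun x : α => ∀ i < n x, ∃ y : ℕ × List (List ℕ), ∀ j < n x,
        ∑ κ ∈ range (q x), ∑ k ∈ range y.1,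
          ν ((y.2.getD κ []).getD k 0) * τ^[k] (u x j κ) = if j = i then 1 else 0 := by
      refine REPred.forall_lt
        (REPred.exists_right
          (REPred.forall_lt ?_ (by fun_prop))) hn
      refine ComputableVal.re_eq hν (ComputableVal.sum hν (by fun_prop)
        (ComputableVal.sum hν (by fun_prop) (ComputableVal.mul hν
          (ComputableVal.getD (by fun_prop) (by fun_prop))
          (ComputableVal.iterate hν (hu.comp (f := fun z :
            ((((α × ℕ) × ℕ × List (List ℕ)) × ℕ) × ℕ) × ℕ =>
              (z.1.1.1.1.1, z.1.1.2, z.1.2)) (by fun_prop)) (by fun_prop)))))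
        (ComputableVal.ite (ComputablePred.natEq (by fun_prop) (by fun_prop))
          (ComputableVal.const hν 1) (ComputableVal.const hν 0))
    refine h.of_eq fun x => ?_
    let := hD.toField
    rw [constIndep_iff_of_isField]
    refine forall₂_congr fun i _ => ⟨fun ⟨y, hy⟩ => ⟨y.1, _, hy⟩, fun ⟨K, z, hz⟩ => ?_⟩
    choose l hl using fun κ => exists_codes hν.surjective K (z κ)
    obtain ⟨L, hL, hL'⟩ := exists_list_getD (q x) [] l
    refine ⟨(K, L), fun j hj => (sum_congr rfl fun κ hκ => sum_congr rfl fun k hk => ?_).trans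
      (hz j hj)⟩
    dsimp only
    rw [hL' κ (mem_range.1 hκ), (hl κ).2 k (mem_range.1 hk)]
  · obtain ⟨solve, hpart, H⟩ := hsolve
    -- `y` codes the coefficient `a₀`, the weights and the right-hand sides of an equation for which
    -- the solver returns the empty basis.
    have h : REPred fun x : α => ∃ y : ℕ × List ℕ × List ℕ, ν y.1 ≠ 0 ∧ y.2.2.length = n x ∧
        (∀ j < n x, ν (y.2.2.getD j 0) = ∑ κ ∈ range (q x), ν (y.2.1.getD κ 0) * u x j κ) ∧
        [] ∈ solve ([y.1], y.2.2) := by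
      refine REPred.exists_right (REPred.and ?_ (REPred.and ?_ (REPred.and ?_ ?_)))
      · exact (ComputableVal.eq hν (ComputableVal.of_code (by fun_prop))
          (ComputableVal.const hν 0)).not.to_re
      · exact (ComputablePred.natEq (by fun_prop) (by fun_prop)).to_re
      · refine REPred.forall_lt ?_ (by fun_prop)
        exact ComputableVal.re_eq hν (ComputableVal.getD (by fun_prop) (by fun_prop))
          (ComputableVal.sum hν (by fun_prop) (ComputableVal.mul hν
            (ComputableVal.getD (by fun_prop) (by fun_prop)) (hu.comp
              (f := fun z : ((α × ℕ × List ℕ × List ℕ) × ℕ) × ℕ => (z.1.1.1, z.1.2, z.2))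
              (by fun_prop))))
      · refine REPred.mem_partrec (hpart.comp ?_) (Computable.const _)
        refine Computable.pair_fun (Computable.list_cons.comp ?_ (Computable.const _)) ?_
        all_goals fun_prop
    refine h.of_eq fun x => ?_
    rw [constIndep_iff_exists_weights ha0 ha hunit]
    constructor
    · rintro ⟨⟨a₀, lρ, lf⟩, hne, hlen, hval, hmem⟩
      dsimp only at hne hlen hval hmem
      refine ⟨ν a₀, fun κ => ν (lρ.getD κ 0), hne, fun y hy g hg => ?_⟩
      obtain ⟨B, hB, hbasis⟩ := exists_isCodedBasis (ν := ν) (P := fun _ a => a ≠ 0) H (m := 0)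
        (la := [a₀]) rfl hlen
        (by exact fun h0 => hne (congrFun h0 (0 : Fin 1)))
      obtain rfl : B = [] := Part.mem_unique hB hmem
      obtain ⟨z, -, h1, h2⟩ := hbasis.inCodedSpan (a := fun i => ν ([a₀].getD i 0))
        (f := fun j => ν (lf.getD j 0)) hy (g := g) (by
          simp only [zero_add, sum_range_one, Function.iterate_zero, id, List.getD_cons_zero]
          rw [hg]
          exact sum_congr rfl fun j hj => by rw [hval j (mem_range.1 hj)])
      exact ⟨by simpa using h2, fun j hj => by simpa using h1 j hj⟩
    · rintro ⟨a₀, ρ, hne, h⟩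
      obtain ⟨na, hna⟩ := hν.surjective a₀
      obtain ⟨lρ, -, hlρ⟩ := exists_codes hν.surjective (q x) ρ
      obtain ⟨lf, hlen, hlf⟩ := exists_codes hν.surjective (n x)
        fun j => ∑ κ ∈ range (q x), ρ κ * u x j κ
      refine ⟨(na, lρ, lf), by simpa [hna] using hne, hlen, fun j hj => ?_, ?_⟩
      · dsimp only
        rw [hlf j hj]
        exact sum_congr rfl fun κ hκ => by rw [hlρ κ (mem_range.1 hκ)]
      · obtain ⟨B, hB, hbasis⟩ := exists_isCodedBasis (ν := ν) (P := fun _ a => a ≠ 0) H (m := 0)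
          (la := [na]) rfl hlen
          (by exact fun h0 => hne (hna.symm.trans (congrFun h0 (0 : Fin 1))))
        have hnil := hbasis.eq_nil inferInstance fun p hp => by
          have hp' := mem_pldeSpace.1 hp
          obtain ⟨h1, h2⟩ := h (fun j => if hj : j < n x then (p.1 ⟨j, hj⟩ : D) else 0)
            (fun j => by
              by_cases hj : j < n x
              · simp only [hj, dif_pos]
                exact (p.1 ⟨j, hj⟩).2
              · simp [hj]) p.2 (by
              rw [sum_range]
              rw [Fin.sum_univ_succ, Fin.sum_univ_zero, add_zero] at hp'
              rw [sum_congr rfl fun j _ => by rw [hlf j j.2]] at hp'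
              simpa [hna] using hp')
          exact Prod.ext (funext fun j => Subtype.ext (by simpa using h2 j j.2)) h1
        exact hnil ▸ hB

end Indep

/-! ### Elimination in the shift projection matrix -/

theorem sum_range_mul_add {M : Type*} [AddCommMonoid M] (f : ℕ → M) (n l : ℕ) :
    ∑ c ∈ range (n * l), f c = ∑ k ∈ range n, ∑ s ∈ range l, f (k * l + s) := by
  induction n with
  | zero => simp
  | succ n ih => rw [Nat.succ_mul, sum_range_add, ih, sum_range_succ]

/-- The entry in row `j` and column `c` of the shift projection matrix of `a₀, …, a_{M-1}`. -/
def shiftEntry {R D : Type*} [CommRing R] [CommRing D] (σ : R ≃+* R) (π : R →+* D) (M : ℕ)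
    (a : ℕ → R) (j c : ℕ) : D :=
  if j ≤ c ∧ c - j < M then π (σ^[j] (a (c - j))) else 0

section Elimination

variable {R D : Type*} [CommRing R] [CommRing D] {σ : R ≃+* R} {π : R →+* D}

theorem sum_shiftEntry_mul {M n j : ℕ} (hj : j + M ≤ n) (a : ℕ → R) (g : R) :
    ∑ c ∈ range n, shiftEntry σ π M a j c * π (σ^[c] g) =
      π (σ^[j] (∑ i ∈ range M, a i * σ^[i] g)) := by
  have h1 : ∑ c ∈ Ico j (j + M), shiftEntry σ π M a j c * π (σ^[c] g) =
      ∑ c ∈ range n, shiftEntry σ π M a j c * π (σ^[c] g) := by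
    refine sum_subset (fun c hc => ?_) fun c _ hc => ?_
    · simp only [mem_Ico, mem_range] at *
      omega
    · rw [shiftEntry, if_neg, zero_mul]
      simp only [mem_Ico] at hc
      omega
  rw [← h1, sum_Ico_eq_sum_range, Nat.add_sub_cancel_left, ← RingAut.coe_pow, map_sum, map_sum]
  refine sum_congr rfl fun i hi => ?_
  rw [shiftEntry, if_pos ⟨Nat.le_add_right _ _, by simpa using hi⟩, Nat.add_sub_cancel_left,
    map_mul, map_mul, RingAut.coe_pow, Function.iterate_add_apply]

/-- Combining the shifts of an equation so that only the columns `c ≡ s` modulo `lam` survive. -/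
theorem sum_eliminant {M lam s : ℕ} (hs : s < lam) (a : ℕ → R) {v : ℕ → D}
    (hv : ∀ c < M * lam, c % lam ≠ s →
      ∑ j ∈ range (M * lam - (M - 1)), v j * shiftEntry σ π M a j c = 0) (hM : 0 < M) (g : R) :
    ∑ k ∈ range M, (∑ j ∈ range (M * lam - (M - 1)), v j * shiftEntry σ π M a j (k * lam + s)) *
        π (σ^[k * lam + s] g) =
      ∑ j ∈ range (M * lam - (M - 1)), v j * π (σ^[j] (∑ i ∈ range M, a i * σ^[i] g)) := by
  have hMl : M ≤ M * lam := Nat.le_mul_of_pos_right M (by omega)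
  calc _ = ∑ c ∈ range (M * lam), (∑ j ∈ range (M * lam - (M - 1)),
          v j * shiftEntry σ π M a j c) * π (σ^[c] g) := by
        rw [sum_range_mul_add]
        refine sum_congr rfl fun k hk => ?_
        rw [sum_eq_single_of_mem s (mem_range.2 hs)]
        intro s' hs' hne
        rw [mem_range] at hk hs'
        rw [hv, zero_mul]
        · calc k * lam + s' < k * lam + lam := by omega
            _ = (k + 1) * lam := by ring
            _ ≤ M * lam := Nat.mul_le_mul_right _ hk
        · rwa [Nat.mul_add_mod_self_right, Nat.mod_eq_of_lt hs']
    _ = _ := by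
        simp only [sum_mul]
        rw [sum_comm]
        refine sum_congr rfl fun j hj => ?_
        rw [mem_range] at hj
        rw [← sum_shiftEntry_mul (n := M * lam) (by omega), mul_sum]
        exact sum_congr rfl fun c _ => mul_assoc _ _ _

/-- There is one row more than there are columns `c` with `c % lam ≠ s`, so a nontrivial
combination of the rows vanishes in these columns; it is nonzero as the rows are independent. -/
theorem NonDegenerate.exists_eliminant [Nontrivial D] {lam m : ℕ} {a : ℕ → R}
    (h : NonDegenerate σ π lam fun i : Fin (m + 1) => a i) {s : ℕ} (hs : s < lam) :
    ∃ v : ℕ → D, (∀ c < (m + 1) * lam, c % lam ≠ s →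
        ∑ j ∈ range ((m + 1) * lam - m), v j * shiftEntry σ π (m + 1) a j c = 0) ∧
      ∃ k < m + 1,
        ∑ j ∈ range ((m + 1) * lam - m), v j * shiftEntry σ π (m + 1) a j (k * lam + s) ≠ 0 := by
  classical
  set N := (m + 1) * lam - m with hN
  -- `T v` lists the entries, in the columns `c` with `c % lam ≠ s`, of the combination `v` of the
  -- rows.
  let T : (Fin N → D) →ₗ[D] (Fin (m + 1) × {x : Fin lam // x ≠ ⟨s, hs⟩} → D) :=
    LinearMap.pi fun p => ∑ j : Fin N,
      shiftEntry σ π (m + 1) a j ((p.1 : ℕ) * lam + (p.2 : Fin lam)) • LinearMap.proj j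
  have hT : ∀ v p, T v p =
      ∑ j : Fin N, v j * shiftEntry σ π (m + 1) a j ((p.1 : ℕ) * lam + (p.2 : Fin lam)) := by
    intro v p
    simp [T, LinearMap.sum_apply, mul_comm]
  have hninj : ¬ Function.Injective T := by
    intro hinj
    have h1 := card_le_of_injective D T hinj
    rw [Fintype.card_prod, Fintype.card_fin, Fintype.card_fin, Fintype.card_subtype_compl,
      Fintype.card_fin, Fintype.card_subtype_eq] at h1
    obtain ⟨l, rfl⟩ : ∃ l, lam = l + 1 := ⟨lam - 1, by omega⟩
    rw [hN, Nat.add_sub_cancel, Nat.mul_succ] at h1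
    omega
  rw [injective_iff_map_eq_zero] at hninj
  push Not at hninj
  obtain ⟨v, hv, hv0⟩ := hninj
  set v' : ℕ → D := fun j => if hj : j < N then v ⟨j, hj⟩ else 0 with hv'
  have hsum : ∀ c, ∑ j ∈ range N, v' j * shiftEntry σ π (m + 1) a j c =
      ∑ j : Fin N, v j * shiftEntry σ π (m + 1) a j c := fun c => by
    rw [sum_range]
    simp [hv']
  have hzero : ∀ c < (m + 1) * lam, c % lam ≠ s →
      ∑ j ∈ range N, v' j * shiftEntry σ π (m + 1) a j c = 0 := by
    intro c hc hcs
    have hl : 0 < lam := by omega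
    have h1 := congrFun hv (⟨c / lam, Nat.div_lt_of_lt_mul (by rwa [mul_comm])⟩,
      ⟨⟨c % lam, Nat.mod_lt _ hl⟩, fun h => hcs (Fin.mk.inj_iff.1 h)⟩)
    rw [hT] at h1
    rw [hsum]
    simpa [Nat.div_add_mod'] using h1
  refine ⟨v', hzero, ?_⟩
  by_contra! hcon
  apply hv0
  unfold NonDegenerate at h
  rw [Fintype.linearIndependent_iff] at h
  refine funext fun j => h v (funext fun c => ?_) j
  have h2 : ∑ j ∈ range N, v' j * shiftEntry σ π (m + 1) a j c = 0 := by
    by_cases hcs : (c : ℕ) % lam = s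
    · have := hcon (c / lam) (Nat.div_lt_of_lt_mul (c.2.trans_eq (mul_comm _ _)))
      rwa [← hcs, Nat.div_add_mod'] at this
    · exact hzero c c.2 hcs
  rw [hsum] at h2
  rw [Finset.sum_apply, Pi.zero_apply, ← h2]
  refine sum_congr rfl fun j _ => ?_
  rw [Pi.smul_apply, smul_eq_mul, Matrix.row_apply, shiftProjectionMatrix, shiftEntry]
  split_ifs <;> rfl

end Elimination

/-! ### Difference rings that are products of copies of a difference ring -/

/-- The map `x ↦ (π (x), π (σ (x)), …, π (σ ^ (lam - 1) (x)))` identifies `R` with the product of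
`lam` copies of `D`, and `σ ^ lam` acts on the first component as `τ`. -/
structure IsCyclicProduct {R D : Type*} [CommRing R] [CommRing D] (σ : R ≃+* R) (τ : D ≃+* D)
    (π : R →+* D) (lam : ℕ) : Prop where
  pos : 0 < lam
  proj_iterate_lam : ∀ x, π (σ^[lam] x) = τ (π x)
  eq_zero : ∀ x, (∀ s < lam, π (σ^[s] x) = 0) → x = 0
  exists_single : ∀ s < lam, ∀ y, ∃ x, ∀ s' < lam, π (σ^[s'] x) = if s' = s then y else 0

namespace IsCyclicProduct

variable {R D : Type*} [CommRing R] [CommRing D] {σ : R ≃+* R} {τ : D ≃+* D} {π : R →+* D}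
  {lam : ℕ}

theorem proj_iterate (h : IsCyclicProduct σ τ π lam) (k s : ℕ) (x : R) :
    π (σ^[k * lam + s] x) = τ^[k] (π (σ^[s] x)) := by
  induction k with
  | zero => simp
  | succ k ih =>
    rw [Function.iterate_succ_apply', ← ih, ← h.proj_iterate_lam, ← Function.iterate_add_apply,
      show (k + 1) * lam + s = lam + (k * lam + s) by ring]

theorem proj_const (h : IsCyclicProduct σ τ π lam) {c : R} (hc : σ c = c) : τ (π c) = π c := by
  rw [← h.proj_iterate_lam, Function.iterate_fixed hc]

theorem const_eq_zero (h : IsCyclicProduct σ τ π lam) {c : R} (hc : σ c = c) (h0 : π c = 0) :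
    c = 0 :=
  h.eq_zero c fun s _ => by rw [Function.iterate_fixed hc, h0]

theorem exists_lift (h : IsCyclicProduct σ τ π lam) (y : ℕ → D) :
    ∃ x, ∀ s < lam, π (σ^[s] x) = y s := by
  have key : ∀ s, ∃ x, s < lam →
      ∀ s' < lam, π (σ^[s'] x) = if s' = s then y s else 0 := fun s => by
    by_cases hs : s < lam
    · exact (h.exists_single s hs (y s)).imp fun x hx _ => hx
    · exact ⟨0, fun h => absurd h hs⟩
  choose x hx using key
  refine ⟨∑ s ∈ range lam, x s, fun s' hs' => ?_⟩
  rw [← RingAut.coe_pow, map_sum, map_sum, RingAut.coe_pow, sum_congr rfl fun s hs =>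
    hx s (mem_range.1 hs) s' hs', sum_ite_eq, if_pos (mem_range.2 hs')]

/-- A constant of `D`, repeated in all the components, is a constant of `R`. -/
theorem exists_const (h : IsCyclicProduct σ τ π lam) {y : D} (hy : τ y = y) :
    ∃ x, σ x = x ∧ π x = y := by
  obtain ⟨x, hx⟩ := h.exists_lift fun _ => y
  refine ⟨x, sub_eq_zero.1 (h.eq_zero _ fun s hs => ?_), hx 0 h.pos⟩
  rw [iterate_map_sub, map_sub, hx s hs, ← Function.iterate_succ_apply, sub_eq_zero]
  rcases Nat.lt_or_ge (s + 1) lam with h1 | h1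
  · exact hx _ h1
  · obtain rfl : s + 1 = lam := by omega
    rw [h.proj_iterate_lam, show π x = y from hx 0 h.pos, hy]

theorem isField_constants (h : IsCyclicProduct σ τ π lam) [Nontrivial D]
    (hunit : ∀ y : D, τ y = y → y ≠ 0 → IsUnit y) : IsField (constants σ) where
  exists_pair_ne := ⟨0, 1, fun h0 => by
    have h1 := congrArg (fun x : constants σ => π x) h0
    simp at h1⟩
  mul_comm := mul_comm
  mul_inv_cancel := by
    rintro ⟨c, hc⟩ hne
    have hc0 : π c ≠ 0 := fun h0 => hne (Subtype.ext (h.const_eq_zero hc h0))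
    obtain ⟨z, hz⟩ := (hunit _ (h.proj_const hc) hc0).exists_right_inv
    have hτz : τ z = z := by
      apply (hunit _ (h.proj_const hc) hc0).mul_left_cancel
      conv_lhs => rw [← h.proj_const hc]
      rw [← map_mul, hz, map_one]
    obtain ⟨x, hx, rfl⟩ := h.exists_const hτz
    refine ⟨⟨x, hx⟩, Subtype.ext (sub_eq_zero.1 (h.const_eq_zero ?_ ?_))⟩
    · simp [mem_constants.1 hc, hx]
    · simp [hz]

end IsCyclicProduct

/-! ### Kernels of linear maps on finitely generated spaces -/

/-- The span of finitely many vectors has a basis of vectors `b` in the kernel of `L` and vectors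
`p` whose images are linearly independent. -/
theorem exists_kernel_complement {K M N ι : Type*} [Field K] [AddCommGroup M] [AddCommGroup N]
    [Module K M] [Module K N] [Finite ι] (L : M →ₗ[K] N) (w : ι → M) :
    ∃ (r q : ℕ) (b : Fin r → M) (p : Fin q → M), (∀ k, L (b k) = 0) ∧ LinearIndependent K b ∧
      LinearIndependent K (fun k => L (p k)) ∧
      ∀ i, w i ∈ Submodule.span K (Set.range b ∪ Set.range p) := by
  set W := Submodule.span K (Set.range w) with hW
  have : FiniteDimensional K W := FiniteDimensional.span_of_finite K (Set.finite_range w)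
  set L' : W →ₗ[K] N := L.domRestrict W with hL'
  obtain ⟨U, hU⟩ := Submodule.exists_isCompl (LinearMap.ker L')
  set b₀ := Module.finBasis K (LinearMap.ker L')
  set p₀ := Module.finBasis K U
  have hspan : ∀ {n : ℕ} {V : Submodule K W} (β : Module.Basis (Fin n) K V) (x : V),
      ((x : W) : M) ∈ Submodule.span K (Set.range fun k => ((β k : W) : M)) := by
    intro n V β x
    rw [← β.sum_repr x]
    simp only [Submodule.coe_sum, Submodule.coe_smul]
    exact Submodule.sum_mem _ fun k _ =>
      Submodule.smul_mem _ _ (Submodule.subset_span ⟨k, rfl⟩)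
  refine ⟨_, _, fun k => ((b₀ k : W) : M), fun k => ((p₀ k : W) : M), fun k => (b₀ k).2, ?_, ?_,
    fun i => ?_⟩
  · exact (b₀.linearIndependent.map' (LinearMap.ker L').subtype (Submodule.ker_subtype _)).map'
      W.subtype (Submodule.ker_subtype _)
  · refine p₀.linearIndependent.map' (L'.comp U.subtype) ?_
    rw [LinearMap.ker_eq_bot']
    intro x hx
    exact Subtype.ext ((Submodule.disjoint_def.1 hU.disjoint) x hx x.2)
  · have hwi : w i ∈ W := Submodule.subset_span ⟨i, rfl⟩
    obtain ⟨x, hx, y, hy, hxy⟩ := Submodule.mem_sup.1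
      (hU.sup_eq_top ▸ Submodule.mem_top : (⟨w i, hwi⟩ : W) ∈ LinearMap.ker L' ⊔ U)
    have h1 := congrArg Subtype.val hxy
    rw [Submodule.span_union, show w i = (x : M) + (y : M) from h1.symm]
    exact Submodule.add_mem_sup (hspan b₀ ⟨x, hx⟩) (hspan p₀ ⟨y, hy⟩)

/-! ### Spans of coded vectors -/

section CodedSpan

variable {R : Type*} [CommRing R] {σ : R ≃+* R} {ν : ℕ → R} {d : ℕ} {B : List (List ℕ × ℕ)}

namespace InCodedSpan

theorem congr {c c' : ℕ → R} {g : R} (h : InCodedSpan σ ν d B c g) (hc : ∀ j < d, c' j = c j) :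
    InCodedSpan σ ν d B c' g :=
  let ⟨y, hy, h1, h2⟩ := h
  ⟨y, hy, fun j hj => (hc j hj).trans (h1 j hj), h2⟩

theorem zero : InCodedSpan σ ν d B (fun _ => 0) 0 :=
  ⟨fun _ => 0, by simp, by simp, by simp⟩

theorem add {c c' : ℕ → R} {g g' : R} (h : InCodedSpan σ ν d B c g)
    (h' : InCodedSpan σ ν d B c' g') : InCodedSpan σ ν d B (fun j => c j + c' j) (g + g') := by
  obtain ⟨y, hy, h1, h2⟩ := h
  obtain ⟨y', hy', h1', h2'⟩ := h'
  refine ⟨fun k => y k + y' k, fun k => by rw [map_add, hy, hy'], fun j hj => ?_, ?_⟩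
  · simp only [add_mul, sum_add_distrib, h1 j hj, h1' j hj]
  · simp only [add_mul, sum_add_distrib, h2, h2']

theorem mul {c : ℕ → R} {g x : R} (hx : σ x = x) (h : InCodedSpan σ ν d B c g) :
    InCodedSpan σ ν d B (fun j => x * c j) (x * g) := by
  obtain ⟨y, hy, h1, h2⟩ := h
  refine ⟨fun k => x * y k, fun k => by rw [map_mul, hx, hy], fun j hj => ?_, ?_⟩
  · simp only [mul_assoc, ← mul_sum, h1 j hj]
  · simp only [mul_assoc, ← mul_sum, h2]

theorem sum {ι : Type*} (s : Finset ι) {c : ι → ℕ → R} {g : ι → R}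
    (h : ∀ i ∈ s, InCodedSpan σ ν d B (c i) (g i)) :
    InCodedSpan σ ν d B (fun j => ∑ i ∈ s, c i j) (∑ i ∈ s, g i) := by
  classical
  induction s using Finset.induction_on with
  | empty => simpa using zero
  | insert i s hi ih =>
    simp only [sum_insert hi]
    exact add (h i (mem_insert_self _ _)) (ih fun l hl => h l (mem_insert_of_mem hl))

theorem mem {k : ℕ} (hk : k < B.length) :
    InCodedSpan σ ν d B (fun j => ν (codedConst B k j)) (ν (codedSol B k)) := by
  refine ⟨fun l => if l = k then 1 else 0, fun l => ?_, fun j _ => ?_, ?_⟩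
  · dsimp only
    split_ifs <;> simp
  · simp [hk]
  · simp [hk]

end InCodedSpan

theorem re_inCodedSpan (hν : IsComputable σ ν) {α : Type*} [Primcodable α]
    {L : α → List (List ℕ × ℕ)} (hL : Computable L) {d : α → ℕ} (hd : Computable d)
    {c : α → ℕ → R} (hc : ComputableVal ν fun x : α × ℕ => c x.1 x.2) {g : α → R}
    (hg : ComputableVal ν g) : REPred fun a => InCodedSpan σ ν (d a) (L a) (c a) (g a) := by
  have h : REPred fun x : α => ∃ y : List ℕ,
      (∀ k < (L x).length, σ (ν (y.getD k 0)) = ν (y.getD k 0)) ∧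
      (∀ j < d x, c x j = ∑ k ∈ range (L x).length, ν (y.getD k 0) * ν (codedConst (L x) k j)) ∧
      g x = ∑ k ∈ range (L x).length, ν (y.getD k 0) * ν (codedSol (L x) k) := by
    refine REPred.exists_right
      (REPred.and ?_ (REPred.and ?_ ?_))
    · refine REPred.forall_lt ?_ (by fun_prop)
      exact ComputableVal.re_eq hν
        (ComputableVal.aut hν (ComputableVal.getD (by fun_prop) (by fun_prop)))
        (ComputableVal.getD (by fun_prop) (by fun_prop))
    · refine REPred.forall_lt ?_
        (by fun_prop)
      refine ComputableVal.re_eq hν (hc.comp (f := fun z : (α × List ℕ) × ℕ => (z.1.1, z.2))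
        (by fun_prop)) (ComputableVal.sum hν (by fun_prop) (ComputableVal.mul hν
          (ComputableVal.getD (by fun_prop) (by fun_prop)) (ComputableVal.of_code ?_)))
      unfold codedConst
      fun_prop
    · refine ComputableVal.re_eq hν (hg.comp Computable.fst) (ComputableVal.sum hν (by fun_prop)
        (ComputableVal.mul hν (ComputableVal.getD (by fun_prop) (by fun_prop))
          (ComputableVal.of_code ?_)))
      unfold codedSol
      fun_prop
  refine h.of_eq fun x => ⟨?_, ?_⟩
  · rintro ⟨y, h0, h1, h2⟩
    refine ⟨fun k => if k < (L x).length then ν (y.getD k 0) else 0, fun k => ?_,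
      fun j hj => ?_, ?_⟩
    · dsimp only
      split_ifs with hk
      · exact h0 k hk
      · exact map_zero σ
    · rw [h1 j hj]
      exact sum_congr rfl fun k hk => by simp only [if_pos (mem_range.1 hk)]
    · rw [h2]
      exact sum_congr rfl fun k hk => by simp only [if_pos (mem_range.1 hk)]
  · rintro ⟨y, h0, h1, h2⟩
    obtain ⟨l, -, hl⟩ := exists_codes hν.surjective (L x).length y
    refine ⟨l, fun k hk => by rw [hl k hk, h0], fun j hj => ?_, ?_⟩
    · rw [h1 j hj]
      exact sum_congr rfl fun k hk => by rw [hl k (mem_range.1 hk)]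
    · rw [h2]
      exact sum_congr rfl fun k hk => by rw [hl k (mem_range.1 hk)]

theorem exists_codedList (hν : Function.Surjective ν) {r : ℕ}
    (b : Fin r → (Fin d → constants σ) × R) :
    ∃ B : List (List ℕ × ℕ), B.length = r ∧ ∀ k : Fin r, (B.getD k ([], 0)).1.length = d ∧
      (∀ j : Fin d, ν (codedConst B k j) = ((b k).1 j : R)) ∧ ν (codedSol B k) = (b k).2 := by
  choose f hf using hν
  refine ⟨List.ofFn fun k => (List.ofFn fun j => f ((b k).1 j), f (b k).2), by simp,
    fun k => ⟨?_, fun j => ?_, ?_⟩⟩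
  · rw [List.getD_eq_getElem _ _ (by simp)]
    simp
  · rw [codedConst_ofFn (fun k j => f ((b k).1 j)), hf]
  · rw [codedSol_ofFn (fun k j => f ((b k).1 j)), hf]

theorem codedConst_append_left {B P : List (List ℕ × ℕ)} {k : ℕ} (hk : k < B.length) (j : ℕ) :
    codedConst (B ++ P) k j = codedConst B k j := by
  rw [codedConst, codedConst, List.getD_append _ _ _ _ hk]

theorem codedConst_append_right (B P : List (List ℕ × ℕ)) (k j : ℕ) :
    codedConst (B ++ P) (B.length + k) j = codedConst P k j := by
  rw [codedConst, codedConst, List.getD_append_right _ _ _ _ (Nat.le_add_right _ _),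
    Nat.add_sub_cancel_left]

theorem codedSol_append_left {B P : List (List ℕ × ℕ)} {k : ℕ} (hk : k < B.length) :
    codedSol (B ++ P) k = codedSol B k := by
  rw [codedSol, codedSol, List.getD_append _ _ _ _ hk]

theorem codedSol_append_right (B P : List (List ℕ × ℕ)) (k : ℕ) :
    codedSol (B ++ P) (B.length + k) = codedSol P k := by
  rw [codedSol, codedSol, List.getD_append_right _ _ _ _ (Nat.le_add_right _ _),
    Nat.add_sub_cancel_left]

/-- The difference `a₀ g + ⋯ + a_{M-1} σ^{M-1}(g) - (c₁ f₁ + ⋯ + c_d f_d)` of the two sides of the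
equation. -/
def residual (σ : R ≃+* R) (M d : ℕ) (a f : ℕ → R) (c : ℕ → R) (g : R) : R :=
  ∑ i ∈ range M, a i * σ^[i] g - ∑ j ∈ range d, c j * f j

theorem residual_sum {M : ℕ} {a f : ℕ → R} {n : ℕ} {y : ℕ → R} (hy : ∀ k, σ (y k) = y k)
    {c : ℕ → R} {g : R} {C : ℕ → ℕ → R} {G : ℕ → R}
    (hc : ∀ j < d, c j = ∑ k ∈ range n, y k * C k j) (hg : g = ∑ k ∈ range n, y k * G k) :
    residual σ M d a f c g = ∑ k ∈ range n, y k * residual σ M d a f (C k) (G k) := by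
  simp only [residual, mul_sub, sum_sub_distrib, mul_sum]
  congr 1
  · rw [sum_comm]
    refine sum_congr rfl fun i _ => ?_
    rw [hg, ← RingAut.coe_pow, map_sum, mul_sum]
    refine sum_congr rfl fun k _ => ?_
    rw [RingAut.coe_pow, iterate_map_mul, Function.iterate_fixed (hy k)]
    ring
  · rw [sum_comm]
    refine sum_congr rfl fun j hj => ?_
    rw [hc j (mem_range.1 hj), sum_mul]
    exact sum_congr rfl fun k _ => by ring

/-- The solutions in the span of `B` and `P` lie in the span of `B` if the residuals of `P` are
linearly independent over the constants. -/
theorem InCodedSpan.of_append {M : ℕ} {a f : ℕ → R} {B P : List (List ℕ × ℕ)}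
    (hB : ∀ k < B.length,
      residual σ M d a f (fun j => ν (codedConst B k j)) (ν (codedSol B k)) = 0)
    (hP : ∀ y : ℕ → R, (∀ k, σ (y k) = y k) → ∑ k ∈ range P.length, y k *
      residual σ M d a f (fun j => ν (codedConst P k j)) (ν (codedSol P k)) = 0 →
      ∀ k < P.length, y k = 0)
    {c : ℕ → R} {g : R} (h : InCodedSpan σ ν d (B ++ P) c g)
    (h0 : residual σ M d a f c g = 0) : InCodedSpan σ ν d B c g := by
  obtain ⟨y, hy, h1, h2⟩ := h
  have hres := residual_sum (M := M) (a := a) (f := f) hy h1 h2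
  rw [h0, List.length_append, sum_range_add, sum_eq_zero (s := range B.length), zero_add] at hres
  · have hz := hP (fun k => y (B.length + k)) (fun k => hy _) (by
      rw [hres]
      refine sum_congr rfl fun k _ => ?_
      simp only [codedConst_append_right, codedSol_append_right])
    refine ⟨y, hy, fun j hj => ?_, ?_⟩
    · rw [h1 j hj, List.length_append, sum_range_add, sum_eq_zero (s := range P.length), add_zero]
      · exact sum_congr rfl fun k hk => by rw [codedConst_append_left (mem_range.1 hk)]
      · intro k hk
        rw [hz k (mem_range.1 hk), zero_mul]
    · rw [h2, List.length_append, sum_range_add, sum_eq_zero (s := range P.length), add_zero]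
      · exact sum_congr rfl fun k hk => by rw [codedSol_append_left (mem_range.1 hk)]
      · intro k hk
        rw [hz k (mem_range.1 hk), zero_mul]
  · intro k hk
    rw [mem_range] at hk
    simp only [codedConst_append_left hk, codedSol_append_left hk]
    rw [hB k hk, mul_zero]

end CodedSpan

/-! ### Certificates for bases of solution spaces -/

section Certificate

variable {R D : Type*} [CommRing R] [CommRing D] {σ : R ≃+* R} {τ : D ≃+* D} {π : R →+* D}
  {lam : ℕ} {ν : ℕ → R} {ν₀ : ℕ → D} {solve : List ℕ × List ℕ →. List (List ℕ × ℕ)}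

/-- A certificate that the component `π (σ ^ s (g))` of every solution `(c, g)` is the component of
an element of the span of `L` whose other components vanish. The coefficients `y.1` eliminate the
columns `c` with `c % lam ≠ s` of the shift projection matrix; this leads to the equation with
coefficients `y.2.1` and right-hand sides `y.2.2.1` over `D`, whose solutions `y.2.2.2` are
computed by `solve`. -/
def ComponentCert (σ : R ≃+* R) (π : R →+* D) (lam : ℕ) (ν : ℕ → R) (ν₀ : ℕ → D)
    (solve : List ℕ × List ℕ →. List (List ℕ × ℕ)) (s : ℕ) (la lf : List ℕ)
    (L : List (List ℕ × ℕ)) : Prop :=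
  ∃ y : List ℕ × List ℕ × List ℕ × List (List ℕ × ℕ),
    (∀ c < la.length * lam, c % lam ≠ s → ∑ j ∈ range (la.length * lam - (la.length - 1)),
      ν₀ (y.1.getD j 0) * shiftEntry σ π la.length (fun i => ν (la.getD i 0)) j c = 0) ∧
    y.2.1.length = la.length ∧
    (∀ k < la.length, ν₀ (y.2.1.getD k 0) =
      ∑ j ∈ range (la.length * lam - (la.length - 1)), ν₀ (y.1.getD j 0) *
        shiftEntry σ π la.length (fun i => ν (la.getD i 0)) j (k * lam + s)) ∧
    (∃ k, k < la.length ∧ ν₀ (y.2.1.getD k 0) ≠ 0) ∧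
    y.2.2.1.length = lf.length ∧
    (∀ l < lf.length, ν₀ (y.2.2.1.getD l 0) =
      ∑ j ∈ range (la.length * lam - (la.length - 1)), ν₀ (y.1.getD j 0) *
        π (σ^[j] (ν (lf.getD l 0)))) ∧
    y.2.2.2 ∈ solve (y.2.1, y.2.2.1) ∧
    ∀ k < y.2.2.2.length, ∃ h : ℕ,
      (∀ s' < lam, π (σ^[s'] (ν h)) = if s' = s then ν₀ (codedSol y.2.2.2 k) else 0) ∧
      InCodedSpan σ ν lf.length L (fun _ => 0) (ν h)

/-- A certificate that `B` codes a basis of the solution space: `B` consists of solutions that are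
linearly independent, as seen from the projections of `c₁, …, c_d` and the `lam` components of `g`;
together with some vectors `P`, whose residuals are linearly independent, it spans a space that
contains all the solutions. -/
def BasisCert (σ : R ≃+* R) (τ : D ≃+* D) (π : R →+* D) (lam : ℕ) (ν : ℕ → R) (ν₀ : ℕ → D)
    (solve : List ℕ × List ℕ →. List (List ℕ × ℕ)) (la lf : List ℕ) (B : List (List ℕ × ℕ)) :
    Prop :=
  (∀ k < B.length, (B.getD k ([], 0)).1.length = lf.length) ∧
  (∀ k < B.length, ∀ j < lf.length, σ (ν (codedConst B k j)) = ν (codedConst B k j)) ∧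
  (∀ k < B.length, residual σ la.length lf.length (fun i => ν (la.getD i 0))
    (fun j => ν (lf.getD j 0)) (fun j => ν (codedConst B k j)) (ν (codedSol B k)) = 0) ∧
  ConstIndep τ B.length (lf.length + lam) (fun k κ =>
    if κ < lf.length then π (ν (codedConst B k κ))
    else π (σ^[κ - lf.length] (ν (codedSol B k)))) ∧
  ∃ P : List (List ℕ × ℕ),
    ConstIndep τ P.length lam (fun k s => π (σ^[s] (residual σ la.length lf.length
      (fun i => ν (la.getD i 0)) (fun j => ν (lf.getD j 0)) (fun j => ν (codedConst P k j))
      (ν (codedSol P k))))) ∧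
    (∀ j < lf.length, InCodedSpan σ ν lf.length (B ++ P) (fun l => if l = j then 1 else 0) 0) ∧
    ∀ s < lam, ComponentCert σ π lam ν ν₀ solve s la lf (B ++ P)

theorem re_componentCert (hν : IsComputable σ ν) (hν₀ : IsComputable τ ν₀)
    (hπ : ComputableVal ν₀ fun n => π (ν n)) (hsolve : Partrec solve) :
    REPred fun x : ℕ × (List ℕ × List ℕ) × List (List ℕ × ℕ) =>
      ComponentCert σ π lam ν ν₀ solve x.1 x.2.1.1 x.2.1.2 x.2.2 := by
  have hentry : ∀ {α : Type} [Primcodable α] {la : α → List ℕ} {j c : α → ℕ}, Computable la →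
      Computable j → Computable c → ComputableVal ν₀ fun x =>
        shiftEntry σ π (la x).length (fun i => ν ((la x).getD i 0)) (j x) (c x) := by
    intro α _ la j c hla hj hc
    refine ComputableVal.ite (ComputablePred.and (ComputablePred.natLe hj hc)
      (ComputablePred.natLt (by fun_prop) (by fun_prop))) (hπ.map
        (ComputableVal.iterate hν (ComputableVal.getD hla (by fun_prop)) hj))
      (ComputableVal.const hν₀ 0)
  unfold ComponentCert
  refine REPred.exists_right (REPred.and ?_ (REPred.and ?_ (REPred.and ?_ (REPred.and ?_
    (REPred.and ?_ (REPred.and ?_ (REPred.and ?_ ?_)))))))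
  · refine REPred.forall_lt ?_ (by fun_prop)
    refine REPred.imp (ComputablePred.natEq (by fun_prop) (by fun_prop)).not ?_
    exact ComputableVal.re_eq hν₀ (ComputableVal.sum hν₀ (by fun_prop) (ComputableVal.mul hν₀
      (ComputableVal.getD (by fun_prop) (by fun_prop))
      (hentry (by fun_prop) (by fun_prop) (by fun_prop)))) (ComputableVal.const hν₀ 0)
  · exact (ComputablePred.natEq (by fun_prop) (by fun_prop)).to_re
  · refine REPred.forall_lt ?_ (by fun_prop)
    exact ComputableVal.re_eq hν₀ (ComputableVal.getD (by fun_prop) (by fun_prop))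
      (ComputableVal.sum hν₀ (by fun_prop) (ComputableVal.mul hν₀
        (ComputableVal.getD (by fun_prop) (by fun_prop))
        (hentry (by fun_prop) (by fun_prop) (by fun_prop))))
  · refine REPred.exists_right ?_
    exact REPred.and (ComputablePred.natLt (by fun_prop) (by fun_prop)).to_re
      (ComputableVal.eq hν₀ (ComputableVal.getD (by fun_prop) (by fun_prop))
        (ComputableVal.const hν₀ 0)).not.to_re
  · exact (ComputablePred.natEq (by fun_prop) (by fun_prop)).to_re
  · refine REPred.forall_lt ?_ (by fun_prop)
    exact ComputableVal.re_eq hν₀ (ComputableVal.getD (by fun_prop) (by fun_prop))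
      (ComputableVal.sum hν₀ (by fun_prop) (ComputableVal.mul hν₀
        (ComputableVal.getD (by fun_prop) (by fun_prop))
        (hπ.map (ComputableVal.iterate hν (ComputableVal.getD (by fun_prop) (by fun_prop))
          (by fun_prop)))))
  · exact REPred.mem_partrec (hsolve.comp (by fun_prop)) (by fun_prop)
  · refine REPred.forall_lt ?_ (by fun_prop)
    refine REPred.exists_right ?_
    refine REPred.and ?_ ?_
    · refine REPred.forall_lt ?_ (Computable.const lam)
      refine ComputableVal.re_eq hν₀ (hπ.map (ComputableVal.iterate hν
        (ComputableVal.of_code (by fun_prop)) (by fun_prop)))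
        (ComputableVal.ite (ComputablePred.natEq (by fun_prop) (by fun_prop))
          (ComputableVal.of_code ?_) (ComputableVal.const hν₀ 0))
      unfold codedSol
      fun_prop
    · exact re_inCodedSpan hν (by fun_prop) (by fun_prop) (ComputableVal.const hν 0)
        (ComputableVal.of_code (by fun_prop))

theorem re_basisCert (hν : IsComputable σ ν) (hν₀ : IsComputable τ ν₀)
    (hπ : ComputableVal ν₀ fun n => π (ν n)) (hsolve : Partrec solve)
    (hind : ∀ {α : Type} [Primcodable α] {n q : α → ℕ} {u : α → ℕ → ℕ → D}, Computable n →
      Computable q → ComputableVal ν₀ (fun x : α × ℕ × ℕ => u x.1 x.2.1 x.2.2) →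
      REPred fun a => ConstIndep τ (n a) (q a) (u a)) :
    REPred fun x : (List ℕ × List ℕ) × List (List ℕ × ℕ) =>
      BasisCert σ τ π lam ν ν₀ solve x.1.1 x.1.2 x.2 := by
  have hconst : ∀ {α : Type} [Primcodable α] {B : α → List (List ℕ × ℕ)} {k j : α → ℕ},
      Computable B → Computable k → Computable j →
      ComputableVal ν fun x => ν (codedConst (B x) (k x) (j x)) := by
    intro α _ B k j hB hk hj
    refine ComputableVal.of_code ?_
    unfold codedConst
    fun_prop
  have hsol : ∀ {α : Type} [Primcodable α] {B : α → List (List ℕ × ℕ)} {k : α → ℕ},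
      Computable B → Computable k → ComputableVal ν fun x => ν (codedSol (B x) (k x)) := by
    intro α _ B k hB hk
    refine ComputableVal.of_code ?_
    unfold codedSol
    fun_prop
  have hres : ∀ {α : Type} [Primcodable α] {la lf : α → List ℕ} {B : α → List (List ℕ × ℕ)}
      {k : α → ℕ}, Computable la → Computable lf → Computable B → Computable k →
      ComputableVal ν fun x => residual σ (la x).length (lf x).length
        (fun i => ν ((la x).getD i 0)) (fun j => ν ((lf x).getD j 0))
        (fun j => ν (codedConst (B x) (k x) j)) (ν (codedSol (B x) (k x))) := by
    intro α _ la lf B k hla hlf hB hk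
    exact ComputableVal.sub hν
      (ComputableVal.sum hν (by fun_prop) (ComputableVal.mul hν
        (ComputableVal.getD (by fun_prop) (by fun_prop))
        (ComputableVal.iterate hν (hsol (by fun_prop) (by fun_prop)) (by fun_prop))))
      (ComputableVal.sum hν (by fun_prop) (ComputableVal.mul hν
        (hconst (by fun_prop) (by fun_prop) (by fun_prop))
        (ComputableVal.getD (by fun_prop) (by fun_prop))))
  have happ : ∀ {α : Type} [Primcodable α] {B P : α → List (List ℕ × ℕ)},
      Computable B → Computable P → Computable fun x => B x ++ P x :=
    fun hB hP => Computable.list_append.comp hB hP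
  unfold BasisCert
  refine REPred.and ?_ (REPred.and ?_ (REPred.and ?_ (REPred.and ?_ ?_)))
  · refine REPred.forall_lt ?_ (by fun_prop)
    exact (ComputablePred.natEq (by fun_prop) (by fun_prop)).to_re
  · refine REPred.forall_lt ?_ (by fun_prop)
    refine REPred.forall_lt ?_ (by fun_prop)
    have h := hconst (α := (((List ℕ × List ℕ) × List (List ℕ × ℕ)) × ℕ) × ℕ)
      (B := fun z => z.1.1.2) (k := fun z => z.1.2) (j := fun z => z.2) (by fun_prop)
      (by fun_prop) (by fun_prop)
    exact ComputableVal.re_eq hν (ComputableVal.aut hν h) h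
  · refine REPred.forall_lt ?_ (by fun_prop)
    have h := hres (α := ((List ℕ × List ℕ) × List (List ℕ × ℕ)) × ℕ) (la := fun z => z.1.1.1)
      (lf := fun z => z.1.1.2) (B := fun z => z.1.2) (k := fun z => z.2) (by fun_prop)
      (by fun_prop) (by fun_prop) (by fun_prop)
    exact ComputableVal.re_eq hν h (ComputableVal.const hν 0)
  · refine hind (by fun_prop) (by fun_prop) ?_
    refine ComputableVal.ite (ComputablePred.natLt (by fun_prop) (by fun_prop)) ?_ ?_
    · exact hπ.map (hconst (by fun_prop) (by fun_prop) (by fun_prop))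
    · exact hπ.map (ComputableVal.iterate hν (hsol (by fun_prop) (by fun_prop)) (by fun_prop))
  · refine REPred.exists_right ?_
    refine REPred.and ?_ (REPred.and ?_ ?_)
    · refine hind (by fun_prop) (by fun_prop) ?_
      refine hπ.map (ComputableVal.iterate hν ?_ (by fun_prop))
      exact hres (by fun_prop) (by fun_prop) (by fun_prop) (by fun_prop)
    · refine REPred.forall_lt ?_ (by fun_prop)
      refine re_inCodedSpan hν (happ (by fun_prop) (by fun_prop)) (by fun_prop) ?_
        (ComputableVal.const hν 0)
      exact ComputableVal.ite (ComputablePred.natEq (by fun_prop) (by fun_prop))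
        (ComputableVal.const hν 1) (ComputableVal.const hν 0)
    · refine REPred.forall_lt ?_ (Computable.const lam)
      exact (re_componentCert hν hν₀ hπ hsolve).comp
        (f := fun z : (((List ℕ × List ℕ) × List (List ℕ × ℕ)) × List (List ℕ × ℕ)) × ℕ =>
          (z.2, z.1.1.1, z.1.1.2 ++ z.1.2)) (Computable.pair_fun (by fun_prop)
            (Computable.pair_fun (by fun_prop) (happ (by fun_prop) (by fun_prop))))

end Certificate

/-! ### Soundness and completeness of the certificates -/

section Certificate

variable {R D : Type*} [CommRing R] [CommRing D] {σ : R ≃+* R} {τ : D ≃+* D} {π : R →+* D}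
  {lam : ℕ} {ν : ℕ → R} {ν₀ : ℕ → D} {solve : List ℕ × List ℕ →. List (List ℕ × ℕ)}

/-- The equations over `D` satisfied by the components `π (σ ^ s (g))` of the solutions. -/
theorem IsCyclicProduct.eliminant_eq (h : IsCyclicProduct σ τ π lam) {M d s : ℕ} (hM : 0 < M)
    (hs : s < lam) {a f c : ℕ → R} {g : R} (hc : ∀ j, σ (c j) = c j)
    (hg : residual σ M d a f c g = 0) {v : ℕ → D}
    (hv : ∀ c < M * lam, c % lam ≠ s →
      ∑ j ∈ range (M * lam - (M - 1)), v j * shiftEntry σ π M a j c = 0) :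
    ∑ k ∈ range M, (∑ j ∈ range (M * lam - (M - 1)),
        v j * shiftEntry σ π M a j (k * lam + s)) * τ^[k] (π (σ^[s] g)) =
      ∑ l ∈ range d, π (c l) *
        ∑ j ∈ range (M * lam - (M - 1)), v j * π (σ^[j] (f l)) := by
  simp only [← h.proj_iterate]
  rw [sum_eliminant hs a hv hM, sub_eq_zero.1 hg]
  simp only [mul_sum]
  rw [sum_comm]
  refine sum_congr rfl fun j _ => ?_
  rw [← RingAut.coe_pow, map_sum, map_sum, mul_sum]
  refine sum_congr rfl fun l _ => ?_
  rw [RingAut.coe_pow, iterate_map_mul, Function.iterate_fixed (hc l), map_mul]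
  ring

/-- The `s`-th component of a solution satisfies an equation over `D` whose solutions are spanned by
the output of `solve`, so it is the `s`-th component of an element of the certified span. -/
theorem ComponentCert.exists_component (h : IsCyclicProduct σ τ π lam)
    (H : ∀ (m d : ℕ) (a : Fin (m + 1) → ℕ) (f : Fin d → ℕ), (fun i => ν₀ (a i)) ≠ 0 →
      ∃ B ∈ solve (List.ofFn a, List.ofFn f),
        IsCodedBasis τ ν₀ (fun i => ν₀ (a i)) (fun j => ν₀ (f j)) B)
    {m s : ℕ} (hs : s < lam) {la lf : List ℕ} (hla : la.length = m + 1) {L : List (List ℕ × ℕ)}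
    (hcert : ComponentCert σ π lam ν ν₀ solve s la lf L) {c : ℕ → R} (hc : ∀ j, σ (c j) = c j)
    {g : R} (hg : residual σ la.length lf.length (fun i => ν (la.getD i 0))
      (fun j => ν (lf.getD j 0)) c g = 0) :
    ∃ g', InCodedSpan σ ν lf.length L (fun _ => 0) g' ∧
      ∀ s' < lam, π (σ^[s'] g') = if s' = s then π (σ^[s] g) else 0 := by
  obtain ⟨⟨lv, lb, lφ, Bs⟩, hv, hb, hbval, ⟨k₀, hk₀, hne⟩, hφ, hφval, hmem, hlift⟩ := hcert
  dsimp only at hv hb hbval hk₀ hne hφ hφval hmem hlift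
  have heq := h.eliminant_eq (by omega) hs hc hg hv
  obtain ⟨B, hB, hbasis⟩ := exists_isCodedBasis (ν := ν₀) (P := fun _ a => a ≠ 0) H (m := m)
    (hb.trans hla) hφ (fun h0 => hne (congrFun h0 (⟨k₀, by omega⟩ : Fin (m + 1))))
  obtain rfl : B = Bs := Part.mem_unique hB hmem
  obtain ⟨y, hy, -, hsum⟩ := hbasis.inCodedSpan (a := fun i => ν₀ (lb.getD i 0))
    (f := fun j => ν₀ (lφ.getD j 0)) (c := fun j => π (c j)) (fun j => h.proj_const (hc j))
    (g := π (σ^[s] g)) (by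
      rw [← hla]
      refine Eq.trans (sum_congr rfl fun k hk => ?_) (heq.trans (sum_congr rfl fun l hl => ?_))
      · rw [hbval k (mem_range.1 hk)]
      · rw [hφval l (mem_range.1 hl)])
  choose x hx hxy using fun k => h.exists_const (hy k)
  have hlift' : ∀ k, ∃ n : ℕ, k < B.length →
      (∀ s' < lam, π (σ^[s'] (ν n)) = if s' = s then ν₀ (codedSol B k) else 0) ∧
      InCodedSpan σ ν lf.length L (fun _ => 0) (ν n) := fun k => by
    by_cases hk : k < B.length
    · exact (hlift k hk).imp fun n hn _ => hn
    · exact ⟨0, fun hk' => absurd hk' hk⟩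
  choose n hn using hlift'
  refine ⟨∑ k ∈ range B.length, x k * ν (n k), ?_, fun s' hs' => ?_⟩
  · refine (InCodedSpan.sum (range B.length) fun k hk =>
      ((hn k (mem_range.1 hk)).2.mul (hx k))).congr fun j _ => ?_
    simp
  · rw [← RingAut.coe_pow, map_sum, map_sum]
    simp only [map_mul, RingAut.coe_pow, Function.iterate_fixed (hx _), hxy]
    rw [sum_congr rfl fun k hk => by rw [(hn k (mem_range.1 hk)).1 s' hs']]
    split_ifs with hss
    · exact hsum.symm
    · simp

/-- Soundness: a solution is a combination of unit vectors `(e_j, 0)` and of one vector `(0, g_s)`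
for each component, all of which lie in the span of `B` and `P`, so it lies in the span of `B`. -/
theorem BasisCert.isCodedBasis (h : IsCyclicProduct σ τ π lam)
    (H : ∀ (m d : ℕ) (a : Fin (m + 1) → ℕ) (f : Fin d → ℕ), (fun i => ν₀ (a i)) ≠ 0 →
      ∃ B ∈ solve (List.ofFn a, List.ofFn f),
        IsCodedBasis τ ν₀ (fun i => ν₀ (a i)) (fun j => ν₀ (f j)) B)
    {m d : ℕ} {la lf : List ℕ} (hla : la.length = m + 1) (hlf : lf.length = d)
    {B : List (List ℕ × ℕ)} (hcert : BasisCert σ τ π lam ν ν₀ solve la lf B) :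
    IsCodedBasis σ ν (fun i : Fin (m + 1) => ν (la.getD i 0)) (fun j : Fin d => ν (lf.getD j 0))
      B := by
  subst hlf
  obtain ⟨hlen, hconst, hres, hind, P, hindP, hunits, hcomp⟩ := hcert
  refine isCodedBasis_of_span (a := fun i => ν (la.getD i 0)) (f := fun j => ν (lf.getD j 0)) hlen
    hconst (fun k hk => ?_) (fun x hx hx1 hx2 k hk => ?_) (fun c hc g hg => ?_)
  · rw [← hla]
    exact sub_eq_zero.1 (hres k hk)
  · refine h.const_eq_zero (hx k) (hind (fun k => π (x k)) (fun k => h.proj_const (hx k)) ?_ k hk)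
    intro κ hκ
    by_cases hκd : κ < lf.length
    · simp only [if_pos hκd]
      have := congrArg π (hx1 κ hκd)
      simpa using this
    · simp only [if_neg hκd]
      have := congrArg (fun z => π ((σ ^ (κ - lf.length) : RingAut R) z)) hx2
      simp only [map_sum, map_mul, map_zero] at this
      rw [← this]
      refine sum_congr rfl fun l _ => ?_
      rw [RingAut.coe_pow, Function.iterate_fixed (hx l)]
  · rw [← hla] at hg
    have hg' : residual σ la.length lf.length (fun i => ν (la.getD i 0))
      (fun j => ν (lf.getD j 0)) c g = 0 := sub_eq_zero.2 hg
    refine InCodedSpan.of_append hres (P := P) (fun y hy hsum k hk => ?_) ?_ hg'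
    · refine h.const_eq_zero (hy k)
        (hindP (fun k => π (y k)) (fun k => h.proj_const (hy k)) ?_ k hk)
      intro s _
      have := congrArg (fun z => π ((σ ^ s : RingAut R) z)) hsum
      simp only [map_sum, map_mul, map_zero] at this
      rw [← this]
      refine sum_congr rfl fun l _ => ?_
      rw [RingAut.coe_pow, Function.iterate_fixed (hy l)]
    · have hg0 : InCodedSpan σ ν lf.length (B ++ P) (fun _ => 0) g := by
        have key : ∀ s, ∃ g', s < lam → InCodedSpan σ ν lf.length (B ++ P) (fun _ => 0) g' ∧
            ∀ s' < lam, π (σ^[s'] g') = if s' = s then π (σ^[s] g) else 0 := fun s => by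
          by_cases hs : s < lam
          · exact ((hcomp s hs).exists_component h H hs hla hc hg').imp fun g' hg' _ => hg'
          · exact ⟨0, fun hs' => absurd hs' hs⟩
        choose G hG using key
        have hsum : g = ∑ s ∈ range lam, G s := by
          refine sub_eq_zero.1 (h.eq_zero _ fun s' hs' => ?_)
          rw [iterate_map_sub, map_sub, ← RingAut.coe_pow, map_sum, map_sum, RingAut.coe_pow,
            sum_congr rfl fun s hs => (hG s (mem_range.1 hs)).2 s' hs', sum_ite_eq,
            if_pos (mem_range.2 hs'), sub_self]
        rw [hsum]
        exact (InCodedSpan.sum (range lam) fun s hs => (hG s (mem_range.1 hs)).1).congr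
          fun j _ => by simp
      have hc0 : InCodedSpan σ ν lf.length (B ++ P) c 0 := by
        have := InCodedSpan.sum (range lf.length) fun j hj =>
          (hunits j (mem_range.1 hj)).mul (hc j)
        simp only [mul_zero, sum_const_zero] at this
        refine this.congr fun j hj => ?_
        simp [hj]
      simpa using hc0.add hg0

/-- The residual as a linear map over the constants. -/
def residualHom (σ : R ≃+* R) (M d : ℕ) (a f : ℕ → R) :
    ((Fin d → constants σ) × R) →ₗ[constants σ] R where
  toFun p := ∑ i ∈ range M, a i * σ^[i] p.2 - ∑ j : Fin d, (p.1 j : R) * f j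
  map_add' p q := by
    simp only [Prod.snd_add, Prod.fst_add, Pi.add_apply, Subring.coe_add, iterate_map_add, mul_add,
      add_mul, sum_add_distrib]
    ring
  map_smul' x p := by
    simp only [Prod.smul_snd, Prod.smul_fst, Pi.smul_apply, Subring.smul_def, smul_eq_mul,
      Subring.coe_mul, iterate_map_mul, Function.iterate_fixed (mem_constants.1 x.2),
      RingHom.id_apply, mul_sub, mul_sum]
    congr 1
    · exact sum_congr rfl fun i _ => by ring
    · exact sum_congr rfl fun j _ => by ring

theorem residualHom_eq {M d : ℕ} {a f : ℕ → R} {p : (Fin d → constants σ) × R} {c : ℕ → R}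
    {g : R}
    (hc : ∀ j : Fin d, c j = p.1 j) (hg : g = p.2) :
    residualHom σ M d a f p = residual σ M d a f c g := by
  rw [residual, sum_range (n := d), hg]
  simp only [hc]
  rfl

theorem inCodedSpan_of_mem_span {d : ℕ} {B : List (List ℕ × ℕ)}
    {S : Set ((Fin d → constants σ) × R)}
    (hS : ∀ p ∈ S, ∀ c : ℕ → R, (∀ j : Fin d, c j = p.1 j) → InCodedSpan σ ν d B c p.2)
    {p : (Fin d → constants σ) × R} (hp : p ∈ Submodule.span (constants σ) S) :
    ∀ c : ℕ → R, (∀ j : Fin d, c j = p.1 j) → InCodedSpan σ ν d B c p.2 := by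
  have hext : ∀ q : (Fin d → constants σ) × R, ∃ c : ℕ → R, ∀ j : Fin d, c j = q.1 j := fun q =>
    ⟨fun j => if hj : j < d then (q.1 ⟨j, hj⟩ : R) else 0, fun j => by simp⟩
  induction hp using Submodule.span_induction with
  | mem q hq => exact hS q hq
  | zero => exact fun c hc => InCodedSpan.zero.congr fun j hj => by simpa using hc ⟨j, hj⟩
  | add q q' _ _ h h' =>
    intro c hc
    obtain ⟨e, he⟩ := hext q
    obtain ⟨e', he'⟩ := hext q'
    refine ((h e he).add (h' e' he')).congr fun j hj => ?_
    rw [hc ⟨j, hj⟩, he ⟨j, hj⟩, he' ⟨j, hj⟩]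
    rfl
  | smul x q _ h =>
    intro c hc
    obtain ⟨e, he⟩ := hext q
    refine ((h e he).mul x.2).congr fun j hj => ?_
    rw [hc ⟨j, hj⟩, he ⟨j, hj⟩]
    rfl

/-- The constants of `(R, σ)` and of `(D, τ)` correspond to each other under `π`, so linear
independence over the former can be tested in `D`. -/
theorem ConstIndep.of_linearIndependent (h : IsCyclicProduct σ τ π lam) {M : Type*}
    [AddCommGroup M] [Module (constants σ) M] {n q : ℕ} {b : Fin n → M}
    (hb : LinearIndependent (constants σ) b) {u : ℕ → ℕ → D}
    (hu : ∀ x : Fin n → constants σ,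
      (∀ κ < q, ∑ k, π (x k) * u k κ = 0) → ∑ k, x k • b k = 0) : ConstIndep τ n q u := by
  intro y hy hrel j hj
  choose x hx hxy using fun k => h.exists_const (hy k)
  rw [Fintype.linearIndependent_iff] at hb
  have h1 := hb (fun k => ⟨x k, hx k⟩) (hu _ fun κ hκ => by
    rw [← hrel κ hκ, sum_range]
    exact sum_congr rfl fun k _ => by rw [← hxy]) ⟨j, hj⟩
  rw [← hxy, show x j = 0 from congrArg Subtype.val h1, map_zero]

/-- Completeness for one component: an eliminant and the output of `solve` provide a certificate for
every span that contains finitely many given vectors `(0, x_k)`. -/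
theorem exists_componentData [IsDomain D] (h : IsCyclicProduct σ τ π lam)
    (hν : Function.Surjective ν) (hν₀ : Function.Surjective ν₀)
    (H : ∀ (m d : ℕ) (a : Fin (m + 1) → ℕ) (f : Fin d → ℕ), (fun i => ν₀ (a i)) ≠ 0 →
      ∃ B ∈ solve (List.ofFn a, List.ofFn f),
        IsCodedBasis τ ν₀ (fun i => ν₀ (a i)) (fun j => ν₀ (f j)) B)
    {m s : ℕ} {la lf : List ℕ} (hla : la.length = m + 1)
    (hnd : NonDegenerate σ π lam fun i : Fin (m + 1) => ν (la.getD i 0)) (hs : s < lam) :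
    ∃ (r : ℕ) (x : Fin r → R), ∀ L : List (List ℕ × ℕ),
      (∀ k, InCodedSpan σ ν lf.length L (fun _ => 0) (x k)) →
      ComponentCert σ π lam ν ν₀ solve s la lf L := by
  obtain ⟨v, hv, k₀, hk₀, hne⟩ := hnd.exists_eliminant (a := fun i => ν (la.getD i 0)) hs
  set N := la.length * lam - (la.length - 1) with hN
  have hN' : (m + 1) * lam - m = N := by rw [hN, hla, Nat.add_sub_cancel]
  simp only [hN'] at hv hne
  simp only [← hla] at hv hne hk₀
  obtain ⟨lv, -, hlv⟩ := exists_codes hν₀ N v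
  obtain ⟨lb, hb, hlb⟩ := exists_codes hν₀ la.length fun k =>
    ∑ j ∈ range N, v j * shiftEntry σ π la.length (fun i => ν (la.getD i 0)) j (k * lam + s)
  obtain ⟨lφ, hφ, hlφ⟩ := exists_codes hν₀ lf.length fun l =>
    ∑ j ∈ range N, v j * π (σ^[j] (ν (lf.getD l 0)))
  obtain ⟨B, hB, -⟩ := exists_isCodedBasis (ν := ν₀) (P := fun _ a => a ≠ 0) H (m := m)
    (hb.trans hla) hφ (fun h0 => hne (by
      rw [← hlb k₀ hk₀]
      exact congrFun h0 (⟨k₀, by omega⟩ : Fin (m + 1))))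
  choose x hx using fun k => h.exists_single s hs (ν₀ (codedSol B k))
  choose n hn using hν
  refine ⟨B.length, fun k => x k, fun L hL => ⟨(lv, lb, lφ, B), fun c hc hcs => ?_, hb,
    fun k hk => ?_, ⟨k₀, hk₀, ?_⟩, hφ, fun l hl => ?_, hB, fun k hk => ⟨n (x k), ?_, ?_⟩⟩⟩
  · rw [← hv c hc hcs]
    exact sum_congr rfl fun j hj => by rw [hlv j (mem_range.1 hj)]
  · rw [hlb k hk]
    exact sum_congr rfl fun j hj => by rw [hlv j (mem_range.1 hj)]
  · rwa [hlb k₀ hk₀]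
  · rw [hlφ l hl]
    exact sum_congr rfl fun j hj => by rw [hlv j (mem_range.1 hj)]
  · rw [hn]
    exact hx k
  · rw [hn]
    exact hL ⟨k, hk⟩

/-- Completeness: the unit vectors `(e_j, 0)` and the vectors `(0, x)` provided for the components
span a finite-dimensional space. A basis `B` of the kernel of the residual in this space and vectors
`P` whose residuals are linearly independent satisfy the conditions of a certificate. -/
theorem exists_basisCert [IsDomain D] (h : IsCyclicProduct σ τ π lam)
    (hunit : ∀ y : D, τ y = y → y ≠ 0 → IsUnit y)
    (hν : Function.Surjective ν) (hν₀ : Function.Surjective ν₀)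
    (H : ∀ (m d : ℕ) (a : Fin (m + 1) → ℕ) (f : Fin d → ℕ), (fun i => ν₀ (a i)) ≠ 0 →
      ∃ B ∈ solve (List.ofFn a, List.ofFn f),
        IsCodedBasis τ ν₀ (fun i => ν₀ (a i)) (fun j => ν₀ (f j)) B)
    {m : ℕ} {la lf : List ℕ} (hla : la.length = m + 1)
    (hnd : NonDegenerate σ π lam fun i : Fin (m + 1) => ν (la.getD i 0)) :
    ∃ B, BasisCert σ τ π lam ν ν₀ solve la lf B := by
  classical
  have hdata := fun s : Fin lam => exists_componentData (lf := lf) h hν hν₀ H hla hnd s.2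
  choose r x hx using hdata
  set d := lf.length with hd
  set L := residualHom σ la.length d (fun i => ν (la.getD i 0)) (fun j => ν (lf.getD j 0)) with hL
  let w : Fin d ⊕ (Σ s : Fin lam, Fin (r s)) → (Fin d → constants σ) × R :=
    Sum.elim (fun j => (Pi.single j 1, 0)) fun y => (0, x y.1 y.2)
  obtain ⟨n, q, b, p, hLb, hb, hp, hspan⟩ :
      ∃ (n q : ℕ) (b : Fin n → (Fin d → constants σ) × R) (p : Fin q → (Fin d → constants σ) × R),
        (∀ k, L (b k) = 0) ∧ LinearIndependent (constants σ) b ∧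
        LinearIndependent (constants σ) (fun k => L (p k)) ∧
        ∀ i, w i ∈ Submodule.span (constants σ) (Set.range b ∪ Set.range p) := by
    let := (h.isField_constants hunit).toField
    exact exists_kernel_complement L w
  obtain ⟨B, rfl, hB⟩ := exists_codedList hν b
  obtain ⟨P, rfl, hP⟩ := exists_codedList hν p
  have hLB : ∀ k : Fin B.length, L (b k) = residual σ la.length d (fun i => ν (la.getD i 0))
      (fun j => ν (lf.getD j 0)) (fun j => ν (codedConst B k j)) (ν (codedSol B k)) := fun k =>
    residualHom_eq (hB k).2.1 (hB k).2.2
  have hLP : ∀ k : Fin P.length, L (p k) = residual σ la.length d (fun i => ν (la.getD i 0))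
      (fun j => ν (lf.getD j 0)) (fun j => ν (codedConst P k j)) (ν (codedSol P k)) := fun k =>
    residualHom_eq (hP k).2.1 (hP k).2.2
  have hmem : ∀ i c, (∀ j : Fin d, c j = ((w i).1 j : R)) →
      InCodedSpan σ ν d (B ++ P) c (w i).2 := by
    intro i
    refine inCodedSpan_of_mem_span ?_ (hspan i)
    rintro _ (⟨k, rfl⟩ | ⟨k, rfl⟩) c hc
    · have h1 := InCodedSpan.mem (σ := σ) (ν := ν) (d := d) (B := B ++ P) (k := k)
        (by simp; omega)
      rw [codedSol_append_left k.2, (hB k).2.2] at h1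
      refine h1.congr fun j hj => ?_
      rw [codedConst_append_left k.2, hc ⟨j, hj⟩]
      exact ((hB k).2.1 ⟨j, hj⟩).symm
    · have h1 := InCodedSpan.mem (σ := σ) (ν := ν) (d := d) (B := B ++ P) (k := B.length + k)
        (by simp)
      rw [codedSol_append_right, (hP k).2.2] at h1
      refine h1.congr fun j hj => ?_
      rw [codedConst_append_right, hc ⟨j, hj⟩]
      exact ((hP k).2.1 ⟨j, hj⟩).symm
  refine ⟨B, fun k hk => (hB ⟨k, hk⟩).1, fun k hk j hj => ?_, fun k hk => ?_, ?_, P, ?_,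
    fun j hj => ?_, fun s hs => ?_⟩
  · rw [(hB ⟨k, hk⟩).2.1 ⟨j, hj⟩]
    exact ((b ⟨k, hk⟩).1 ⟨j, hj⟩).2
  · exact (hLB ⟨k, hk⟩).symm.trans (hLb ⟨k, hk⟩)
  · refine ConstIndep.of_linearIndependent h hb fun y hy => ?_
    have h1 : ∀ j : Fin d, ∑ k, ((y k : constants σ) : R) * ((b k).1 j : R) = 0 := by
      intro j
      refine h.const_eq_zero ?_ ?_
      · rw [map_sum]
        refine sum_congr rfl fun k _ => ?_
        rw [map_mul, mem_constants.1 (y k).2, mem_constants.1 ((b k).1 j).2]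
      · rw [map_sum, ← hy j (by omega)]
        refine sum_congr rfl fun k _ => ?_
        rw [if_pos (by exact j.2), map_mul, (hB k).2.1]
    have h2 : ∑ k, ((y k : constants σ) : R) * (b k).2 = 0 := by
      refine h.eq_zero _ fun s hs => ?_
      rw [← RingAut.coe_pow, map_sum, map_sum, ← hy (d + s) (by omega)]
      refine sum_congr rfl fun k _ => ?_
      rw [if_neg (by omega), Nat.add_sub_cancel_left, map_mul, map_mul, RingAut.coe_pow,
        Function.iterate_fixed (mem_constants.1 (y k).2), (hB k).2.2]
    refine Prod.ext (funext fun j => Subtype.ext ?_) ?_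
    · rw [Prod.fst_sum, Finset.sum_apply, AddSubmonoidClass.coe_finsetSum]
      exact h1 j
    · rw [Prod.snd_sum]
      exact h2
  · refine ConstIndep.of_linearIndependent h hp fun y hy => ?_
    refine h.eq_zero _ fun s hs => ?_
    rw [← RingAut.coe_pow, map_sum, map_sum, ← hy s hs]
    refine sum_congr rfl fun k _ => ?_
    rw [Subring.smul_def, smul_eq_mul, map_mul, map_mul, RingAut.coe_pow,
      Function.iterate_fixed (mem_constants.1 (y k).2), hLP]
  · refine hmem (Sum.inl ⟨j, hj⟩) _ fun l => ?_
    simp only [w, Sum.elim_inl, Pi.single_apply, Fin.ext_iff]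
    split_ifs <;> rfl
  · exact hx ⟨s, hs⟩ _ fun k => hmem (Sum.inr ⟨⟨s, hs⟩, k⟩) _ fun l => rfl

/-- Non-degenerate equations can be solved in a product of copies of a difference domain, if
equations can be solved in this domain: a certificate is found by search. -/
theorem IsCyclicProduct.canSolvePLDE [IsDomain D] (h : IsCyclicProduct σ τ π lam)
    (hunit : ∀ y : D, τ y = y → y ≠ 0 → IsUnit y)
    (hD : IsField D ∨ ∃ a : D, a ≠ 0 ∧ ∀ x : D, (∀ N, a ^ N ∣ x) → x = 0)
    (hν : IsComputable σ ν) (hν₀ : IsComputable τ ν₀) (hπ : ComputableVal ν₀ fun n => π (ν n))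
    (hsolve : CanSolvePLDE τ ν₀ fun _ a => a ≠ 0) :
    CanSolvePLDE σ ν fun _ a => NonDegenerate σ π lam a := by
  have hind := fun {α : Type} [Primcodable α] {n q : α → ℕ} {u : α → ℕ → ℕ → D} hn hq hu =>
    re_constIndep (α := α) (n := n) (q := q) (u := u) hν₀ hunit hD hsolve hn hq hu
  obtain ⟨solve, hpart, H⟩ := hsolve
  obtain ⟨solve', hpart', H'⟩ := (re_basisCert (lam := lam) hν hν₀ hπ hpart hind).exists_partrec
  refine ⟨solve', hpart', fun m d a f hnd => ?_⟩
  have hget : ∀ {n : ℕ} (x : Fin n → ℕ) (i : Fin n), (List.ofFn x).getD i 0 = x i := by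
    intro n x i
    rw [List.getD_eq_getElem _ _ (by simp)]
    simp
  have hex := exists_basisCert (la := List.ofFn a) (lf := List.ofFn f) h hunit hν.surjective
    hν₀.surjective H List.length_ofFn (by simpa only [hget] using hnd)
  obtain ⟨B, hB, hcert⟩ := H' (List.ofFn a, List.ofFn f) hex
  refine ⟨B, hB, ?_⟩
  have := hcert.isCodedBasis h H (m := m) (d := d) List.length_ofFn List.length_ofFn
  simpa only [hget] using this

end Certificate

end DifferenceRing

namespace DifferenceRing

/-! ### Rings of fractions -/

section Fractions

variable {R D : Type*} [CommRing R] [CommRing D] {σ : R ≃+* R} {τ : D ≃+* D} {π : R →+* D}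
  {lam : ℕ} {ν : ℕ → R} {ν₀ : ℕ → D}

theorem fracAut_mk' (σ : R ≃+* R) (x : R) (y : nonZeroDivisors R) (hy : σ y ∈ nonZeroDivisors R) :
    fracAut σ (IsLocalization.mk' (FractionRing R) x y) =
      IsLocalization.mk' (FractionRing R) (σ x) (⟨σ y, hy⟩ : nonZeroDivisors R) :=
  IsLocalization.ringEquivOfRingEquiv_mk' _ _ _

theorem fracAut_iterate_algebraMap (σ : R ≃+* R) (k : ℕ) (x : R) :
    (fracAut σ)^[k] (algebraMap R (FractionRing R) x) =
      algebraMap R (FractionRing R) (σ^[k] x) := by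
  induction k with
  | zero => rfl
  | succ k ih =>
    rw [Function.iterate_succ_apply', Function.iterate_succ_apply', ih]
    exact IsLocalization.ringEquivOfRingEquiv_eq _ _

theorem map_mem_nonZeroDivisors_of_equiv (σ : R ≃+* R) {x : R} (hx : x ∈ nonZeroDivisors R) :
    σ x ∈ nonZeroDivisors R :=
  MulEquivClass.map_nonZeroDivisors σ ▸ Submonoid.mem_map_of_mem _ hx

theorem IsCyclicProduct.mem_nonZeroDivisors_iff [IsDomain D] (h : IsCyclicProduct σ τ π lam)
    (x : R) : x ∈ nonZeroDivisors R ↔ ∀ s < lam, π (σ^[s] x) ≠ 0 := by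
  rw [mem_nonZeroDivisors_iff_right]
  constructor
  · intro hx s hs h0
    obtain ⟨z, hz⟩ := h.exists_single s hs 1
    have hzx : z * x = 0 := h.eq_zero _ fun s' hs' => by
      rw [iterate_map_mul, map_mul, hz s' hs']
      split_ifs with hss
      · rw [hss, h0, mul_zero]
      · rw [zero_mul]
    have := hz s hs
    rw [hx z hzx, ← RingAut.coe_pow, map_zero, map_zero, if_pos rfl] at this
    exact zero_ne_one this
  · intro hx z hzx
    refine h.eq_zero z fun s hs => ?_
    have := congrArg (fun w => π ((σ ^ s : RingAut R) w)) hzx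
    simp only [map_mul, map_zero, mul_eq_zero, RingAut.coe_pow] at this
    exact this.resolve_right (hx s hs)

/-- The decomposition of `R` into copies of `D` induces one of the rings of fractions. -/
theorem IsCyclicProduct.fractionRing [IsDomain D] (h : IsCyclicProduct σ τ π lam)
    {πQ : FractionRing R →+* FractionRing D}
    (hπQ : ∀ x, πQ (algebraMap R _ x) = algebraMap D _ (π x)) :
    IsCyclicProduct (fracAut σ) (fracAut τ) πQ lam where
  pos := h.pos
  proj_iterate_lam x := by
    have : πQ.comp ((fracAut σ ^ lam : RingAut (FractionRing R)) : FractionRing R →+* _) =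
        ((fracAut τ : FractionRing D →+* FractionRing D)).comp πQ := by
      refine IsLocalization.ringHom_ext (nonZeroDivisors R) (RingHom.ext fun y => ?_)
      have h1 := fracAut_iterate_algebraMap τ 1 (π y)
      simp only [Function.iterate_one] at h1
      simp only [RingHom.comp_apply, RingHom.coe_coe, RingAut.coe_pow]
      rw [fracAut_iterate_algebraMap, hπQ, hπQ, h1, h.proj_iterate_lam]
    have := congrArg (fun φ : FractionRing R →+* FractionRing D => φ x) this
    simpa only [RingHom.comp_apply, RingHom.coe_coe, RingAut.coe_pow] using this
  eq_zero x hx := by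
    obtain ⟨⟨a, b⟩, hab⟩ := IsLocalization.surj (nonZeroDivisors R) x
    dsimp only at hab
    have ha : a = 0 := h.eq_zero a fun s hs => by
      have := congrArg (fun w => πQ ((fracAut σ ^ s : RingAut (FractionRing R)) w)) hab
      simp only [map_mul, RingAut.coe_pow, hx s hs, zero_mul, fracAut_iterate_algebraMap,
        hπQ] at this
      exact (IsFractionRing.injective D (FractionRing D)) (by rw [map_zero, ← this])
    rw [ha, map_zero] at hab
    exact (IsLocalization.map_units (FractionRing R) b).mul_left_eq_zero.1 hab
  exists_single s hs y := by
    obtain ⟨⟨p, q⟩, hpq⟩ := IsLocalization.surj (nonZeroDivisors D) y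
    dsimp only at hpq
    obtain ⟨x, hx⟩ := h.exists_single s hs p
    -- The denominator `q` is repeated in all the components, to obtain a non-zero-divisor of `R`.
    obtain ⟨z, hz⟩ := h.exists_lift fun _ => (q : D)
    have hz' : z ∈ nonZeroDivisors R := (h.mem_nonZeroDivisors_iff z).2 fun s hs => by
      rw [hz s hs]
      exact nonZeroDivisors.ne_zero q.2
    refine ⟨IsLocalization.mk' (FractionRing R) x ⟨z, hz'⟩, fun s' hs' => ?_⟩
    have h1 := IsLocalization.mk'_spec (FractionRing R) x ⟨z, hz'⟩
    have h2 := congrArg (fun w => πQ ((fracAut σ ^ s' : RingAut (FractionRing R)) w)) h1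
    simp only [map_mul, RingAut.coe_pow, fracAut_iterate_algebraMap, hπQ, hz s' hs',
      hx s' hs'] at h2
    refine (IsLocalization.map_units (FractionRing D) q).mul_right_cancel ?_
    rw [h2]
    split_ifs with hss
    · exact hpq.symm
    · rw [map_zero, zero_mul]

theorem fracNumbering_pair {k l : ℕ} (hl : ν l ∈ nonZeroDivisors R) :
    fracNumbering ν (Nat.pair k l) = IsLocalization.mk' (FractionRing R) (ν k)
      (⟨ν l, hl⟩ : nonZeroDivisors R) := by
  simp [fracNumbering, hl]

/-- Numerators and denominators of the elements of the ring of fractions can be computed, also for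
the codes of `0` with a denominator that is a zero divisor. -/
theorem exists_num_den (hν : IsComputable σ ν)
    (hnzd : ComputablePred fun n => ν n ∈ nonZeroDivisors R) :
    ∃ num den : ℕ → ℕ, Computable num ∧ Computable den ∧
      ∀ n, ∃ hd : ν (den n) ∈ nonZeroDivisors R, fracNumbering ν n =
        IsLocalization.mk' (FractionRing R) (ν (num n)) (⟨ν (den n), hd⟩ : nonZeroDivisors R) := by
  classical
  obtain ⟨z, hz⟩ := hν.surjective 0
  obtain ⟨o, ho⟩ := hν.surjective 1
  have hc := (hnzd.comp (f := fun n : ℕ => n.unpair.2) (by fun_prop)).decide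
  refine ⟨fun n => cond (decide (ν n.unpair.2 ∈ nonZeroDivisors R)) n.unpair.1 z,
    fun n => cond (decide (ν n.unpair.2 ∈ nonZeroDivisors R)) n.unpair.2 o,
    Computable.cond hc (by fun_prop) (by fun_prop), Computable.cond hc (by fun_prop) (by fun_prop),
    fun n => ?_⟩
  by_cases hn : ν n.unpair.2 ∈ nonZeroDivisors R
  · simp only [hn, decide_true, cond_true, exists_true_left, fracNumbering, dif_pos]
  · refine ⟨by simp [hn, ho], ?_⟩
    simp only [fracNumbering, hn, dif_neg, not_false_eq_true, decide_false, cond_false, hz,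
      IsLocalization.mk'_zero]

/-- The representation of the ring of fractions by fractions is computable if it can be decided
which elements are zero divisors. -/
theorem IsComputable.fracNumbering (hν : IsComputable σ ν)
    (hnzd : ComputablePred fun n => ν n ∈ nonZeroDivisors R) :
    IsComputable (fracAut σ) (fracNumbering ν) := by
  obtain ⟨num, den, hnum, hden, hfrac⟩ := exists_num_den hν hnzd
  choose hd hfrac using hfrac
  obtain ⟨fa, hfa, hfa'⟩ := hν.add
  obtain ⟨fm, hfm, hfm'⟩ := hν.mul
  obtain ⟨fn, hfn, hfn'⟩ := hν.neg
  obtain ⟨fs, hfs, hfs'⟩ := hν.aut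
  have hfa2 : ∀ {α : Type} [Primcodable α] {f g : α → ℕ}, Computable f → Computable g →
      Computable fun x => fa (f x) (g x) := fun hf hg => hfa.comp hf hg
  have hfm2 : ∀ {α : Type} [Primcodable α] {f g : α → ℕ}, Computable f → Computable g →
      Computable fun x => fm (f x) (g x) := fun hf hg => hfm.comp hf hg
  have hn1 : Computable fun x : ℕ × ℕ => num x.1 := hnum.comp Computable.fst
  have hn2 : Computable fun x : ℕ × ℕ => num x.2 := hnum.comp Computable.snd
  have hd1 : Computable fun x : ℕ × ℕ => den x.1 := hden.comp Computable.fst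
  have hd2 : Computable fun x : ℕ × ℕ => den x.2 := hden.comp Computable.snd
  have hdd : ∀ a b, ν (fm (den a) (den b)) ∈ nonZeroDivisors R := fun a b => by
    rw [hfm']
    exact mul_mem (hd a) (hd b)
  refine ⟨fun q => ?_, ?_, ?_, ?_, ?_, ?_⟩
  · obtain ⟨x, y, rfl⟩ := IsLocalization.exists_mk'_eq (nonZeroDivisors R) q
    obtain ⟨k, hk⟩ := hν.surjective x
    obtain ⟨l, hl⟩ := hν.surjective y
    refine ⟨Nat.pair k l, ?_⟩
    rw [fracNumbering_pair (by rw [hl]; exact y.2)]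
    simp [hk, hl]
  · refine ((hν.eq.comp (f := fun x : ℕ × ℕ => (fm (den x.2) (num x.1), fm (den x.1) (num x.2)))
      ((hfm2 hd2 hn1).pair (hfm2 hd1 hn2)))).of_eq fun x => ?_
    rw [hfrac, hfrac, hfm', hfm', IsLocalization.mk'_eq_iff_eq]
    exact (IsFractionRing.injective R (FractionRing R)).eq_iff.symm
  · refine ⟨fun a b => Nat.pair (fa (fm (num a) (den b)) (fm (num b) (den a))) (fm (den a) (den b)),
      Computable.natPair_fun (hfa2 (hfm2 hn1 hd2) (hfm2 hn2 hd1)) (hfm2 hd1 hd2), fun a b => ?_⟩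
    rw [fracNumbering_pair (hdd a b), hfrac, hfrac, ← IsLocalization.mk'_add]
    congr 1
    · rw [hfa', hfm', hfm']
    · exact Subtype.ext (hfm' _ _)
  · refine ⟨fun a b => Nat.pair (fm (num a) (num b)) (fm (den a) (den b)),
      Computable.natPair_fun (hfm2 hn1 hn2) (hfm2 hd1 hd2), fun a b => ?_⟩
    rw [fracNumbering_pair (hdd a b), hfrac, hfrac, ← IsLocalization.mk'_mul]
    congr 1
    · rw [hfm']
    · exact Subtype.ext (hfm' _ _)
  · refine ⟨fun a => Nat.pair (fn (num a)) (den a), Computable.natPair_fun (hfn.comp hnum) hden,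
      fun a => ?_⟩
    rw [fracNumbering_pair (hd a), hfrac, hfn', IsLocalization.mk'_neg]
  · have hda : ∀ a, σ (ν (den a)) ∈ nonZeroDivisors R := fun a =>
      map_mem_nonZeroDivisors_of_equiv σ (hd a)
    refine ⟨fun a => Nat.pair (fs (num a)) (fs (den a)),
      Computable.natPair_fun (hfs.comp hnum) (hfs.comp hden), fun a => ?_⟩
    rw [fracNumbering_pair (by rw [hfs']; exact hda a), hfrac, fracAut_mk' _ _ _ (hda a)]
    congr 1
    · rw [hfs']
    · exact Subtype.ext (hfs' _)

theorem computableVal_fracMap (hν : IsComputable σ ν)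
    (hnzd : ComputablePred fun n => ν n ∈ nonZeroDivisors R)
    (hπ : ComputableVal ν₀ fun n => π (ν n))
    (hle : nonZeroDivisors R ≤ (nonZeroDivisors D).comap π) :
    ComputableVal (fracNumbering ν₀) fun n =>
      (IsLocalization.map (FractionRing D) π hle : FractionRing R →+* FractionRing D)
        (fracNumbering ν n) := by
  obtain ⟨num, den, hnum, hden, hfrac⟩ := exists_num_den hν hnzd
  obtain ⟨p, hp, hp'⟩ := hπ
  refine ⟨fun n => Nat.pair (p (num n)) (p (den n)),
    Computable.natPair_fun (hp.comp hnum) (hp.comp hden), fun n => ?_⟩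
  obtain ⟨hd, hn⟩ := hfrac n
  have hd' : ν₀ (p (den n)) ∈ nonZeroDivisors D := by
    rw [hp']
    exact hle hd
  dsimp only
  rw [fracNumbering_pair hd', hn, IsLocalization.map_mk']
  congr 1
  · exact hp' _
  · exact Subtype.ext (hp' _)

theorem IsCyclicProduct.computablePred_mem_nonZeroDivisors [IsDomain D]
    (h : IsCyclicProduct σ τ π lam) (hν : IsComputable σ ν) (hν₀ : IsComputable τ ν₀)
    (hπ : ComputableVal ν₀ fun n => π (ν n)) :
    ComputablePred fun n => ν n ∈ nonZeroDivisors R := by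
  refine (ComputableVal.eq hν₀ (ComputableVal.prod hν₀ (w := fun n s => π (σ^[s] (ν n)))
    (fun s => hπ.map (ComputableVal.iterate hν (ComputableVal.of_code (by fun_prop))
      (by fun_prop))) lam) (ComputableVal.const hν₀ 0)).not.of_eq fun n => ?_
  rw [h.mem_nonZeroDivisors_iff, ← ne_eq, Finset.prod_ne_zero_iff]
  simp only [Finset.mem_range]

end Fractions

/-! ### The ring generated by the `Π`- and `Σ`-monomials -/

/-- The span over `C` of a monoid of elements that are linearly independent over `B ⊇ C` is a monoid
algebra over `C`, so it has no zero divisors if `C` has none and the monoid has unique products. -/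
theorem eq_zero_or_eq_zero_of_mem_span {A E G : Type*} [CommRing A] [CommRing E] [Algebra A E]
    [Monoid G] [UniqueProds G] {B C : Subalgebra A E} (hCB : C ≤ B)
    (hC : ∀ x ∈ C, ∀ y ∈ C, x * y = 0 → x = 0 ∨ y = 0) {v : G →* E}
    (hv : LinearIndependent B v) {x y : E} (hx : x ∈ Submodule.span C (Set.range v))
    (hy : y ∈ Submodule.span C (Set.range v)) (hxy : x * y = 0) : x = 0 ∨ y = 0 := by
  have : NoZeroDivisors C := ⟨fun {a b} hab =>
    (hC a a.2 b b.2 (congrArg Subtype.val hab)).imp Subtype.ext Subtype.ext⟩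
  set φ := MonoidAlgebra.lift C E G v with hφ
  have hφ' : ∀ p, φ p = p.coeff.sum fun a b => b • v a := fun p => MonoidAlgebra.lift_apply v p
  have hsurj : ∀ z ∈ Submodule.span C (Set.range v), ∃ p, φ p = z := by
    intro z hz
    obtain ⟨c, rfl⟩ := Finsupp.mem_span_range_iff_exists_finsupp.1 hz
    exact ⟨.ofCoeff c, hφ' _⟩
  have hinj : ∀ p, φ p = 0 → p = 0 := by
    intro p hp
    rw [hφ', Finsupp.sum] at hp
    have h1 := linearIndependent_iff'.1 hv p.coeff.support
      (fun i => ⟨p.coeff i, hCB (p.coeff i).2⟩) hp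
    ext i
    by_contra hi
    have := congrArg Subtype.val (h1 i (Finsupp.mem_support_iff.2 fun h0 => hi (by simp [h0])))
    exact hi (by simpa using this)
  obtain ⟨p, rfl⟩ := hsurj x hx
  obtain ⟨q, rfl⟩ := hsurj y hy
  rw [← map_mul] at hxy
  rcases mul_eq_zero.1 (hinj _ hxy) with h | h
  · exact Or.inl (by rw [h, map_zero])
  · exact Or.inr (by rw [h, map_zero])

/-- In a Noetherian domain that is not a field, no nonzero element is divisible by all powers of
a non-unit. -/
theorem isField_or_exists_forall_pow_dvd {D : Type*} [CommRing D] [IsDomain D]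
    [IsNoetherianRing D] : IsField D ∨ ∃ a : D, a ≠ 0 ∧ ∀ x, (∀ N, a ^ N ∣ x) → x = 0 := by
  by_cases hD : IsField D
  · exact Or.inl hD
  obtain ⟨a, ha, hau⟩ := Ring.exists_not_isUnit_of_not_isField hD
  refine Or.inr ⟨a, ha, fun x hx => ?_⟩
  have h1 := Ideal.iInf_pow_eq_bot_of_isDomain (Ideal.span {a})
    (by rwa [Ne, Ideal.span_singleton_eq_top])
  rw [← Ideal.mem_bot, ← h1, Ideal.mem_iInf]
  intro N
  rw [Ideal.span_singleton_pow, Ideal.mem_span_singleton]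
  exact hx N

namespace IsSingleRExtension

variable {F E : Type*} [Field F] [CommRing E] [Algebra F E]
  {σF : F ≃+* F} {σ : E ≃+* E} {e : ℕ} {kind : Fin (e + 1) → MonomialKind}
  {t : Fin (e + 1) → E} {lam : ℕ} {α : F}

theorem eq_zero_or_eq_zero_of_mem_tildeTower (h : IsSingleRExtension σF σ kind t lam α) (i : ℕ)
    (hi : i ≤ e) : ∀ x ∈ tildeTower F kind t (i + 1), ∀ y ∈ tildeTower F kind t (i + 1),
      x * y = 0 → x = 0 ∨ y = 0 := by
  induction i with
  | zero =>
    have hbot : tildeTower F kind t (0 + 1) = ⊥ := by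
      rw [tildeTower, ← Algebra.adjoin_empty]
      congr 1
      ext x
      simp only [Set.mem_ofPred_eq, Set.mem_empty_iff_false, iff_false, not_exists]
      rintro j ⟨h0, hj, -⟩
      exact h0 (Fin.ext (by simpa using hj))
    rw [hbot]
    intro x hx y hy hxy
    obtain ⟨r, rfl⟩ := Algebra.mem_bot.1 hx
    obtain ⟨s, rfl⟩ := Algebra.mem_bot.1 hy
    rw [← map_mul, map_eq_zero_iff _ h.injective, mul_eq_zero] at hxy
    exact hxy.imp (fun h => by rw [h, map_zero]) fun h => by rw [h, map_zero]
  | succ i ih =>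
    intro x hx y hy hxy
    set j : Fin (e + 1) := ⟨i + 1, by omega⟩ with hj
    have hj0 : j ≠ 0 := by simp [hj, Fin.ext_iff]
    rcases h.kind_ne_zero j hj0 with hk | hk
    · obtain ⟨⟨u, hu, hlin⟩, -⟩ := h.product j hk
      let v : Multiplicative ℤ →* E := (Units.coeHom E).comp (zpowersHom Eˣ u)
      have hv : LinearIndependent (tower F kind t (i + 1)) v := hlin
      have hmem : ∀ x ∈ tildeTower F kind t (i + 1 + 1),
          x ∈ Submodule.span (tildeTower F kind t (i + 1)) (Set.range v) := by
        refine fun x hx => mem_span_of_mem_tildeTower kind t ⟨1, map_one v⟩ ?_ ?_ hx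
        · rintro _ ⟨a, rfl⟩ _ ⟨b, rfl⟩
          exact ⟨a * b, map_mul v a b⟩
        · intro j' hj' x hx
          obtain rfl : j' = j := Fin.ext hj'
          rcases hx with rfl | ⟨-, hx⟩
          · exact ⟨.ofAdd 1, by simp [v, hu]⟩
          · refine ⟨.ofAdd (-1), ?_⟩
            rw [← hu] at hx
            simpa [v] using (Units.eq_inv_of_mul_eq_one_right hx).symm
      exact eq_zero_or_eq_zero_of_mem_span (tildeTower_le_tower kind t (i + 1)) (ih (by omega)) hv
        (hmem x hx) (hmem y hy) hxy
    · obtain ⟨hlin, -⟩ := h.sum j hk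
      let v : Multiplicative ℕ →* E := powersHom E (t j)
      have hv : LinearIndependent (tower F kind t (i + 1)) v := hlin
      have hmem : ∀ x ∈ tildeTower F kind t (i + 1 + 1),
          x ∈ Submodule.span (tildeTower F kind t (i + 1)) (Set.range v) := by
        refine fun x hx => mem_span_of_mem_tildeTower kind t ⟨1, map_one v⟩ ?_ ?_ hx
        · rintro _ ⟨a, rfl⟩ _ ⟨b, rfl⟩
          exact ⟨a * b, map_mul v a b⟩
        · intro j' hj' x hx
          obtain rfl : j' = j := Fin.ext hj'
          rcases hx with rfl | ⟨hx, -⟩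
          · exact ⟨.ofAdd 1, by simp [v]⟩
          · rw [hk] at hx; cases hx
      exact eq_zero_or_eq_zero_of_mem_span (tildeTower_le_tower kind t (i + 1)) (ih (by omega)) hv
        (hmem x hx) (hmem y hy) hxy

theorem isDomain_tilde (h : IsSingleRExtension σF σ kind t lam α) :
    IsDomain (tilde F kind t) := by
  have : Nontrivial E := h.injective.nontrivial
  have : NoZeroDivisors (tilde F kind t) := ⟨fun {x y} hxy =>
    (h.eq_zero_or_eq_zero_of_mem_tildeTower e le_rfl x x.2 y y.2
      (congrArg Subtype.val hxy)).imp Subtype.ext Subtype.ext⟩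
  exact NoZeroDivisors.to_isDomain _

theorem isNoetherianRing_tilde : IsNoetherianRing (tilde F kind t) := by
  refine isNoetherianRing_of_fg (Subalgebra.fg_def.2 ⟨_, Set.Finite.subset
    ((Set.finite_range t).union (Set.finite_range fun j => Ring.inverse (t j))) ?_, rfl⟩)
  rintro x ⟨j, -, -, rfl | ⟨-, hx⟩⟩
  · exact Or.inl ⟨j, rfl⟩
  · refine Or.inr ⟨j, ?_⟩
    have hu : t j * x = 1 := by rw [mul_comm, hx]
    exact Ring.inverse_unit ⟨t j, x, hu, hx⟩

/-! ### The components of `E` -/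

theorem ne_zero_lam (h : IsSingleRExtension σF σ kind t lam α) : (lam : F) ≠ 0 := by
  have : NeZero lam := ⟨by have := h.one_lt; omega⟩
  exact h.isPrimitiveRoot.neZero'.ne

theorem sum_pow_root (h : IsSingleRExtension σF σ kind t lam α) (k : ℕ) :
    ∑ i ∈ Finset.range lam, (α ^ k) ^ i = if lam ∣ k then (lam : F) else 0 := by
  split_ifs with hk
  · simp [(h.isPrimitiveRoot.pow_eq_one_iff_dvd k).2 hk]
  · have h1 : α ^ k - 1 ≠ 0 := fun h0 =>
      hk ((h.isPrimitiveRoot.pow_eq_one_iff_dvd k).1 (sub_eq_zero.1 h0))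
    refine (mul_eq_zero.1 (?_ : _ * (α ^ k - 1) = 0)).resolve_right h1
    rw [geom_sum_mul, ← pow_mul, mul_comm, pow_mul, h.isPrimitiveRoot.pow_eq_one, one_pow,
      sub_self]

theorem iterate_cofactor (h : IsSingleRExtension σF σ kind t lam α) (k : ℕ) :
    σ^[k] (cofactor lam (α ^ (lam - 1)) (t 0)) =
      ∑ i ∈ Finset.range lam, algebraMap F E ((α ^ k) ^ i) *
        (t 0 ^ i * algebraMap F E (α ^ (lam - 1)) ^ (lam - 1 - i)) := by
  have h1 : σ^[k] (algebraMap F E (α ^ (lam - 1))) = algebraMap F E (α ^ (lam - 1)) :=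
    Function.iterate_fixed (by rw [h.extends_aut, map_pow, h.map_α]) k
  rw [cofactor, ← RingAut.coe_pow, map_sum]
  refine Finset.sum_congr rfl fun i _ => ?_
  rw [map_mul, map_pow, map_pow, RingAut.coe_pow, h1, h.iterate_y, mul_pow, ← mul_assoc, map_pow,
    map_pow, map_pow]

/-- Up to the factor `lam * (α ^ (lam - 1)) ^ (lam - 1)`, the cofactor of `y - α ^ (lam - 1)` in
`y ^ lam - 1` is the idempotent of the first component of `E`. -/
theorem proj_iterate_cofactor (h : IsSingleRExtension σF σ kind t lam α) (k : ℕ) :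
    h.proj (σ^[k] (cofactor lam (α ^ (lam - 1)) (t 0))) =
      if lam ∣ k then algebraMap F _ (lam * (α ^ (lam - 1)) ^ (lam - 1)) else 0 := by
  have h1 : ∀ i ∈ Finset.range lam, h.proj (algebraMap F E ((α ^ k) ^ i) *
      (t 0 ^ i * algebraMap F E (α ^ (lam - 1)) ^ (lam - 1 - i))) =
        algebraMap F _ ((α ^ k) ^ i * (α ^ (lam - 1)) ^ (lam - 1)) := by
    intro i hi
    rw [map_mul, map_mul, AlgHom.commutes, map_pow h.proj (t 0), h.proj_y,
      map_pow h.proj (algebraMap F E _), AlgHom.commutes, ← pow_add,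
      Nat.add_sub_of_le (by have := Finset.mem_range.1 hi; omega), map_mul,
      map_pow (algebraMap F _) (α ^ (lam - 1))]
  rw [h.iterate_cofactor, map_sum, Finset.sum_congr rfl h1, ← map_sum, ← Finset.sum_mul,
    h.sum_pow_root]
  split_ifs <;> simp

theorem sum_iterate_cofactor (h : IsSingleRExtension σF σ kind t lam α) :
    ∑ k ∈ Finset.range lam, σ^[k] (cofactor lam (α ^ (lam - 1)) (t 0)) =
      algebraMap F E (lam * (α ^ (lam - 1)) ^ (lam - 1)) := by
  have hl := h.one_lt
  have h1 : ∀ i, ∑ k ∈ Finset.range lam, algebraMap F E ((α ^ k) ^ i) =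
      if i = 0 then (lam : E) else ∑ k ∈ Finset.range lam, algebraMap F E ((α ^ i) ^ k) := by
    intro i
    split_ifs with hi
    · simp [hi]
    · exact Finset.sum_congr rfl fun k _ => by rw [← pow_mul, ← pow_mul, mul_comm]
  simp only [h.iterate_cofactor]
  rw [Finset.sum_comm, Finset.sum_eq_single_of_mem 0 (Finset.mem_range.2 (by omega))]
  · simp
  · intro i hi hi0
    rw [← Finset.sum_mul, h1, if_neg hi0, ← map_sum, h.sum_pow_root, if_neg, map_zero, zero_mul]
    exact Nat.not_dvd_of_pos_of_lt (by omega) (Finset.mem_range.1 hi)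

theorem isUnit_weight (h : IsSingleRExtension σF σ kind t lam α) :
    IsUnit ((lam : F) * (α ^ (lam - 1)) ^ (lam - 1)) :=
  have h0 : α ≠ 0 := h.isPrimitiveRoot.ne_zero (by have := h.one_lt; omega)
  (mul_ne_zero h.ne_zero_lam (pow_ne_zero _ (pow_ne_zero _ h0))).isUnit

/-- The ring `E` is the product of `lam` copies of `Ẽ`, which `σ` permutes cyclically: the shifted
cofactors `σ ^ k (q)` are, up to a common unit, the idempotents of the components, and sum to this
unit. -/
theorem isCyclicProduct (h : IsSingleRExtension σF σ kind t lam α) :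
    IsCyclicProduct σ h.sigmaZero (h.proj : E →+* tilde F kind t) lam where
  pos := by have := h.one_lt; omega
  proj_iterate_lam x := by
    have h1 := h.proj_iterate_proj (σ ^ lam : RingAut E)
      (by rw [RingAut.coe_pow, h.iterate_lam_root]) x
    rw [RingAut.coe_pow] at h1
    exact h1.symm
  eq_zero x hx := by
    set q := cofactor lam (α ^ (lam - 1)) (t 0) with hq
    have h1 : ∀ s < lam, σ^[lam - 1 - s + 1] q * σ^[lam] x = 0 := by
      intro s hs
      have h2 : q * σ^[s] x = 0 := by
        rw [hq, ← h.cofactor_mul_proj, show h.proj (σ^[s] x) = 0 from hx s hs,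
          ZeroMemClass.coe_zero, mul_zero]
      have h3 := congrArg (σ ^ (lam - 1 - s + 1) : RingAut E) h2
      rw [map_mul, map_zero, RingAut.coe_pow, ← Function.iterate_add_apply] at h3
      rwa [show lam - 1 - s + 1 + s = lam by omega] at h3
    have h2 : ∑ s ∈ Finset.range lam, σ^[lam - 1 - s + 1] q =
        algebraMap F E (σF (lam * (α ^ (lam - 1)) ^ (lam - 1))) := by
      rw [Finset.sum_range_reflect fun s => σ^[s + 1] q, ← h.extends_aut,
        ← h.sum_iterate_cofactor, map_sum]
      exact Finset.sum_congr rfl fun k _ => Function.iterate_succ_apply' _ _ _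
    have h3 : algebraMap F E (σF (lam * (α ^ (lam - 1)) ^ (lam - 1))) * σ^[lam] x = 0 := by
      rw [← h2, Finset.sum_mul]
      exact Finset.sum_eq_zero fun s hs => h1 s (Finset.mem_range.1 hs)
    rw [((h.isUnit_weight.map σF).map (algebraMap F E)).mul_right_eq_zero,
      ← RingAut.coe_pow] at h3
    exact (map_eq_zero_iff _ (σ ^ lam : RingAut E).injective).1 h3
  exists_single s hs y := by
    obtain ⟨w, hw⟩ := h.isUnit_weight.exists_right_inv
    refine ⟨σ^[lam - s] (cofactor lam (α ^ (lam - 1)) (t 0) *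
      (h.sigmaZero.symm (algebraMap F _ w * y) : tilde F kind t)), fun s' hs' => ?_⟩
    rw [← Function.iterate_add_apply, iterate_map_mul, map_mul]
    change h.proj _ * h.proj _ = _
    rw [h.proj_iterate_cofactor]
    by_cases hss : s' = s
    · rw [if_pos hss, show s' + (lam - s) = lam by omega, if_pos dvd_rfl]
      change _ * h.sigmaZero (h.sigmaZero.symm _) = y
      rw [RingEquiv.apply_symm_apply, ← mul_assoc, ← map_mul, hw, map_one, one_mul]
    · rw [if_neg, if_neg hss, zero_mul]
      intro hd
      obtain ⟨k, hk⟩ := hd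
      rcases k with _ | _ | k
      · omega
      · omega
      · have h1 : lam * (k + 1 + 1) = lam * k + 2 * lam := by ring
        omega

/-! ### Constants and computability of the first component -/

/-- A constant of `σ₀` is the projection of a constant of `σ`. -/
theorem exists_of_sigmaZero_eq (h : IsSingleRExtension σF σ kind t lam α) {y : tilde F kind t}
    (hy : h.sigmaZero y = y) : ∃ c : F, algebraMap F _ c = y := by
  obtain ⟨x, hx, rfl⟩ := h.isCyclicProduct.exists_const hy
  obtain ⟨c, -, rfl⟩ := h.constants_eq x hx
  exact ⟨c, (h.proj.commutes c).symm⟩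

theorem isUnit_of_sigmaZero_eq (h : IsSingleRExtension σF σ kind t lam α) {y : tilde F kind t}
    (hy : h.sigmaZero y = y) (h0 : y ≠ 0) : IsUnit y := by
  obtain ⟨c, rfl⟩ := h.exists_of_sigmaZero_eq hy
  refine (IsUnit.mk0 c ?_).map _
  rintro rfl
  exact h0 (map_zero _)

/-- An equation in `E` that characterizes the projection, so that it can be decided. -/
theorem proj_eq_iff (h : IsSingleRExtension σF σ kind t lam α) (x : E) (y : tilde F kind t) :
    h.proj x = y ↔ cofactor lam (α ^ (lam - 1)) (t 0) * x =
      cofactor lam (α ^ (lam - 1)) (t 0) * (y : E) := by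
  rw [← h.cofactor_mul_proj x, ← sub_eq_zero (a := _ * _), ← mul_sub]
  refine ⟨fun hxy => by rw [hxy, sub_self, mul_zero], fun hxy => sub_eq_zero.1 (Subtype.ext ?_)⟩
  exact h.eq_zero_of_cofactor_mul e le_rfl _ (h.proj x - y).2 hxy

theorem computableVal_proj (h : IsSingleRExtension σF σ kind t lam α) {ν : ℕ → E}
    (hν : IsComputable σ ν) {ν₀ : ℕ → tilde F kind t}
    (hν₀ : IsComputableSubring (tilde F kind t) ν₀ ν) :
    ComputableVal ν₀ fun n => (h.proj : E →+* tilde F kind t) (ν n) := by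
  obtain ⟨hsurj, f, hf, hf'⟩ := hν₀
  refine ComputableVal.of_search hsurj ?_
  refine (ComputableVal.eq hν (u := fun x : ℕ × ℕ => cofactor lam (α ^ (lam - 1)) (t 0) * ν x.1)
    (v := fun x : ℕ × ℕ => cofactor lam (α ^ (lam - 1)) (t 0) * ν (f x.2))
    (.mul hν (.const hν _) (.of_code Computable.fst))
    (.mul hν (.const hν _) (.of_code (hf.comp Computable.snd)))).of_eq fun x => ?_
  rw [hf']
  exact (h.proj_eq_iff _ _).symm

theorem isComputable_sigmaZero (h : IsSingleRExtension σF σ kind t lam α) {ν : ℕ → E}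
    (hν : IsComputable σ ν) {ν₀ : ℕ → tilde F kind t}
    (hν₀ : IsComputableSubring (tilde F kind t) ν₀ ν) : IsComputable h.sigmaZero ν₀ := by
  have hproj := h.computableVal_proj hν hν₀
  obtain ⟨hsurj, f, hf, hf'⟩ := hν₀
  have h1 : ComputableVal ν fun x : ℕ × ℕ => (ν₀ x.1 : E) :=
    ⟨fun x => f x.1, hf.comp Computable.fst, fun x => hf' x.1⟩
  have h2 : ComputableVal ν fun x : ℕ × ℕ => (ν₀ x.2 : E) :=
    ⟨fun x => f x.2, hf.comp Computable.snd, fun x => hf' x.2⟩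
  have h3 : ComputableVal ν fun x : ℕ => (ν₀ x : E) := ⟨f, hf, hf'⟩
  refine ⟨hsurj, ?_, ?_, ?_, ?_, ?_⟩
  · exact (ComputableVal.eq hν h1 h2).of_eq fun x => Subtype.ext_iff.symm
  · obtain ⟨g, hg, hg'⟩ := hproj.map (.add hν h1 h2)
    exact ⟨fun a b => g (a, b), hg, fun a b => (hg' (a, b)).trans (h.proj_coe (ν₀ a + ν₀ b))⟩
  · obtain ⟨g, hg, hg'⟩ := hproj.map (.mul hν h1 h2)
    exact ⟨fun a b => g (a, b), hg, fun a b => (hg' (a, b)).trans (h.proj_coe (ν₀ a * ν₀ b))⟩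
  · obtain ⟨g, hg, hg'⟩ := hproj.map (.neg hν h3)
    exact ⟨g, hg, fun a => (hg' a).trans (h.proj_coe (-ν₀ a))⟩
  · obtain ⟨g, hg, hg'⟩ := hproj.map (.iterate hν h3 (Computable.const lam))
    exact ⟨g, hg, hg'⟩

end IsSingleRExtension

end DifferenceRing

/-! ### Solving non-degenerate equations -/

theorem mainTheorem6 {F : Type*} {E : Type*} [Field F] [CommRing E] [Algebra F E]
    (σF : F ≃+* F) (hstable : ConstantStable σF) (σ : E ≃+* E)
    (e : ℕ) (kind : Fin (e + 1) → MonomialKind) (t : Fin (e + 1) → E) (lam : ℕ) (α : F)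
    (h : IsSingleRExtension σF σ kind t lam α)
    (ν : ℕ → E) (hν : IsComputable σ ν)
    (ν₀ : ℕ → tilde F kind t) (hν₀ : IsComputableSubring (tilde F kind t) ν₀ ν) :
    (CanSolvePLDE h.sigmaZero ν₀ (fun _ a => a ≠ 0) →
      CanSolvePLDE σ ν (fun _ a => NonDegenerate σ (h.proj : E →+* tilde F kind t) lam a)) ∧
    (CanSolvePLDE (fracAut h.sigmaZero) (fracNumbering ν₀) (fun _ a => a ≠ 0) →
      CanSolvePLDE (fracAut σ) (fracNumbering ν)
        (fun _ a => NonDegenerate (fracAut σ) h.fracProj lam a)) := by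
  have := h.isDomain_tilde
  have : IsNoetherianRing (tilde F kind t) := IsSingleRExtension.isNoetherianRing_tilde
  have hcyc := h.isCyclicProduct
  have hcomp := h.isComputable_sigmaZero hν hν₀
  have hproj := h.computableVal_proj hν hν₀
  refine ⟨fun hsolve => hcyc.canSolvePLDE (fun _ => h.isUnit_of_sigmaZero_eq)
    isField_or_exists_forall_pow_dvd hν hcomp hproj hsolve, fun hsolve => ?_⟩
  have hnzd := hcyc.computablePred_mem_nonZeroDivisors hν hcomp hproj
  have hnzd₀ : ComputablePred fun n => ν₀ n ∈ nonZeroDivisors (tilde F kind t) :=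
    (ComputableVal.eq hcomp (.of_code Computable.id) (.const hcomp 0)).not.of_eq
      fun n => mem_nonZeroDivisors_iff_ne_zero.symm
  exact (hcyc.fractionRing fun x => IsLocalization.map_eq h.nonZeroDivisors_le_comap x).canSolvePLDE
    (fun y _ hy => hy.isUnit) (Or.inl (Field.toIsField _)) (hν.fracNumbering hnzd)
    (hcomp.fracNumbering hnzd₀) (computableVal_fracMap hν hnzd hproj h.nonZeroDivisors_le_comap)
    hsolve
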